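/- **Setting.** Let $d\ge 1$, $T>0$, and let $U$ be a non-empty compact metric space. $\mathcal P_c(\mathbb R^d)$ is the set of compactly supported Borel probability measures on $\mathbb R^d$; $B(0,R)$ is the closed ball; $\mathcal P(K)$ is the set of measures concentrated on $K$; $\mathcal M_1(\mu)=\int|x|\,d\mu$. $\Gamma(\mu,\nu)$ is the set of transport plans between $\mu$ and $\nu$; for $\boldsymbol\mu\in\Gamma(\mu_1,\mu_2)$ put $W_{2,\boldsymbol\mu}(\mu_1,\mu_2)=\big(\int|x-y|^2d\boldsymbol\mu\big)^{1/2}$ and $\boldsymbol\mu^{1\to2}_\lambda=((1-\lambda)\pi^1+\lambda\pi^2)_\#\boldsymbol\mu$. $W_p$ is the $p$-Wasserstein distance and $\Gamma_o(\mu,\nu)$ the set of $2$-optimal plans. "A.e. $t$" means Lebesgue-a.e. $t\in[0,T]$. Let $v:[0,T]\times\mathcal P_c(\mathbb R^d)\times U\times\mathbb R^d\to\mathbb R^d$ and $\varphi:\mathcal P_c(\mathbb R^d)\to\mathbb R$. **Local differentiability.** For $\phi:\mathcal P_c(\mathbb R^d)\to\mathbb R$ and $\mu\in\mathcal P_c(\mathbb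 R^d)$, $\partial^-\phi(\mu)$ is the set of $\xi\in L^2(\mu;\mathbb R^d)$ such that for every $R>0$ and every $\nu\in\mathcal P\big(\bigcup_{x\in\mathrm{supp}\,\mu}B(x,R)\big)$, $$\phi(\nu)-\phi(\mu)\ge\inf_{\gamma\in\Gamma_o(\mu,\nu)}\int\langle\xi(x),y-x\rangle\,d\gamma(x,y)+o_R(W_2(\mu,\nu)),$$ and $\partial^+\phi(\mu)=-\partial^-(-\phi)(\mu)$. $\phi$ is locally differentiable at $\mu$ if there is an element $\nabla\phi(\mu)$ of the $L^2(\mu)$-closure of $\{\nabla\psi:\psi\in C_c^\infty(\mathbb R^d)\}$ that belongs to both $\partial^-\phi(\mu)$ and $\partial^+\phi(\mu)$; it is then unique. For vector-valued maps this is understood componentwise, and $\mathrm D_\mu$ denotes the matrix field whose rows are the gradients of the components. **(OCP).** There are $m\in L^1([0,T],\mathbb R_+)$ and, for every $K=B(0,R)$ with $R>0$, functions $l_K,L_K\in L^1([0,T],\mathbb R_+)$, all independent of $u$, such that for every $u\in U$: 1. $t\mapsto v(t,\mu,u,x)$ is Lebesgue measurable for all $(\mu,x)$, and $|v(t,\mu,u,x)|\le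 m(t)(1+|x|+\mathcal M_1(\mu))$ for a.e. $t$ and all $(\mu,x)$; 2. for a.e. $t$, all $\mu,\nu\in\mathcal P(K)$ and $x,y\in K$: $|v(t,\mu,u,x)-v(t,\mu,u,y)|\le l_K(t)|x-y|$ and $|v(t,\mu,u,x)-v(t,\nu,u,x)|\le L_K(t)W_1(\mu,\nu)$; 3. for a.e. $t$, $x\mapsto v(t,\mu,u,x)$ is differentiable for all $\mu$, and $(\mu,x)\mapsto \mathrm D_xv(t,\mu,u,x)$ is continuous on $(\mathcal P(K),W_1)\times K$; 4. for a.e. $t$, $\mu\mapsto v(t,\mu,u,x)$ is locally differentiable for all $x$, and $(\mu,x,y)\mapsto \mathrm D_\mu v(t,\mu,u,x)(y)$ (for a suitable representative) is continuous on $(\mathcal P(K),W_1)\times K\times K$. Moreover $u\mapsto v(t,\mu,u,x)$ is continuous for a.e. $t$ and all $(\mu,x)$; $\varphi$ is $W_1$-Lipschitz on $\mathcal P(K)$ for every $K=B(0,R)$, and locally differentiable, with $\nabla\varphi(\mu)$ having a continuous representative for every $\mu$. **(SC2).** For every $K=B(0,R)$ with $R>0$: 1. there is $\mathcal C_K\in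 L^1([0,T],\mathbb R_+)$ such that for every $u\in U$, all $\mu_1,\mu_2\in\mathcal P(K)$, $\boldsymbol\mu\in\Gamma(\mu_1,\mu_2)$ and $x,y\in K$, $$\big|(1-\lambda)v(t,\mu_1,u,x)+\lambda v(t,\mu_2,u,y)-v(t,\boldsymbol\mu^{1\to2}_\lambda,u,(1-\lambda)x+\lambda y)\big|\le\mathcal C_K(t)\lambda(1-\lambda)\big(|x-y|^2+W_{2,\boldsymbol\mu}^2(\mu_1,\mu_2)\big)$$ for a.e. $t$ and all $\lambda\in[0,1]$; 2. there is $C_K>0$ such that for all $\mu_1,\mu_2\in\mathcal P(K)$, $\boldsymbol\mu\in\Gamma(\mu_1,\mu_2)$ and $\lambda\in[0,1]$, $$(1-\lambda)\varphi(\mu_1)+\lambda\varphi(\mu_2)-\varphi(\boldsymbol\mu^{1\to2}_\lambda)\le C_K\lambda(1-\lambda)W_{2,\boldsymbol\mu}^2(\mu_1,\mu_2).$$ **Value function.** For $(\tau,\mu_\tau)\in[0,T]\times\mathcal P_c(\mathbb R^d)$, $\mathcal V(\tau,\mu_\tau)$ is the infimum of $\varphi(\mu(T))$ over all Lebesgue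 measurable controls $u:[0,T]\to U$ and all $W_1$-continuous curves $\mu:[\tau,T]\to\mathcal P_c(\mathbb R^d)$ with $\mu(\tau)=\mu_\tau$ that solve $\partial_t\mu(t)+\mathrm{div}_x\big(v(t,\mu(t),u(t))\mu(t)\big)=0$ on $(\tau,T)\times\mathbb R^d$ in the sense of distributions. **Theorem (local strong semiconcavity of the value function).** Assume (OCP) and (SC2). Then $\mathcal V$ is well defined and finite on $[0,T]\times\mathcal P_c(\mathbb R^d)$, and for every $K=B(0,r)$ with $r>0$ there is a constant $\mathcal C_K>0$ such that for every $\tau\in[0,T]$, all $\mu_1,\mu_2\in\mathcal P(K)$, all $\lambda\in[0,1]$ and each $\boldsymbol\mu\in\Gamma(\mu_1,\mu_2)$, $$(1-\lambda)\mathcal V(\tau,\mu_1)+\lambda\mathcal V(\tau,\mu_2)-\mathcal V(\tau,\boldsymbol\mu^{1\to2}_\lambda)\le\mathcal C_K\,\lambda(1-\lambda)W_{2,\boldsymbol\mu}^2(\mu_1,\mu_2).$$ -/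

import Mathlib

open MeasureTheory Set Filter Topology
open scoped ContDiff

namespace MeanField

noncomputable section

/-- The state space `ℝ^d` with its Euclidean norm. -/
abbrev Rd (d : ℕ) : Type := EuclideanSpace ℝ (Fin d)

/-- Borel probability measures on `ℝ^d` with compact support. A Borel measure on `ℝ^d` gives no mass
to the complement of its support, so the support is compact if and only if some closed ball has
full measure. -/
def Pc (d : ℕ) : Type :=
  {μ : Measure (Rd d) // IsProbabilityMeasure μ ∧ ∃ R : ℝ, μ (Metric.closedBall 0 R)ᶜ = 0}

/-- The measure underlying an element of `Pc d`. -/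
def Pc.meas {d : ℕ} (μ : Pc d) : Measure (Rd d) := μ.1

/-- `μ` belongs to `𝒫(K)` for a (closed) set `K`. -/
def Pc.LivesOn {d : ℕ} (μ : Pc d) (K : Set (Rd d)) : Prop := μ.meas Kᶜ = 0

/-- `B(0, R)`. -/
abbrev ball0 (d : ℕ) (R : ℝ) : Set (Rd d) := Metric.closedBall 0 R

/-- The first moment `∫ |x| dμ(x)`. -/
def moment1 {d : ℕ} (μ : Pc d) : ℝ := ∫ x, ‖x‖ ∂μ.meas

/-! Optimal transport -/

/-- The set `Γ(μ, ν)` of transport plans (the marginals force a plan to be a probability measure). -/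
def transportPlans {d : ℕ} (μ ν : Pc d) : Set (Measure (Rd d × Rd d)) :=
  {γ | γ.map Prod.fst = μ.meas ∧ γ.map Prod.snd = ν.meas}

/-- `W_{p,γ} = (∫ |x - y|^p dγ(x, y))^{1/p}`. -/
def planCost {d : ℕ} (p : ℝ) (γ : Measure (Rd d × Rd d)) : ℝ :=
  (∫ z, ‖z.1 - z.2‖ ^ p ∂γ) ^ (1 / p)

/-- The Wasserstein distance `W_p`. -/
def wasserstein {d : ℕ} (p : ℝ) (μ ν : Pc d) : ℝ :=
  sInf (planCost p '' transportPlans μ ν)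

/-- The `p`-optimal transport plans. -/
def optimalPlans {d : ℕ} (p : ℝ) (μ ν : Pc d) : Set (Measure (Rd d × Rd d)) :=
  {γ | γ ∈ transportPlans μ ν ∧ planCost p γ = wasserstein p μ ν}

theorem interp_mem {d : ℕ} {μ₁ μ₂ : Pc d} (γ : transportPlans μ₁ μ₂) (s : ℝ) :
    IsProbabilityMeasure (γ.1.map fun z => (1 - s) • z.1 + s • z.2) ∧
      ∃ R : ℝ, (γ.1.map fun z => (1 - s) • z.1 + s • z.2) (Metric.closedBall 0 R)ᶜ = 0 := by
  obtain ⟨γ, h1, h2⟩ := γ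
  obtain ⟨μ₁, hp1, R₁, hR₁⟩ := μ₁
  obtain ⟨μ₂, hp2, R₂, hR₂⟩ := μ₂
  simp only [Pc.meas] at h1 h2
  have hm : Measurable fun z : Rd d × Rd d => (1 - s) • z.1 + s • z.2 := by fun_prop
  have hγ : IsProbabilityMeasure γ := by
    constructor
    have := hp1.measure_univ
    rw [← h1, Measure.map_apply measurable_fst MeasurableSet.univ] at this
    simpa using this
  refine ⟨Measure.isProbabilityMeasure_map hm.aemeasurable, |1 - s| * R₁ + |s| * R₂, ?_⟩
  rw [Measure.map_apply hm Metric.isClosed_closedBall.measurableSet.compl]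
  rw [← h1, Measure.map_apply measurable_fst Metric.isClosed_closedBall.measurableSet.compl] at hR₁
  rw [← h2, Measure.map_apply measurable_snd Metric.isClosed_closedBall.measurableSet.compl] at hR₂
  refine measure_mono_null ?_ (measure_union_null hR₁ hR₂)
  intro z hz
  by_contra hcon
  simp only [mem_union, mem_preimage, mem_compl_iff, mem_closedBall_zero_iff, not_or, not_not]
    at hcon hz
  apply hz
  calc ‖(1 - s) • z.1 + s • z.2‖ ≤ ‖(1 - s) • z.1‖ + ‖s • z.2‖ := norm_add_le _ _
    _ = |1 - s| * ‖z.1‖ + |s| * ‖z.2‖ := by simp [norm_smul]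
    _ ≤ _ := by gcongr <;> tauto

/-- The interpolation `((1 - s) π¹ + s π²)_# γ` along a transport plan `γ`. -/
def interp {d : ℕ} {μ₁ μ₂ : Pc d} (γ : transportPlans μ₁ μ₂) (s : ℝ) : Pc d :=
  ⟨γ.1.map fun z => (1 - s) • z.1 + s • z.2, interp_mem γ s⟩

/-- Local strong semiconcavity of a functional on `𝒫_c(ℝ^d)`. -/
def StronglySemiconcave {d : ℕ} (φ : Pc d → ℝ) : Prop :=
  ∀ R > 0, ∃ C > 0, ∀ μ₁ μ₂ : Pc d, μ₁.LivesOn (ball0 d R) → μ₂.LivesOn (ball0 d R) →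
    ∀ γ : transportPlans μ₁ μ₂, ∀ s ∈ Icc (0 : ℝ) 1,
      (1 - s) * φ μ₁ + s * φ μ₂ - φ (interp γ s) ≤ C * (s * (1 - s)) * planCost 2 γ.1 ^ 2

/-! Differential calculus on `𝒫_c(ℝ^d)` -/

/-- The analytical tangent space: the `L²(μ)`-closure of the gradients of functions in `C_c^∞`. -/
def tangentSpace {d : ℕ} (μ : Pc d) : Set (Lp (Rd d) 2 μ.meas) :=
  closure {f | ∃ ψ : Rd d → ℝ, ContDiff ℝ ∞ ψ ∧ HasCompactSupport ψ ∧
    (f : Rd d → Rd d) =ᵐ[μ.meas] gradient ψ}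

/-- The `R`-fattening of the support of `μ`. -/
def fattening {d : ℕ} (μ : Pc d) (R : ℝ) : Set (Rd d) :=
  ⋃ x ∈ μ.meas.support, Metric.closedBall x R

/-- The localised classical Fréchet subdifferential. The remainder `o_R(W₂(μ, ν))` is uniform over
the measures `ν` that live on the `R`-fattening of the support of `μ`. -/
def subdiff {d : ℕ} (φ : Pc d → ℝ) (μ : Pc d) : Set (Lp (Rd d) 2 μ.meas) :=
  {ξ | ∀ R > 0, ∀ ε > 0, ∃ δ > 0, ∀ ν : Pc d, ν.LivesOn (fattening μ R) →
    wasserstein 2 μ ν ≤ δ →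
      sInf ((fun γ : Measure (Rd d × Rd d) => ∫ z, inner ℝ (ξ z.1) (z.2 - z.1) ∂γ) ''
        optimalPlans 2 μ ν) - ε * wasserstein 2 μ ν ≤ φ ν - φ μ}

/-- The localised classical Fréchet superdifferential. -/
def superdiff {d : ℕ} (φ : Pc d → ℝ) (μ : Pc d) : Set (Lp (Rd d) 2 μ.meas) :=
  {ξ | -ξ ∈ subdiff (fun ν => -φ ν) μ}

/-- `g` represents the Wasserstein gradient of `φ` at `μ`, that is the (unique) element of the
tangent space that is both a sub- and a supergradient. The functional `φ` is locally differentiable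
at `μ` when such a `g` exists. -/
def IsWassersteinGradient {d : ℕ} (φ : Pc d → ℝ) (μ : Pc d) (g : Rd d → Rd d) : Prop :=
  ∃ ξ : Lp (Rd d) 2 μ.meas, (ξ : Rd d → Rd d) =ᵐ[μ.meas] g ∧
    ξ ∈ tangentSpace μ ∧ ξ ∈ subdiff φ μ ∧ ξ ∈ superdiff φ μ

/-! Hypotheses on the data -/

/-- `f ∈ L¹([0,T], ℝ₊)`. -/
def IsL1Nonneg (T : ℝ) (f : ℝ → ℝ) : Prop :=
  IntegrableOn f (Icc 0 T) ∧ ∀ t ∈ Icc 0 T, 0 ≤ f t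

/-- The hypotheses on a non-local velocity field `w : [0,T] × 𝒫_c(ℝ^d) × ℝ^d → ℝ^d`, with
sublinearity bound `m` and, for `K = B(0, R)`, Lipschitz bounds `l R` in space and `L R` in the
measure. Continuity on `𝒫(K)` refers to the distance `W₁`. -/
structure CE {d : ℕ} (T : ℝ) (m : ℝ → ℝ) (l L : ℝ → ℝ → ℝ)
    (w : ℝ → Pc d → Rd d → Rd d) : Prop where
  measurable : ∀ μ x, AEMeasurable (fun t => w t μ x) (volume.restrict (Icc 0 T))
  sublinear : ∀ᵐ t ∂volume.restrict (Icc 0 T), ∀ μ x, ‖w t μ x‖ ≤ m t * (1 + ‖x‖ + moment1 μ)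
  lipschitz_space : ∀ R > 0, ∀ᵐ t ∂volume.restrict (Icc 0 T), ∀ μ : Pc d, μ.LivesOn (ball0 d R) →
    ∀ x ∈ ball0 d R, ∀ y ∈ ball0 d R, ‖w t μ x - w t μ y‖ ≤ l R t * ‖x - y‖
  lipschitz_measure : ∀ R > 0, ∀ᵐ t ∂volume.restrict (Icc 0 T), ∀ μ ν : Pc d,
    μ.LivesOn (ball0 d R) → ν.LivesOn (ball0 d R) →
    ∀ x ∈ ball0 d R, ‖w t μ x - w t ν x‖ ≤ L R t * wasserstein 1 μ ν
  differentiable_space : ∀ᵐ t ∂volume.restrict (Icc 0 T), ∀ μ, Differentiable ℝ (w t μ)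
  continuous_fderiv : ∀ R > 0, ∀ᵐ t ∂volume.restrict (Icc 0 T),
    ∀ μ : Pc d, μ.LivesOn (ball0 d R) → ∀ x ∈ ball0 d R, ∀ ε > 0, ∃ δ > 0,
      ∀ μ' : Pc d, μ'.LivesOn (ball0 d R) → ∀ x' ∈ ball0 d R,
        wasserstein 1 μ μ' < δ → ‖x - x'‖ < δ →
          ‖fderiv ℝ (w t μ') x' - fderiv ℝ (w t μ) x‖ < ε
  /-- `G μ x i` is the `i`-th row of the matrix field `y ↦ D_μ w(t, μ, x)(y)`. -/
  differentiable_measure : ∀ R > 0, ∀ᵐ t ∂volume.restrict (Icc 0 T),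
    ∃ G : Pc d → Rd d → Fin d → Rd d → Rd d,
      (∀ μ x i, IsWassersteinGradient (fun ν => w t ν x i) μ (G μ x i)) ∧
      ∀ i, ∀ μ : Pc d, μ.LivesOn (ball0 d R) → ∀ x ∈ ball0 d R, ∀ y ∈ ball0 d R,
        ∀ ε > 0, ∃ δ > 0, ∀ μ' : Pc d, μ'.LivesOn (ball0 d R) →
          ∀ x' ∈ ball0 d R, ∀ y' ∈ ball0 d R,
          wasserstein 1 μ μ' < δ → ‖x - x'‖ < δ → ‖y - y'‖ < δ →
            ‖G μ' x' i y' - G μ x i y‖ < ε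

/-- Standing hypotheses on the controlled velocity field `v` and on the final cost `φ`. -/
structure OCP {d : ℕ} {U : Type*} [MetricSpace U] (T : ℝ)
    (v : ℝ → Pc d → U → Rd d → Rd d) (φ : Pc d → ℝ) : Prop where
  velocity : ∃ (m : ℝ → ℝ) (l L : ℝ → ℝ → ℝ), IsL1Nonneg T m ∧
    (∀ R > 0, IsL1Nonneg T (l R)) ∧ (∀ R > 0, IsL1Nonneg T (L R)) ∧
    ∀ u : U, CE T m l L (fun t μ x => v t μ u x)
  continuous_control : ∀ᵐ t ∂volume.restrict (Icc 0 T), ∀ μ x, Continuous fun u => v t μ u x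
  cost_lipschitz : ∀ R > 0, ∃ C : ℝ, ∀ μ ν : Pc d, μ.LivesOn (ball0 d R) → ν.LivesOn (ball0 d R) →
    |φ μ - φ ν| ≤ C * wasserstein 1 μ ν
  cost_differentiable : ∀ μ, ∃ g : Rd d → Rd d, Continuous g ∧ IsWassersteinGradient φ μ g

/-- Interpolation inequalities along arbitrary transport plans. -/
structure SC2 {d : ℕ} {U : Type*} (T : ℝ)
    (v : ℝ → Pc d → U → Rd d → Rd d) (φ : Pc d → ℝ) : Prop where
  velocity : ∀ R > 0, ∃ C : ℝ → ℝ, IsL1Nonneg T C ∧ ∀ u : U, ∀ μ₁ μ₂ : Pc d,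
    μ₁.LivesOn (ball0 d R) → μ₂.LivesOn (ball0 d R) → ∀ γ : transportPlans μ₁ μ₂,
    ∀ x ∈ ball0 d R, ∀ y ∈ ball0 d R,
    ∀ᵐ t ∂volume.restrict (Icc 0 T), ∀ s ∈ Icc (0 : ℝ) 1,
      ‖(1 - s) • v t μ₁ u x + s • v t μ₂ u y - v t (interp γ s) u ((1 - s) • x + s • y)‖
        ≤ C t * (s * (1 - s)) * (‖x - y‖ ^ 2 + planCost 2 γ.1 ^ 2)
  cost : StronglySemiconcave φ

/-! The control problem -/

/-- `μ` solves `∂_t μ(t) + div(w(t, μ(t)) μ(t)) = 0` on `[τ,T]` with `μ(τ) = μτ`: it is a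
`W₁`-continuous curve in `𝒫_c(ℝ^d)`, and the equation holds in the sense of distributions. -/
structure SolvesCE {d : ℕ} (T : ℝ) (w : ℝ → Pc d → Rd d → Rd d) (τ : ℝ) (μτ : Pc d)
    (μ : ℝ → Pc d) : Prop where
  continuous : ∀ t ∈ Icc τ T, Tendsto (fun s => wasserstein 1 (μ s) (μ t)) (𝓝[Icc τ T] t) (𝓝 0)
  initial : μ τ = μτ
  equation : ∀ ξ : ℝ × Rd d → ℝ, ContDiff ℝ ∞ ξ → HasCompactSupport ξ →
    tsupport ξ ⊆ Ioo τ T ×ˢ univ →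
    IntegrableOn (fun t => ∫ x, (deriv (fun s => ξ (s, x)) t +
      inner ℝ (gradient (fun y => ξ (t, y)) x) (w t (μ t) x)) ∂(μ t).meas) (Icc τ T) ∧
    ∫ t in Icc τ T, ∫ x, (deriv (fun s => ξ (s, x)) t +
      inner ℝ (gradient (fun y => ξ (t, y)) x) (w t (μ t) x)) ∂(μ t).meas = 0

/-- The final costs `φ(μ(T))` of the trajectories issued from `μτ` at time `τ` that are driven by
some Lebesgue measurable open-loop control `u : [0,T] → U`. -/
def attainableCosts {d : ℕ} {U : Type*} [MeasurableSpace U] (T : ℝ)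
    (v : ℝ → Pc d → U → Rd d → Rd d) (φ : Pc d → ℝ) (τ : ℝ) (μτ : Pc d) : Set ℝ :=
  {c | ∃ (u : ℝ → U) (μ : ℝ → Pc d), AEMeasurable u (volume.restrict (Icc 0 T)) ∧
    SolvesCE T (fun t ν x => v t ν (u t) x) τ μτ μ ∧ c = φ (μ T)}

/-- The value function. -/
def valueFunction {d : ℕ} {U : Type*} [MeasurableSpace U] (T : ℝ)
    (v : ℝ → Pc d → U → Rd d → Rd d) (φ : Pc d → ℝ) (τ : ℝ) (μτ : Pc d) : ℝ :=
  sInf (attainableCosts T v φ τ μτ)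

end

end MeanField

set_option linter.unusedSectionVars false

namespace MeanField

/-! The estimate is made on random variables. A plan between measures on a ball is the joint law of
two continuous random variables X₀, Y₀ on a compact probability space (`exists_jointPlan_eq`); its
interpolation is the law of Z₀ = (1 - s)X₀ + sY₀ and its squared cost is E|X₀ - Y₀|². The continuity
equation lifts to an ODE in the Banach space C(Ω, ℝ^d), whose field at X is w(t, law X) ∘ X. This
field is locally Lipschitz with linear growth, so Picard iteration solves it
(`exists_caratheodory_solution`, `LipField.exists_lagrangian`).

Take any admissible trajectory issued from the interpolation, with control u. It is the law of a
Lagrangian curve Z started at Z₀; let X and Y be Lagrangian curves with the same control started at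
X₀ and Y₀. Grönwall in L² gives E|X - Y|² ≤ const · E|X₀ - Y₀|². By (SC2), M = (1 - s)X + sY solves
the equation of Z up to a defect s(1 - s)C(t)(|X - Y|² + E|X - Y|²). Since M and Z start together,
Grönwall in L¹ gives E|M(T) - Z(T)| ≤ const · s(1 - s)E|X₀ - Y₀|². Semiconcavity of φ along the
joint law of X(T), Y(T) compares the two costs with φ(law M(T)), and the W₁-Lipschitz bound on φ
replaces M(T) by Z(T). All constants depend only on the radius, and taking the infimum over the
trajectories of the interpolation needs no minimiser.

The costly point is that every distributional solution is the law of a Lagrangian curve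
(`SolvesCE.exists_lagrangian`). Exponential moments of a slowly varying cutoff first confine a
solution to one ball (`SolvesCE.exists_boundedCurve`). Freezing the measure argument along the
solution makes the equation linear; the frozen flow yields a second solution, and uniqueness for the
linear equation, by duality with an approximate backward transport (`BallField.exists_approx_dual`),
identifies the two.

The null sets of times in the hypotheses depend on controls, measures and points. Continuity and
separability remove this dependence (`ae_forall_of_forall_ae`). -/

/-! ### Grönwall's inequality, null sets and measurability -/

theorem absolutelyContinuousOnInterval_of_dist_le {X : Type*} [PseudoMetricSpace X] {f : ℝ → X}
    {g : ℝ → ℝ} {a b C : ℝ} (hg : AbsolutelyContinuousOnInterval g a b)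
    (h : ∀ s ∈ uIcc a b, ∀ t ∈ uIcc a b, dist (f s) (f t) ≤ C * dist (g s) (g t)) :
    AbsolutelyContinuousOnInterval f a b := by
  rw [absolutelyContinuousOnInterval_iff] at hg ⊢
  intro ε hε
  obtain ⟨δ, hδ, H⟩ := hg (ε / (|C| + 1)) (by positivity)
  refine ⟨δ, hδ, fun E hE hlt => ?_⟩
  have h1 := H E hE hlt
  rw [lt_div_iff₀ (by positivity), Finset.sum_mul] at h1
  refine lt_of_le_of_lt (Finset.sum_le_sum fun i hi => ?_) h1
  have hmem := hE.1 i hi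
  calc dist (f (E.2 i).1) (f (E.2 i).2) ≤ C * dist (g (E.2 i).1) (g (E.2 i).2) := h _ hmem.1 _ hmem.2
    _ ≤ (|C| + 1) * dist (g (E.2 i).1) (g (E.2 i).2) := by
        gcongr; linarith [le_abs_self C]
    _ = _ := mul_comm _ _

/-- For a merely integrable `l` the primitive is absolutely continuous with bounded range, where
exp(c ·) is Lipschitz; hence its exponential is absolutely continuous and the fundamental theorem of
calculus applies. -/
theorem integral_mul_exp_primitive {l : ℝ → ℝ} {a b : ℝ} (hl : IntervalIntegrable l volume a b)
    (c : ℝ) :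
    c * ∫ s in a..b, l s * Real.exp (c * ∫ r in a..s, l r)
      = Real.exp (c * ∫ r in a..b, l r) - 1 := by
  set A : ℝ → ℝ := fun s => ∫ r in a..s, l r with hA
  have hAC : AbsolutelyContinuousOnInterval A a b :=
    hl.absolutelyContinuousOnInterval_intervalIntegral (by simp)
  obtain ⟨K, hK⟩ := hAC.exists_bound
  have hE : AbsolutelyContinuousOnInterval (fun s => Real.exp (c * A s)) a b := by
    have hc : ContDiffOn ℝ 1 (fun x => Real.exp (c * x)) (Icc (-K) K) := by fun_prop
    obtain ⟨M, hM⟩ := hc.exists_lipschitzOnWith (by simp) (convex_Icc _ _) isCompact_Icc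
    refine absolutelyContinuousOnInterval_of_dist_le (C := M) hAC fun s hs t ht => ?_
    exact hM.dist_le_mul _ (abs_le.1 (hK s hs)) _ (abs_le.1 (hK t ht))
  have := hE.integral_deriv_eq_sub
  simp only [hA, intervalIntegral.integral_same, mul_zero, Real.exp_zero] at this
  rw [← this, ← intervalIntegral.integral_const_mul]
  apply intervalIntegral.integral_congr_ae
  filter_upwards [hl.ae_hasDerivAt_integral] with x hx hxm
  have h1 := hx (uIoc_subset_uIcc hxm) a (by simp)
  have h2 := ((h1.const_mul c).exp).deriv
  rw [h2]; ring

/-- A form of Grönwall's inequality with an integrable kernel. -/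
theorem gronwall_integrable {l f : ℝ → ℝ} {a b c : ℝ}
    (hl : IntegrableOn l (Icc a b)) (hl0 : ∀ t ∈ Icc a b, 0 ≤ l t)
    (hf : ContinuousOn f (Icc a b)) (hc : 0 ≤ c)
    (h : ∀ t ∈ Icc a b, f t ≤ c + ∫ s in a..t, l s * f s) :
    ∀ t ∈ Icc a b, f t ≤ 2 * c * Real.exp (2 * ∫ s in a..t, l s) := by
  intro t0 ht0
  have hab : a ≤ b := ht0.1.trans ht0.2
  have hli : ∀ t ∈ Icc a b, IntervalIntegrable l volume a t := fun t ht =>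
    (intervalIntegrable_iff_integrableOn_Icc_of_le ht.1).2 (hl.mono_set (Icc_subset_Icc le_rfl ht.2))
  set A : ℝ → ℝ := fun s => ∫ r in a..s, l r with hA
  have hAc : ContinuousOn A (Icc a b) := by
    have := ((hli b ⟨hab, le_rfl⟩).absolutelyContinuousOnInterval_intervalIntegral
      (c := a) (by simp)).continuousOn
    rwa [uIcc_of_le hab] at this
  -- The weight exp(-2A) turns the integral inequality into an algebraic one at a maximum point,
  -- because ∫ l exp(2A) = (exp(2A) - 1)/2.
  have hgc : ContinuousOn (fun t => f t * Real.exp (-(2 * A t))) (Icc a b) :=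
    hf.mul (Real.continuous_exp.comp_continuousOn (hAc.const_smul (2 : ℝ)).neg)
  obtain ⟨t1, ht1, hmax⟩ := isCompact_Icc.exists_isMaxOn ⟨t0, ht0⟩ hgc
  set M := f t1 * Real.exp (-(2 * A t1)) with hM
  have hfM : ∀ t ∈ Icc a b, f t ≤ M * Real.exp (2 * A t) := by
    intro t ht
    have := hmax ht
    simp only [mem_ofPred_eq] at this
    calc f t = f t * Real.exp (-(2 * A t)) * Real.exp (2 * A t) := by
          rw [mul_assoc, ← Real.exp_add]; simp
      _ ≤ _ := by gcongr
  suffices M ≤ 2 * c by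
    calc f t0 ≤ M * Real.exp (2 * A t0) := hfM t0 ht0
      _ ≤ _ := by gcongr
  have h1 := h t1 ht1
  have hli1 := hli t1 ht1
  have hsub : Icc a t1 ⊆ Icc a b := Icc_subset_Icc le_rfl ht1.2
  have h2 : ∫ s in a..t1, l s * f s ≤ ∫ s in a..t1, M * (l s * Real.exp (2 * A s)) := by
    apply intervalIntegral.integral_mono_on ht1.1
    · apply hli1.mul_continuousOn
      rw [uIcc_of_le ht1.1]; exact hf.mono hsub
    · apply IntervalIntegrable.const_mul
      apply hli1.mul_continuousOn
      rw [uIcc_of_le ht1.1]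
      exact Real.continuous_exp.comp_continuousOn ((hAc.mono hsub).const_smul (2 : ℝ))
    · intro s hs
      calc l s * f s ≤ l s * (M * Real.exp (2 * A s)) :=
            mul_le_mul_of_nonneg_left (hfM s (hsub hs)) (hl0 s (hsub hs))
        _ = _ := by ring
  rw [intervalIntegral.integral_const_mul] at h2
  have h3 := integral_mul_exp_primitive hli1 2
  have h3' : ∫ s in a..t1, l s * Real.exp (2 * A s) = (Real.exp (2 * A t1) - 1) / 2 := by
    simp only [hA]; linarith
  rw [h3'] at h2
  have h4 : f t1 = M * Real.exp (2 * A t1) := by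
    rw [hM, mul_assoc, ← Real.exp_add]; simp
  have hA0 : 1 ≤ Real.exp (2 * A t1) := by
    apply Real.one_le_exp
    have : 0 ≤ A t1 := intervalIntegral.integral_nonneg ht1.1 fun s hs => hl0 s (hsub hs)
    linarith
  -- At the maximum point the inequality reads M(exp(2A) + 1) ≤ 2c, which is incompatible with M >
  -- 2c ≥ 0.
  by_contra hcon
  push Not at hcon
  nlinarith

/-- The null sets attached to a countable dense set have a null union; off it, closedness extends
the property to every point. -/
theorem ae_forall_of_forall_ae {α S : Type*} [MeasurableSpace α] {μ : Measure α}
    [TopologicalSpace S] [TopologicalSpace.SeparableSpace S] {p : α → S → Prop}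
    (hclosed : ∀ᵐ t ∂μ, IsClosed {x | p t x}) (h : ∀ x, ∀ᵐ t ∂μ, p t x) :
    ∀ᵐ t ∂μ, ∀ x, p t x := by
  obtain ⟨D, hDc, hD⟩ := TopologicalSpace.exists_countable_dense S
  have := (ae_ball_iff hDc).2 fun x _ => h x
  filter_upwards [this, hclosed] with t ht hc x
  have : D ⊆ {x | p t x} := fun y hy => ht y hy
  have h2 := hc.closure_subset_iff.2 this
  rw [hD.closure_eq] at h2
  exact h2 (mem_univ x)

/-- Compositions of Carathéodory functions with measurable functions are measurable. -/
theorem aestronglyMeasurable_caratheodory_comp {α S E : Type*} [MeasurableSpace α] {μ : Measure α}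
    [PseudoMetricSpace S] [TopologicalSpace.SeparableSpace S] [MeasurableSpace S] [BorelSpace S]
    [TopologicalSpace E] [TopologicalSpace.PseudoMetrizableSpace E]
    {f : α → S → E} {p : α → S} (hf : ∀ x, AEStronglyMeasurable (fun t => f t x) μ)
    (hc : ∀ᵐ t ∂μ, Continuous (f t)) (hp : AEMeasurable p μ) :
    AEStronglyMeasurable (fun t => f t (p t)) μ := by
  rcases isEmpty_or_nonempty α with hα | hα
  · rw [Measure.eq_zero_of_isEmpty μ]
    exact aestronglyMeasurable_zero_measure _
  have hS : Nonempty S := ⟨p hα.some⟩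
  set q := hp.mk p with hq
  have hqm : Measurable q := hp.measurable_mk
  suffices AEStronglyMeasurable (fun t => f t (q t)) μ by
    refine this.congr ?_
    filter_upwards [hp.ae_eq_mk] with t ht
    rw [ht]
  let e := TopologicalSpace.denseSeq S
  let N : ℕ → SimpleFunc S S := fun n => SimpleFunc.nearestPt e n
  -- Replacing `q` by simple functions freezes the second argument of `f` on each of finitely many
  -- measurable fibres; continuity gives the limit.
  refine aestronglyMeasurable_of_tendsto_ae atTop (f := fun n t => f t (N n (q t))) ?_ ?_
  · intro n
    have hcov : (⋃ y : (N n).range, q ⁻¹' ((N n) ⁻¹' {(y : S)})) = univ := by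
      ext t; simp
    rw [← Measure.restrict_univ (μ := μ), ← hcov, aestronglyMeasurable_iUnion_iff]
    rintro ⟨y, hy⟩
    refine ((hf y).restrict).congr ?_
    have hms : MeasurableSet (q ⁻¹' ((N n) ⁻¹' {y})) := hqm ((N n).measurableSet_fiber y)
    filter_upwards [ae_restrict_mem hms] with t ht
    have : N n (q t) = y := ht
    simp [this]
  · filter_upwards [hc] with t ht
    refine (ht.tendsto _).comp ?_
    refine SimpleFunc.tendsto_nearestPt (e := e) ?_
    rw [(TopologicalSpace.denseRange_denseSeq S).closure_range]
    trivial

/-- Evaluation along a dense sequence is a continuous injection of the Polish space C(Ω, F) into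
F^ℕ, hence a measurable embedding (Lusin–Souslin). Measurability can therefore be tested point by
point. -/
theorem aestronglyMeasurable_continuousMap {α Ω F : Type*} [MeasurableSpace α] {μ : Measure α}
    [MetricSpace Ω] [CompactSpace Ω] [NormedAddCommGroup F] [CompleteSpace F]
    [SecondCountableTopology F] {f : α → C(Ω, F)}
    (h : ∀ x, AEStronglyMeasurable (fun t => f t x) μ) : AEStronglyMeasurable f μ := by
  rcases isEmpty_or_nonempty Ω with hΩ | hΩ
  · have : Subsingleton C(Ω, F) := ⟨fun a b => by ext x; exact isEmptyElim x⟩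
    have : f = fun _ => 0 := Subsingleton.elim _ _
    rw [this]; exact aestronglyMeasurable_const
  borelize F
  borelize C(Ω, F)
  let e := TopologicalSpace.denseSeq Ω
  let ι : C(Ω, F) → (ℕ → F) := fun g n => g (e n)
  have hι : Continuous ι := continuous_pi fun n => continuous_eval_const (e n)
  have hinj : Function.Injective ι := by
    intro g₁ g₂ h12
    apply DFunLike.coe_injective
    apply (TopologicalSpace.denseRange_denseSeq Ω).equalizer g₁.continuous g₂.continuous
    exact h12
  have hemb : MeasurableEmbedding ι := hι.measurableEmbedding hinj
  obtain ⟨r, hr, hrι⟩ := hemb.exists_measurable_extend measurable_id fun _ => ⟨0⟩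
  have h1 : AEMeasurable (fun t => ι (f t)) μ := aemeasurable_pi_lambda _ fun n => (h (e n)).aemeasurable
  have h2 : f = fun t => r (ι (f t)) := by
    ext1 t; exact (congrFun hrι (f t)).symm
  rw [h2]
  exact (hr.comp_aemeasurable h1).aestronglyMeasurable

/-! ### Carathéodory equations in Banach spaces -/

section Ode

variable {E : Type*} [NormedAddCommGroup E] [NormedSpace ℝ E]

theorem intervalIntegrable_of_integrableOn_Icc {F : Type*} [NormedAddCommGroup F] {f : ℝ → F}
    {a b s t : ℝ} (hf : IntegrableOn f (Icc a b)) (hs : s ∈ Icc a b) (ht : t ∈ Icc a b) :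
    IntervalIntegrable f volume s t :=
  intervalIntegrable_iff.2 <| hf.mono_set <|
    uIoc_subset_uIcc.trans (uIcc_subset_Icc hs ht)

theorem norm_integral_le_of_ae_restrict {f : ℝ → E} {g : ℝ → ℝ} {a b s t : ℝ}
    (hg : IntegrableOn g (Icc a b))
    (h : ∀ᵐ r ∂volume.restrict (Icc a b), ‖f r‖ ≤ g r) (hs : s ∈ Icc a b) (ht : t ∈ Icc a b)
    (hst : s ≤ t) : ‖∫ r in s..t, f r‖ ≤ ∫ r in s..t, g r := by
  refine intervalIntegral.norm_integral_le_of_norm_le hst ?_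
    (intervalIntegrable_of_integrableOn_Icc hg hs ht)
  rw [ae_restrict_iff' measurableSet_Icc] at h
  filter_upwards [h] with r hr hrm
  exact hr ⟨hs.1.trans hrm.1.le, hrm.2.trans ht.2⟩

theorem continuousOn_primitive_Icc {f : ℝ → E} {a b : ℝ} (hf : IntegrableOn f (Icc a b))
    (hab : a ≤ b) : ContinuousOn (fun t => ∫ s in a..t, f s) (Icc a b) := by
  have := intervalIntegral.continuousOn_primitive_interval (f := f) (a := a) (b := b) (μ := volume)
    (by rwa [uIcc_of_le hab])
  rwa [uIcc_of_le hab] at this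

theorem primitive_nonneg {l : ℝ → ℝ} {a b t : ℝ} (hl0 : ∀ t ∈ Icc a b, 0 ≤ l t)
    (ht : t ∈ Icc a b) : 0 ≤ ∫ s in a..t, l s :=
  intervalIntegral.integral_nonneg ht.1 fun s hs => hl0 s ⟨hs.1, hs.2.trans ht.2⟩

theorem primitive_mono {l : ℝ → ℝ} {a b s t : ℝ} (hl : IntegrableOn l (Icc a b))
    (hl0 : ∀ t ∈ Icc a b, 0 ≤ l t) (hs : s ∈ Icc a b) (ht : t ∈ Icc a b) (hst : s ≤ t) :
    ∫ r in a..s, l r ≤ ∫ r in a..t, l r := by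
  have ha : a ∈ Icc a b := ⟨le_rfl, hs.1.trans hs.2⟩
  rw [← intervalIntegral.integral_add_adjacent_intervals
    (intervalIntegrable_of_integrableOn_Icc hl ha hs)
    (intervalIntegrable_of_integrableOn_Icc hl hs ht)]
  have : 0 ≤ ∫ r in s..t, l r := intervalIntegral.integral_nonneg hst fun r hr =>
    hl0 r ⟨hs.1.trans hr.1, hr.2.trans ht.2⟩
  linarith

/-- Carathéodory's existence theorem for locally Lipschitz fields with linear growth on a Banach
space. -/
theorem exists_caratheodory_solution [CompleteSpace E] {τ T : ℝ} (hτ : τ ≤ T) (G : ℝ → E → E)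
    {m : ℝ → ℝ} (hm : IntegrableOn m (Icc τ T)) (hm0 : ∀ t ∈ Icc τ T, 0 ≤ m t)
    (hmeas : ∀ X : ℝ → E, Continuous X →
      AEStronglyMeasurable (fun t => G t (X t)) (volume.restrict (Icc τ T)))
    (hgrowth : ∀ᵐ t ∂volume.restrict (Icc τ T), ∀ x, ‖G t x‖ ≤ m t * (1 + ‖x‖))
    (hlip : ∀ R > 0, ∃ l : ℝ → ℝ, IntegrableOn l (Icc τ T) ∧ (∀ t ∈ Icc τ T, 0 ≤ l t) ∧
      ∀ᵐ t ∂volume.restrict (Icc τ T), ∀ x y, ‖x‖ ≤ R → ‖y‖ ≤ R → ‖G t x - G t y‖ ≤ l t * ‖x - y‖)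
    (x₀ : E) :
    ∃ X : ℝ → E, Continuous X ∧ IntegrableOn (fun t => G t (X t)) (Icc τ T) ∧
      ∀ t ∈ Icc τ T, X t = x₀ + ∫ s in τ..t, G s (X s) := by
  set M : ℝ → ℝ := fun t => ∫ s in τ..t, m s with hM
  have hτm : τ ∈ Icc τ T := ⟨le_rfl, hτ⟩
  have hTm : T ∈ Icc τ T := ⟨hτ, le_rfl⟩
  have hMc : ContinuousOn M (Icc τ T) := continuousOn_primitive_Icc hm hτ
  -- ρ solves the extremal equation ρ' = m(1 + ρ) with ρ(τ) = ‖x₀‖. The Picard map therefore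
  -- preserves the curves below ρ, and these stay in one ball, where a single Lipschitz bound `l` is
  -- available.
  set ρ : ℝ → ℝ := fun t => (1 + ‖x₀‖) * Real.exp (M t) - 1 with hρ
  set R : ℝ := (1 + ‖x₀‖) * Real.exp (M T) with hR
  have hR0 : 0 < R := by positivity
  have hρR : ∀ t ∈ Icc τ T, ρ t ≤ R := by
    intro t ht
    have : M t ≤ M T := primitive_mono hm hm0 ht hTm ht.2
    have : (1 + ‖x₀‖) * Real.exp (M t) ≤ R := by rw [hR]; gcongr
    simp only [hρ]; linarith
  obtain ⟨l, hl, hl0, hlR⟩ := hlip R hR0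
  set A : ℝ → ℝ := fun t => ∫ s in τ..t, l s with hA
  have hAc : ContinuousOn A (Icc τ T) := continuousOn_primitive_Icc hl hτ
  let good : (ℝ → E) → Prop := fun X => Continuous X ∧ ∀ t ∈ Icc τ T, ‖X t‖ ≤ ρ t
  have hint : ∀ X, good X → IntegrableOn (fun t => G t (X t)) (Icc τ T) := by
    intro X hX
    refine Integrable.mono' (hm.mul_const (1 + R)) (hmeas X hX.1) ?_
    filter_upwards [hgrowth, ae_restrict_mem measurableSet_Icc] with t ht htm
    refine (ht _).trans ?_
    have := (hX.2 t htm).trans (hρR t htm)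
    have := hm0 t htm
    gcongr
  -- Iterates are extended by constants outside [τ,T], so that they are continuous on all of ℝ, as
  -- `hmeas` requires.
  let pr : ℝ → ℝ := fun t => (projIcc τ T hτ t : ℝ)
  have hpr : ∀ t, pr t ∈ Icc τ T := fun t => (projIcc τ T hτ t).2
  have hprc : Continuous pr := continuous_subtype_val.comp continuous_projIcc
  have hpre : ∀ t ∈ Icc τ T, pr t = t := fun t ht => by simp [pr, projIcc_of_mem hτ ht]
  let Φ : (ℝ → E) → ℝ → E := fun X t => x₀ + ∫ s in τ..pr t, G s (X s)
  have hΦ : ∀ X, good X → good (Φ X) := by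
    intro X hX
    refine ⟨continuous_const.add ((continuousOn_primitive_Icc (hint X hX) hτ).comp_continuous
      hprc hpr), fun t ht => ?_⟩
    have h1 : ‖∫ s in τ..t, G s (X s)‖ ≤
        ∫ s in τ..t, (1 + ‖x₀‖) * (m s * Real.exp (1 * ∫ r in τ..s, m r)) := by
      refine norm_integral_le_of_ae_restrict ?_ ?_ hτm ht ht.1
      · refine Integrable.const_mul ?_ _
        refine IntegrableOn.mul_continuousOn hm ?_ isCompact_Icc
        exact Real.continuous_exp.comp_continuousOn (hMc.const_smul (1 : ℝ))
      · filter_upwards [hgrowth, ae_restrict_mem measurableSet_Icc] with s hs hsm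
        refine (hs _).trans ?_
        have h2 := hX.2 s hsm
        have h3 := hm0 s hsm
        simp only [hρ, hM] at h2
        calc m s * (1 + ‖X s‖) ≤ m s * ((1 + ‖x₀‖) * Real.exp (∫ r in τ..s, m r)) := by
              gcongr; linarith
          _ = _ := by rw [one_mul]; ring
    rw [intervalIntegral.integral_const_mul] at h1
    have h2 := integral_mul_exp_primitive (intervalIntegrable_of_integrableOn_Icc hm hτm ht) 1
    rw [one_mul] at h2
    rw [h2, one_mul] at h1
    simp only [Φ, hpre t ht]
    refine (norm_add_le _ _).trans ?_
    simp only [hρ, hM]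
    linarith
  let X : ℕ → ℝ → E := fun n => Φ^[n] (fun _ => x₀)
  have hX0 : good (X 0) := by
    refine ⟨continuous_const, fun t ht => ?_⟩
    have : 1 ≤ Real.exp (M t) := Real.one_le_exp (primitive_nonneg hm0 ht)
    have : ‖x₀‖ ≤ ρ t := by
      simp only [hρ]; nlinarith [norm_nonneg x₀]
    exact this
  have hXs : ∀ n, X (n + 1) = Φ (X n) := fun n => Function.iterate_succ_apply' _ _ _
  have hXg : ∀ n, good (X n) := by
    intro n
    induction n with
    | zero => exact hX0
    | succ n ih => rw [hXs]; exact hΦ _ ih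
  -- In the supremum norm with weight exp(-2A) the Picard map contracts by the factor 1/2, whatever
  -- the length of the interval.
  have hΦlip : ∀ (Y Z : ℝ → E) (C : ℝ), good Y → good Z →
      (∀ t ∈ Icc τ T, ‖Y t - Z t‖ ≤ C * Real.exp (2 * A t)) →
      ∀ t ∈ Icc τ T, ‖Φ Y t - Φ Z t‖ ≤ C / 2 * (Real.exp (2 * A t) - 1) := by
    intro Y Z C hY hZ hYZ t ht
    simp only [Φ, hpre t ht, add_sub_add_left_eq_sub]
    rw [← intervalIntegral.integral_sub
      (intervalIntegrable_of_integrableOn_Icc (hint Y hY) hτm ht)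
      (intervalIntegrable_of_integrableOn_Icc (hint Z hZ) hτm ht)]
    have h1 : ‖∫ s in τ..t, (G s (Y s) - G s (Z s))‖ ≤
        ∫ s in τ..t, C * (l s * Real.exp (2 * ∫ r in τ..s, l r)) := by
      refine norm_integral_le_of_ae_restrict ?_ ?_ hτm ht ht.1
      · refine Integrable.const_mul ?_ _
        refine IntegrableOn.mul_continuousOn hl ?_ isCompact_Icc
        exact Real.continuous_exp.comp_continuousOn (hAc.const_smul (2 : ℝ))
      · filter_upwards [hlR, ae_restrict_mem measurableSet_Icc] with s hs hsm
        refine (hs _ _ ((hY.2 s hsm).trans (hρR s hsm)) ((hZ.2 s hsm).trans (hρR s hsm))).trans ?_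
        calc l s * ‖Y s - Z s‖ ≤ l s * (C * Real.exp (2 * A s)) :=
              mul_le_mul_of_nonneg_left (hYZ s hsm) (hl0 s hsm)
          _ = _ := by ring
    rw [intervalIntegral.integral_const_mul] at h1
    have h2 := integral_mul_exp_primitive (intervalIntegrable_of_integrableOn_Icc hl hτm ht) 2
    refine h1.trans (le_of_eq ?_)
    simp only [hA]
    linear_combination (C / 2) * h2
  have hA1 : ∀ t ∈ Icc τ T, 1 ≤ Real.exp (2 * A t) := fun t ht =>
    Real.one_le_exp (by have := primitive_nonneg hl0 ht; simp only [hA]; linarith)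
  have hdiff : ∀ n, ∀ t ∈ Icc τ T, ‖X (n + 1) t - X n t‖ ≤ 2 * R * (1 / 2) ^ n * Real.exp (2 * A t) := by
    intro n
    induction n with
    | zero =>
      intro t ht
      have h1 := ((hXg 1).2 t ht).trans (hρR t ht)
      have h2 := ((hXg 0).2 t ht).trans (hρR t ht)
      calc ‖X (0 + 1) t - X 0 t‖ ≤ ‖X 1 t‖ + ‖X 0 t‖ := norm_sub_le _ _
        _ ≤ 2 * R * (1 / 2) ^ 0 * 1 := by linarith
        _ ≤ _ := by gcongr; exact hA1 t ht
    | succ n ih =>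
      intro t ht
      rw [hXs (n + 1)]
      nth_rewrite 2 [hXs n]
      refine (hΦlip _ _ _ (hXg _) (hXg _) ih t ht).trans ?_
      have : 0 ≤ 2 * R * (1 / 2 : ℝ) ^ n / 2 := by positivity
      calc 2 * R * (1 / 2) ^ n / 2 * (Real.exp (2 * A t) - 1)
          ≤ 2 * R * (1 / 2) ^ n / 2 * Real.exp (2 * A t) := by
            apply mul_le_mul_of_nonneg_left _ this; linarith
        _ = _ := by rw [pow_succ]; ring
  set K : ℝ := 2 * R * Real.exp (2 * A T) with hK
  have hdist : ∀ t ∈ Icc τ T, ∀ n, dist (X n t) (X (n + 1) t) ≤ K * (1 / 2) ^ n := by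
    intro t ht n
    rw [dist_comm, dist_eq_norm]
    refine (hdiff n t ht).trans ?_
    have : A t ≤ A T := primitive_mono hl hl0 ht hTm ht.2
    calc 2 * R * (1 / 2) ^ n * Real.exp (2 * A t) ≤ 2 * R * (1 / 2) ^ n * Real.exp (2 * A T) := by
          gcongr
      _ = _ := by rw [hK]; ring
  have hlim : ∀ t : ℝ, ∃ y, Tendsto (fun n => X n (pr t)) atTop (𝓝 y) := fun t =>
    cauchySeq_tendsto_of_complete
      (cauchySeq_of_le_geometric (1 / 2) K (by norm_num) (hdist _ (hpr t)))
  choose Y hY using hlim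
  have hYd : ∀ n t, dist (X n (pr t)) (Y t) ≤ K * (1 / 2) ^ n / (1 - 1 / 2) := fun n t =>
    dist_le_of_le_geometric_of_tendsto (1 / 2) K (by norm_num) (hdist _ (hpr t)) (hY t) n
  have hYd' : ∀ n, ∀ t ∈ Icc τ T, ‖X n t - Y t‖ ≤ 2 * K * (1 / 2) ^ n := by
    intro n t ht
    have := hYd n t
    rw [hpre t ht, dist_eq_norm] at this
    refine this.trans (le_of_eq ?_)
    ring
  have hKlim : Tendsto (fun n : ℕ => 2 * K * (1 / 2 : ℝ) ^ n) atTop (𝓝 0) := by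
    have := (tendsto_pow_atTop_nhds_zero_of_lt_one (r := (1 / 2 : ℝ)) (by norm_num)
      (by norm_num)).const_mul (2 * K)
    simpa using this
  have hYc : Continuous Y := by
    have hu : TendstoUniformly (fun n t => X n (pr t)) Y atTop := by
      rw [Metric.tendstoUniformly_iff]
      intro ε hε
      filter_upwards [hKlim.eventually (gt_mem_nhds hε)] with n hn t
      rw [dist_comm]
      refine (hYd n t).trans_lt (lt_of_eq_of_lt ?_ hn)
      ring
    exact hu.continuous (Eventually.of_forall fun n => (hXg n).1.comp hprc).frequently
  have hYg : good Y := by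
    refine ⟨hYc, fun t ht => ?_⟩
    have h1 := (hY t).norm
    rw [hpre t ht] at h1
    exact le_of_tendsto h1 (Eventually.of_forall fun n => (hXg n).2 t ht)
  refine ⟨Y, hYc, hint Y hYg, fun t ht => ?_⟩
  have h1 : Tendsto (fun n => X (n + 1) t) atTop (𝓝 (Y t)) := by
    have := hY t
    rw [hpre t ht] at this
    exact this.comp (tendsto_add_atTop_nat 1)
  have h2 : Tendsto (fun n => X (n + 1) t) atTop (𝓝 (Φ Y t)) := by
    rw [tendsto_iff_norm_sub_tendsto_zero]
    have hb : Tendsto (fun n : ℕ => 2 * K * (1 / 2 : ℝ) ^ n / 2 * (Real.exp (2 * A t) - 1)) atTop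
        (𝓝 0) := by
      have := (hKlim.div_const 2).mul_const (Real.exp (2 * A t) - 1)
      simpa using this
    refine squeeze_zero (fun n => norm_nonneg _) (fun n => ?_) hb
    rw [hXs]
    refine hΦlip _ _ _ (hXg n) hYg (fun s hs => (hYd' n s hs).trans ?_) t ht
    have : 0 ≤ 2 * K * (1 / 2 : ℝ) ^ n := (norm_nonneg _).trans (hYd' n s hs)
    nlinarith [hA1 s hs]
  have h3 := tendsto_nhds_unique h1 h2
  rw [h3]
  simp only [Φ, hpre t ht]

end Ode

/-! ### Laws of continuous random variables and transport plans -/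

section Law

variable {d : ℕ}

instance Pc.isProbabilityMeasure_meas (μ : Pc d) : IsProbabilityMeasure μ.meas := μ.2.1

theorem Pc.livesOn_iff {μ : Pc d} {R : ℝ} :
    μ.LivesOn (ball0 d R) ↔ ∀ᵐ x ∂μ.meas, ‖x‖ ≤ R := by
  simp only [Pc.LivesOn, ae_iff, compl_def, mem_closedBall_zero_iff]

theorem Pc.exists_livesOn (μ : Pc d) : ∃ R > 0, μ.LivesOn (ball0 d R) := by
  obtain ⟨R, hR⟩ := μ.2.2
  refine ⟨max R 1, by positivity, ?_⟩
  exact measure_mono_null (compl_subset_compl.2 (Metric.closedBall_subset_closedBall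
    (le_max_left _ _))) hR

theorem Pc.LivesOn.mono {μ : Pc d} {R R' : ℝ} (h : μ.LivesOn (ball0 d R)) (hR : R ≤ R') :
    μ.LivesOn (ball0 d R') := by
  rw [Pc.livesOn_iff] at h ⊢
  filter_upwards [h] with x hx using hx.trans hR

theorem Pc.integrable_of_continuousOn {F : Type*} [NormedAddCommGroup F] {μ : Pc d} {R : ℝ}
    (hμ : μ.LivesOn (ball0 d R)) {f : Rd d → F} (hf : ContinuousOn f (ball0 d R)) :
    Integrable f μ.meas := by
  have h1 : IntegrableOn f (ball0 d R) μ.meas :=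
    hf.integrableOn_compact (isCompact_closedBall _ _)
  have h2 : μ.meas.restrict (ball0 d R) = μ.meas :=
    Measure.restrict_eq_self_of_ae_mem (by
      rw [Pc.livesOn_iff] at hμ
      filter_upwards [hμ] with x hx using mem_closedBall_zero_iff.2 hx)
  rwa [IntegrableOn, h2] at h1

theorem Pc.integrable_of_continuous {F : Type*} [NormedAddCommGroup F] (μ : Pc d) {f : Rd d → F}
    (hf : Continuous f) : Integrable f μ.meas := by
  obtain ⟨R, _, hR⟩ := μ.exists_livesOn
  exact Pc.integrable_of_continuousOn hR hf.continuousOn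

theorem transportPlans_nonempty (μ ν : Pc d) : (transportPlans μ ν).Nonempty :=
  ⟨μ.meas.prod ν.meas, by
    rw [Measure.map_fst_prod]; simp, by rw [Measure.map_snd_prod]; simp⟩

theorem planCost_nonneg (p : ℝ) (γ : Measure (Rd d × Rd d)) : 0 ≤ planCost p γ :=
  Real.rpow_nonneg (integral_nonneg fun _ => Real.rpow_nonneg (norm_nonneg _) _) _

theorem wasserstein_nonneg (p : ℝ) (μ ν : Pc d) : 0 ≤ wasserstein p μ ν :=
  Real.sInf_nonneg (by rintro _ ⟨γ, _, rfl⟩; exact planCost_nonneg p γ)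

theorem wasserstein_le_planCost {p : ℝ} {μ ν : Pc d} {γ : Measure (Rd d × Rd d)}
    (hγ : γ ∈ transportPlans μ ν) : wasserstein p μ ν ≤ planCost p γ :=
  csInf_le ⟨0, by rintro _ ⟨γ, _, rfl⟩; exact planCost_nonneg p γ⟩ ⟨γ, hγ, rfl⟩

theorem planCost_one (γ : Measure (Rd d × Rd d)) : planCost 1 γ = ∫ z, ‖z.1 - z.2‖ ∂γ := by
  simp [planCost]

theorem planCost_two_sq (γ : Measure (Rd d × Rd d)) :
    planCost 2 γ ^ 2 = ∫ z, ‖z.1 - z.2‖ ^ 2 ∂γ := by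
  have h : 0 ≤ ∫ z, ‖z.1 - z.2‖ ^ 2 ∂γ := integral_nonneg fun _ => by positivity
  simp only [planCost, Real.rpow_two]
  rw [← Real.sqrt_eq_rpow, Real.sq_sqrt h]

/-- The easy half of Kantorovich–Rubinstein duality: the bound holds for the cost of every plan,
then for the infimum. -/
theorem abs_integral_sub_le_wasserstein {f : Rd d → ℝ} {K : NNReal} (hf : LipschitzWith K f)
    (μ ν : Pc d) : |∫ x, f x ∂μ.meas - ∫ x, f x ∂ν.meas| ≤ K * wasserstein 1 μ ν := by
  suffices ∀ γ ∈ transportPlans μ ν, |∫ x, f x ∂μ.meas - ∫ x, f x ∂ν.meas| ≤ K * planCost 1 γ by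
    rcases eq_or_ne K 0 with rfl | hK
    · obtain ⟨γ, hγ⟩ := transportPlans_nonempty μ ν
      simpa using this γ hγ
    have hK' : (0 : ℝ) < K := by positivity
    rw [← div_le_iff₀' hK']
    refine le_csInf ((transportPlans_nonempty μ ν).image _) ?_
    rintro _ ⟨γ, hγ, rfl⟩
    rw [div_le_iff₀' hK']
    exact this γ hγ
  rintro γ ⟨h1, h2⟩
  have hμf : ∀ {g : Rd d → ℝ}, Continuous g → Integrable (fun z : Rd d × Rd d => g z.1) γ := by
    intro g hg
    have := μ.integrable_of_continuous hg
    rw [← h1] at this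
    exact (integrable_map_measure hg.aestronglyMeasurable measurable_fst.aemeasurable).1 this
  have hνf : ∀ {g : Rd d → ℝ}, Continuous g → Integrable (fun z : Rd d × Rd d => g z.2) γ := by
    intro g hg
    have := ν.integrable_of_continuous hg
    rw [← h2] at this
    exact (integrable_map_measure hg.aestronglyMeasurable measurable_snd.aemeasurable).1 this
  have e1 : ∫ x, f x ∂μ.meas = ∫ z, f z.1 ∂γ := by
    rw [← h1, integral_map measurable_fst.aemeasurable hf.continuous.aestronglyMeasurable]
  have e2 : ∫ x, f x ∂ν.meas = ∫ z, f z.2 ∂γ := by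
    rw [← h2, integral_map measurable_snd.aemeasurable hf.continuous.aestronglyMeasurable]
  rw [e1, e2, ← integral_sub (hμf hf.continuous) (hνf hf.continuous), planCost_one,
    ← integral_const_mul]
  refine norm_integral_le_of_norm_le (f := fun z : Rd d × Rd d => f z.1 - f z.2) ?_ ?_
  · refine Integrable.const_mul ?_ _
    refine Integrable.mono' ((hμf continuous_norm).add (hνf continuous_norm))
      (by fun_prop) (Eventually.of_forall fun z => ?_)
    simpa using norm_sub_le z.1 z.2
  · refine Eventually.of_forall fun z => ?_
    have := hf.dist_le_mul z.1 z.2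
    rwa [dist_eq_norm, dist_eq_norm] at this

variable {Ω : Type*} [MetricSpace Ω] [CompactSpace Ω] [MeasurableSpace Ω] [BorelSpace Ω]

/-- The law of a continuous random variable on a compact probability space. -/
noncomputable def law (P : Measure Ω) [hP : IsProbabilityMeasure P] (X : C(Ω, Rd d)) : Pc d :=
  ⟨P.map X, Measure.isProbabilityMeasure_map X.continuous.aemeasurable, ‖X‖, by
    rw [Measure.map_apply X.continuous.measurable Metric.isClosed_closedBall.measurableSet.compl]
    convert measure_empty (μ := P)
    ext o
    simpa using X.norm_coe_le_norm o⟩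

variable (P : Measure Ω) [IsProbabilityMeasure P]

theorem law_meas (X : C(Ω, Rd d)) : (law P X).meas = P.map X := rfl

theorem integral_law {F : Type*} [NormedAddCommGroup F] [NormedSpace ℝ F] (X : C(Ω, Rd d))
    {f : Rd d → F} (hf : Continuous f) : ∫ x, f x ∂(law P X).meas = ∫ o, f (X o) ∂P :=
  integral_map X.continuous.aemeasurable hf.aestronglyMeasurable

theorem law_livesOn {X : C(Ω, Rd d)} {R : ℝ} (h : ‖X‖ ≤ R) : (law P X).LivesOn (ball0 d R) := by
  rw [Pc.livesOn_iff, law_meas, ae_map_iff X.continuous.aemeasurable]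
  · exact Eventually.of_forall fun o => (X.norm_coe_le_norm o).trans h
  · exact measurableSet_le measurable_norm measurable_const

theorem integrable_continuous {F : Type*} [NormedAddCommGroup F] {f : Ω → F}
    (hf : Continuous f) : Integrable f P := by
  have := hf.continuousOn.integrableOn_compact (μ := P) isCompact_univ
  rwa [integrableOn_univ] at this

theorem moment1_law_le (X : C(Ω, Rd d)) : moment1 (law P X) ≤ ‖X‖ := by
  rw [moment1, integral_law P X continuous_norm]
  calc ∫ o, ‖X o‖ ∂P ≤ ∫ _, ‖X‖ ∂P := by
        refine integral_mono (integrable_continuous P (by fun_prop)) (integrable_const _) fun o => ?_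
        exact X.norm_coe_le_norm o
    _ = ‖X‖ := by simp

/-- The coupling of the laws of two random variables on the same probability space. -/
noncomputable def jointPlan (X Y : C(Ω, Rd d)) : transportPlans (law P X) (law P Y) :=
  ⟨P.map fun o => (X o, Y o), by
    have h : Measurable fun o => (X o, Y o) :=
      X.continuous.measurable.prodMk Y.continuous.measurable
    exact ⟨by rw [Measure.map_map measurable_fst h]; rfl,
      by rw [Measure.map_map measurable_snd h]; rfl⟩⟩

theorem integral_jointPlan {F : Type*} [NormedAddCommGroup F] [NormedSpace ℝ F] (X Y : C(Ω, Rd d))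
    {f : Rd d × Rd d → F} (hf : Continuous f) :
    ∫ z, f z ∂(jointPlan P X Y).1 = ∫ o, f (X o, Y o) ∂P :=
  integral_map (X.continuous.measurable.prodMk Y.continuous.measurable).aemeasurable
    hf.aestronglyMeasurable

theorem planCost_two_jointPlan_sq (X Y : C(Ω, Rd d)) :
    planCost 2 (jointPlan P X Y).1 ^ 2 = ∫ o, ‖X o - Y o‖ ^ 2 ∂P := by
  rw [planCost_two_sq, integral_jointPlan P X Y (by fun_prop)]

theorem interp_jointPlan (X Y : C(Ω, Rd d)) (s : ℝ) :
    interp (jointPlan P X Y) s = law P ((1 - s) • X + s • Y) := by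
  apply Subtype.ext
  change Measure.map _ (Measure.map _ P) = Measure.map _ P
  rw [Measure.map_map (by fun_prop) (X.continuous.measurable.prodMk Y.continuous.measurable)]
  rfl

theorem wasserstein_law_le (X Y : C(Ω, Rd d)) :
    wasserstein 1 (law P X) (law P Y) ≤ ∫ o, ‖X o - Y o‖ ∂P := by
  refine (wasserstein_le_planCost (jointPlan P X Y).2).trans (le_of_eq ?_)
  rw [planCost_one, integral_jointPlan P X Y (by fun_prop)]

theorem integral_norm_le_norm (Y : C(Ω, Rd d)) : ∫ o, ‖Y o‖ ∂P ≤ ‖Y‖ := by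
  have := moment1_law_le P Y
  rwa [moment1, integral_law P Y continuous_norm] at this

theorem wasserstein_law_le_norm (X Y : C(Ω, Rd d)) :
    wasserstein 1 (law P X) (law P Y) ≤ ‖X - Y‖ :=
  (wasserstein_law_le P X Y).trans (integral_norm_le_norm P (X - Y))

/-- The closed ball as a compact metric space. -/
abbrev BallSpace (d : ℕ) (r : ℝ) : Type := Metric.closedBall (0 : Rd d) r

instance (d : ℕ) (r : ℝ) : CompactSpace (BallSpace d r) :=
  isCompact_iff_compactSpace.1 (isCompact_closedBall _ _)

/-- The inclusion of the closed ball. -/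
def ballIncl (d : ℕ) (r : ℝ) : C(BallSpace d r, Rd d) := ⟨Subtype.val, continuous_subtype_val⟩

/-- The ball itself serves as probability space, with the identity as random variable. -/
theorem exists_law_ballIncl {μ : Pc d} {r : ℝ} (hμ : μ.LivesOn (ball0 d r)) :
    ∃ (P : Measure (BallSpace d r)) (_ : IsProbabilityMeasure P), law P (ballIncl d r) = μ := by
  have hemb : MeasurableEmbedding (Subtype.val : BallSpace d r → Rd d) :=
    MeasurableEmbedding.subtype_coe Metric.isClosed_closedBall.measurableSet
  have hmap : (μ.meas.comap (Subtype.val : BallSpace d r → Rd d)).map Subtype.val = μ.meas := by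
    rw [hemb.map_comap, Subtype.range_coe]
    refine Measure.restrict_eq_self_of_ae_mem ?_
    rw [Pc.livesOn_iff] at hμ
    filter_upwards [hμ] with x hx using mem_closedBall_zero_iff.2 hx
  refine ⟨μ.meas.comap Subtype.val, ?_, ?_⟩
  · constructor
    have := congrArg (fun ν => ν univ) hmap
    simpa [Measure.map_apply measurable_subtype_coe] using this
  · exact Subtype.ext hmap

/-- A plan with marginals on the ball is carried by the product of two balls; there the coordinate
projections are continuous and bounded, and the plan is their joint law. This turns statements about
arbitrary plans into statements about random variables. -/
theorem exists_jointPlan_eq {μ₁ μ₂ : Pc d} {r : ℝ} (h₁ : μ₁.LivesOn (ball0 d r))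
    (h₂ : μ₂.LivesOn (ball0 d r)) (γ : transportPlans μ₁ μ₂) :
    ∃ (P : Measure (BallSpace d r × BallSpace d r)) (_ : IsProbabilityMeasure P)
      (X Y : C(BallSpace d r × BallSpace d r, Rd d)), ‖X‖ ≤ max r 0 ∧ ‖Y‖ ≤ max r 0 ∧
        law P X = μ₁ ∧ law P Y = μ₂ ∧ (jointPlan P X Y).1 = γ.1 := by
  obtain ⟨γ, hγ1, hγ2⟩ := γ
  have hms : MeasurableSet (ball0 d r) := Metric.isClosed_closedBall.measurableSet
  let ι : BallSpace d r × BallSpace d r → Rd d × Rd d := Prod.map Subtype.val Subtype.val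
  have hemb : MeasurableEmbedding ι :=
    (MeasurableEmbedding.subtype_coe hms).prodMap (MeasurableEmbedding.subtype_coe hms)
  have hmap : (γ.comap ι).map ι = γ := by
    rw [hemb.map_comap]
    refine Measure.restrict_eq_self_of_ae_mem ?_
    rw [Pc.livesOn_iff] at h₁ h₂
    rw [← hγ1] at h₁
    rw [← hγ2] at h₂
    filter_upwards [ae_of_ae_map measurable_fst.aemeasurable h₁,
      ae_of_ae_map measurable_snd.aemeasurable h₂] with z hz1 hz2
    exact ⟨(⟨z.1, mem_closedBall_zero_iff.2 hz1⟩, ⟨z.2, mem_closedBall_zero_iff.2 hz2⟩), rfl⟩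
  have hprob : IsProbabilityMeasure (γ.comap ι) := by
    constructor
    have h3 := congrArg (fun ν => ν univ) hmap
    have h4 := congrArg (fun ν => ν univ) hγ1
    simp only [Measure.map_apply hemb.measurable MeasurableSet.univ, preimage_univ,
      Measure.map_apply measurable_fst MeasurableSet.univ, measure_univ] at h3 h4
    rw [h3, h4]
  refine ⟨γ.comap ι, hprob, (ballIncl d r).comp ⟨Prod.fst, continuous_fst⟩,
    (ballIncl d r).comp ⟨Prod.snd, continuous_snd⟩, ?_, ?_, ?_, ?_, hmap⟩
  · refine (ContinuousMap.norm_le _ (le_max_right _ _)).2 fun z => ?_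
    exact (mem_closedBall_zero_iff.1 z.1.2).trans (le_max_left _ _)
  · refine (ContinuousMap.norm_le _ (le_max_right _ _)).2 fun z => ?_
    exact (mem_closedBall_zero_iff.1 z.2.2).trans (le_max_left _ _)
  · apply Subtype.ext
    change Measure.map _ _ = μ₁.meas
    rw [← hγ1]
    conv_rhs => rw [← hmap]
    rw [Measure.map_map measurable_fst hemb.measurable]
    rfl
  · apply Subtype.ext
    change Measure.map _ _ = μ₂.meas
    rw [← hγ2]
    conv_rhs => rw [← hmap]
    rw [Measure.map_map measurable_snd hemb.measurable]
    rfl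

end Law

/-! ### Velocity fields and their action on random variables -/

section Field

variable {d : ℕ}

/-- The bounds on a controlled velocity field, with exceptional null sets that do not depend on the
control. -/
structure UniformField {U : Type*} [MetricSpace U] (T : ℝ) (m : ℝ → ℝ) (l L : ℝ → ℝ → ℝ)
    (v : ℝ → Pc d → U → Rd d → Rd d) : Prop where
  growth_integrable : IsL1Nonneg T m
  space_integrable : ∀ R > 0, IsL1Nonneg T (l R)
  measure_integrable : ∀ R > 0, IsL1Nonneg T (L R)
  measurable : ∀ μ u x, AEMeasurable (fun t => v t μ u x) (volume.restrict (Icc 0 T))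
  control : ∀ᵐ t ∂volume.restrict (Icc 0 T), ∀ μ x, Continuous fun u => v t μ u x
  growth : ∀ᵐ t ∂volume.restrict (Icc 0 T), ∀ u μ x, ‖v t μ u x‖ ≤ m t * (1 + ‖x‖ + moment1 μ)
  lipschitz_space : ∀ R > 0, ∀ᵐ t ∂volume.restrict (Icc 0 T), ∀ u, ∀ μ : Pc d,
    μ.LivesOn (ball0 d R) → ∀ x ∈ ball0 d R, ∀ y ∈ ball0 d R,
      ‖v t μ u x - v t μ u y‖ ≤ l R t * ‖x - y‖
  lipschitz_measure : ∀ R > 0, ∀ᵐ t ∂volume.restrict (Icc 0 T), ∀ u, ∀ μ ν : Pc d,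
    μ.LivesOn (ball0 d R) → ν.LivesOn (ball0 d R) →
    ∀ x ∈ ball0 d R, ‖v t μ u x - v t ν u x‖ ≤ L R t * wasserstein 1 μ ν

/-- For fixed t the three inequalities are closed conditions on u, by continuity in the control, and
the compact metric space U is separable. One null set thus serves all controls, which is needed
before substituting u = u(t). -/
theorem OCP.exists_uniformField {U : Type*} [MetricSpace U] [CompactSpace U] {T : ℝ}
    {v : ℝ → Pc d → U → Rd d → Rd d} {φ : Pc d → ℝ} (h : OCP T v φ) :
    ∃ m l L, UniformField T m l L v := by
  obtain ⟨m, l, L, hm, hl, hL, hCE⟩ := h.velocity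
  refine ⟨m, l, L, hm, hl, hL, fun μ u x => (hCE u).measurable μ x, h.continuous_control,
    ?_, ?_, ?_⟩
  · refine ae_forall_of_forall_ae ?_ fun u => (hCE u).sublinear
    filter_upwards [h.continuous_control] with t ht
    simp only [ofPred_forall]
    exact isClosed_iInter fun μ => isClosed_iInter fun x =>
      isClosed_le (ht μ x).norm continuous_const
  · intro R hR
    refine ae_forall_of_forall_ae ?_ fun u => (hCE u).lipschitz_space R hR
    filter_upwards [h.continuous_control] with t ht
    simp only [ofPred_forall]
    exact isClosed_iInter fun μ => isClosed_iInter fun _ => isClosed_iInter fun x =>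
      isClosed_iInter fun _ => isClosed_iInter fun y => isClosed_iInter fun _ =>
      isClosed_le ((ht μ x).sub (ht μ y)).norm continuous_const
  · intro R hR
    refine ae_forall_of_forall_ae ?_ fun u => (hCE u).lipschitz_measure R hR
    filter_upwards [h.continuous_control] with t ht
    simp only [ofPred_forall]
    exact isClosed_iInter fun μ => isClosed_iInter fun ν => isClosed_iInter fun _ =>
      isClosed_iInter fun _ => isClosed_iInter fun x => isClosed_iInter fun _ =>
      isClosed_le ((ht μ x).sub (ht ν x)).norm continuous_const

/-- A `W₁`-continuous curve of measures that live on a common ball. -/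
structure BoundedCurve (τ T R : ℝ) (N : ℝ → Pc d) : Prop where
  livesOn : ∀ t ∈ Icc τ T, (N t).LivesOn (ball0 d R)
  continuous : ∀ t ∈ Icc τ T, Tendsto (fun s => wasserstein 1 (N s) (N t)) (𝓝[Icc τ T] t) (𝓝 0)

theorem BoundedCurve.mono {τ T R R' : ℝ} {N : ℝ → Pc d} (h : BoundedCurve τ T R N) (hR : R ≤ R') :
    BoundedCurve τ T R' N :=
  ⟨fun t ht => (h.livesOn t ht).mono hR, h.continuous⟩

/-- A non-local velocity field with the bounds used in the well-posedness theory. -/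
structure LipField (τ T : ℝ) (m : ℝ → ℝ) (l L : ℝ → ℝ → ℝ) (w : ℝ → Pc d → Rd d → Rd d) :
    Prop where
  growth_integrable : IntegrableOn m (Icc τ T)
  growth_nonneg : ∀ t ∈ Icc τ T, 0 ≤ m t
  space_integrable : ∀ R > 0, IntegrableOn (l R) (Icc τ T)
  space_nonneg : ∀ R > 0, ∀ t ∈ Icc τ T, 0 ≤ l R t
  measure_integrable : ∀ R > 0, IntegrableOn (L R) (Icc τ T)
  measure_nonneg : ∀ R > 0, ∀ t ∈ Icc τ T, 0 ≤ L R t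
  measurable : ∀ (R : ℝ) (N : ℝ → Pc d) (x : ℝ → Rd d), BoundedCurve τ T R N → Continuous x →
    AEStronglyMeasurable (fun t => w t (N t) (x t)) (volume.restrict (Icc τ T))
  growth : ∀ᵐ t ∂volume.restrict (Icc τ T), ∀ μ x, ‖w t μ x‖ ≤ m t * (1 + ‖x‖ + moment1 μ)
  lipschitz_space : ∀ R > 0, ∀ᵐ t ∂volume.restrict (Icc τ T), ∀ μ : Pc d,
    μ.LivesOn (ball0 d R) → ∀ x ∈ ball0 d R, ∀ y ∈ ball0 d R, ‖w t μ x - w t μ y‖ ≤ l R t * ‖x - y‖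
  lipschitz_measure : ∀ R > 0, ∀ᵐ t ∂volume.restrict (Icc τ T), ∀ μ ν : Pc d,
    μ.LivesOn (ball0 d R) → ν.LivesOn (ball0 d R) →
    ∀ x ∈ ball0 d R, ‖w t μ x - w t ν x‖ ≤ L R t * wasserstein 1 μ ν

/-- The Lipschitz bounds in measure and space are uniform in the control, so joint continuity
reduces to continuity in u at one frozen pair (measure, point). -/
theorem UniformField.continuous_along {U : Type*} [MetricSpace U] {T : ℝ} {m : ℝ → ℝ}
    {l L : ℝ → ℝ → ℝ} {v : ℝ → Pc d → U → Rd d → Rd d} (h : UniformField T m l L v)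
    {S : Type*} [TopologicalSpace S] {N : S → Pc d} {x : S → Rd d} {R : ℝ}
    (hN : ∀ s, (N s).LivesOn (ball0 d R))
    (hNc : ∀ s, Tendsto (fun r => wasserstein 1 (N r) (N s)) (𝓝 s) (𝓝 0))
    (hx : Continuous x) (hxR : ∀ s, ‖x s‖ ≤ R) :
    ∀ᵐ t ∂volume.restrict (Icc 0 T), Continuous fun p : S × U => v t (N p.1) p.2 (x p.1) := by
  set R' := max R 1
  have hR' : 0 < R' := by positivity
  have hN' : ∀ s, (N s).LivesOn (ball0 d R') := fun s => (hN s).mono (le_max_left _ _)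
  have hx' : ∀ s, x s ∈ ball0 d R' := fun s =>
    mem_closedBall_zero_iff.2 ((hxR s).trans (le_max_left _ _))
  filter_upwards [h.control, h.lipschitz_space R' hR', h.lipschitz_measure R' hR'] with t h1 h2 h3
  rw [continuous_iff_continuousAt]
  rintro ⟨s, u⟩
  have e1 : Tendsto (fun p : S × U => L R' t * wasserstein 1 (N p.1) (N s) +
      l R' t * ‖x p.1 - x s‖ + ‖v t (N s) p.2 (x s) - v t (N s) u (x s)‖) (𝓝 (s, u)) (𝓝 0) := by
    have a1 : Tendsto (fun p : S × U => L R' t * wasserstein 1 (N p.1) (N s)) (𝓝 (s, u))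
        (𝓝 (L R' t * 0)) :=
      ((hNc s).comp (continuous_fst.tendsto (s, u))).const_mul _
    have a2 : Tendsto (fun p : S × U => l R' t * ‖x p.1 - x s‖) (𝓝 (s, u))
        (𝓝 (l R' t * ‖x s - x s‖)) := by
      have : Continuous fun p : S × U => l R' t * ‖x p.1 - x s‖ := by fun_prop
      exact this.tendsto (s, u)
    have a3 : Tendsto (fun p : S × U => ‖v t (N s) p.2 (x s) - v t (N s) u (x s)‖) (𝓝 (s, u))
        (𝓝 ‖v t (N s) u (x s) - v t (N s) u (x s)‖) := by
      have : Continuous fun p : S × U => ‖v t (N s) p.2 (x s) - v t (N s) u (x s)‖ :=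
        (((h1 (N s) (x s)).comp continuous_snd).sub continuous_const).norm
      exact this.tendsto (s, u)
    have := (a1.add a2).add a3
    simpa using this
  rw [ContinuousAt, tendsto_iff_norm_sub_tendsto_zero]
  refine squeeze_zero (fun _ => norm_nonneg _) (fun p => ?_) e1
  have b1 := h3 p.2 (N p.1) (N s) (hN' _) (hN' _) (x p.1) (hx' _)
  have b2 := h2 p.2 (N s) (hN' _) (x p.1) (hx' _) (x s) (hx' _)
  calc ‖v t (N p.1) p.2 (x p.1) - v t (N s) u (x s)‖
      = ‖(v t (N p.1) p.2 (x p.1) - v t (N s) p.2 (x p.1)) +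
          (v t (N s) p.2 (x p.1) - v t (N s) p.2 (x s)) +
          (v t (N s) p.2 (x s) - v t (N s) u (x s))‖ := by congr 1; abel
    _ ≤ _ := (norm_add₃_le).trans (by gcongr)

/-- Only measurability needs an argument: along a bounded curve, v is a Carathéodory function of t
and of (s, u) in [τ,T] × U, and it is composed with the measurable map t ↦ (t, u(t)). -/
theorem UniformField.lipField {U : Type*} [MetricSpace U] [CompactSpace U]
    [MeasurableSpace U] [BorelSpace U] {T : ℝ} {m : ℝ → ℝ}
    {l L : ℝ → ℝ → ℝ} {v : ℝ → Pc d → U → Rd d → Rd d} (h : UniformField T m l L v)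
    {u : ℝ → U} (hu : AEMeasurable u (volume.restrict (Icc 0 T))) {τ : ℝ} (hτ : τ ∈ Icc 0 T) :
    LipField τ T m l L (fun t ν x => v t ν (u t) x) := by
  have hsub : Icc τ T ⊆ Icc 0 T := Icc_subset_Icc hτ.1 le_rfl
  have hle : volume.restrict (Icc τ T) ≤ volume.restrict (Icc 0 T) :=
    Measure.restrict_mono hsub le_rfl
  refine ⟨h.growth_integrable.1.mono_set hsub, fun t ht => h.growth_integrable.2 t (hsub ht),
    fun R hR => (h.space_integrable R hR).1.mono_set hsub,
    fun R hR t ht => (h.space_integrable R hR).2 t (hsub ht),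
    fun R hR => (h.measure_integrable R hR).1.mono_set hsub,
    fun R hR t ht => (h.measure_integrable R hR).2 t (hsub ht), ?_, ?_, ?_, ?_⟩
  · intro R N x hN hx
    have hle' : τ ≤ T := hτ.2
    obtain ⟨B, hB⟩ := isCompact_Icc.exists_bound_of_continuousOn (hx.continuousOn (s := Icc τ T))
    have hcont := h.continuous_along (S := Icc τ T) (N := fun s => N s) (x := fun s => x s)
      (R := max R B) (fun s => (hN.livesOn s s.2).mono (le_max_left _ _))
      (fun s => by
        have h1 := hN.continuous s s.2
        rw [nhdsWithin_eq_map_subtype_coe s.2] at h1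
        exact tendsto_map'_iff.1 h1)
      (by fun_prop) (fun s => (hB s s.2).trans (le_max_right _ _))
    have key := aestronglyMeasurable_caratheodory_comp (μ := volume.restrict (Icc τ T))
      (S := Icc τ T × U) (f := fun t p => v t (N p.1) p.2 (x p.1))
      (p := fun t => (projIcc τ T hle' t, u t))
      (fun p => ((h.measurable (N p.1) p.2 (x p.1)).mono_measure hle).aestronglyMeasurable)
      (ae_mono hle hcont)
      ((continuous_projIcc.measurable.aemeasurable).prodMk (hu.mono_measure hle))
    refine key.congr ?_
    filter_upwards [ae_restrict_mem measurableSet_Icc] with t ht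
    simp [projIcc_of_mem hle' ht]
  · filter_upwards [ae_mono hle h.growth] with t ht using ht (u t)
  · intro R hR
    filter_upwards [ae_mono hle (h.lipschitz_space R hR)] with t ht using ht (u t)
  · intro R hR
    filter_upwards [ae_mono hle (h.lipschitz_measure R hR)] with t ht using ht (u t)

variable {Ω : Type*} [MetricSpace Ω] [CompactSpace Ω]

/-- The velocity field acting on random variables. -/
noncomputable def fieldOn (w : ℝ → Pc d → Rd d → Rd d) (t : ℝ) (ν : Pc d) (X : C(Ω, Rd d)) :
    C(Ω, Rd d) :=
  -- The default value 0 is taken when the composition is not continuous; `LipField.fieldOn_apply`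
  -- confines this to a null set of times.
  ContinuousMap.mkD (fun o => w t ν (X o)) 0

variable {τ T : ℝ} {m : ℝ → ℝ} {l L : ℝ → ℝ → ℝ} {w : ℝ → Pc d → Rd d → Rd d}

namespace LipField

/-- The Lipschitz bound on each ball comes with its own null set, so integer radii are used to
exhaust the space. -/
theorem continuous_space (h : LipField τ T m l L w) :
    ∀ᵐ t ∂volume.restrict (Icc τ T), ∀ μ, Continuous (w t μ) := by
  have : ∀ᵐ t ∂volume.restrict (Icc τ T), ∀ n : ℕ, ∀ μ : Pc d,
      μ.LivesOn (ball0 d ((n : ℝ) + 1)) → ∀ x ∈ ball0 d ((n : ℝ) + 1), ∀ y ∈ ball0 d ((n : ℝ) + 1),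
      ‖w t μ x - w t μ y‖ ≤ l (n + 1) t * ‖x - y‖ :=
    ae_all_iff.2 fun n => h.lipschitz_space _ (by positivity)
  filter_upwards [this] with t ht μ
  rw [continuous_iff_continuousAt]
  intro x
  obtain ⟨R, _, hR⟩ := μ.exists_livesOn
  obtain ⟨n, hn⟩ := exists_nat_ge (max R (‖x‖ + 1))
  have hμ : μ.LivesOn (ball0 d ((n : ℝ) + 1)) := hR.mono (by linarith [le_max_left R (‖x‖ + 1)])
  have hxn : ‖x‖ + 1 ≤ n := (le_max_right _ _).trans hn
  have hlip : LipschitzOnWith (Real.toNNReal (l (n + 1) t)) (w t μ) (ball0 d ((n : ℝ) + 1)) := by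
    refine LipschitzOnWith.of_dist_le_mul fun y hy z hz => ?_
    rw [dist_eq_norm, dist_eq_norm]
    refine (ht n μ hμ y hy z hz).trans ?_
    gcongr
    exact Real.le_coe_toNNReal _
  refine hlip.continuousOn.continuousAt ?_
  refine Metric.closedBall_mem_nhds_of_mem ?_
  rw [mem_ball_zero_iff]; linarith

theorem fieldOn_apply (h : LipField τ T m l L w) :
    ∀ᵐ t ∂volume.restrict (Icc τ T), ∀ ν (X : C(Ω, Rd d)) o, fieldOn w t ν X o = w t ν (X o) := by
  filter_upwards [h.continuous_space] with t ht ν X o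
  exact ContinuousMap.mkD_apply_of_continuous ((ht ν).comp X.continuous)

theorem aestronglyMeasurable_fieldOn (h : LipField τ T m l L w) {R : ℝ} {N : ℝ → Pc d}
    (hN : BoundedCurve τ T R N) {X : ℝ → C(Ω, Rd d)} (hX : Continuous X) :
    AEStronglyMeasurable (fun t => fieldOn w t (N t) (X t)) (volume.restrict (Icc τ T)) := by
  refine aestronglyMeasurable_continuousMap fun o => ?_
  refine (h.measurable R N (fun t => X t o) hN ((continuous_eval_const o).comp hX)).congr ?_
  filter_upwards [h.fieldOn_apply (Ω := Ω)] with t ht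
  exact (ht _ _ _).symm

theorem norm_fieldOn_le (h : LipField τ T m l L w) :
    ∀ᵐ t ∂volume.restrict (Icc τ T), ∀ ν (X : C(Ω, Rd d)),
      ‖fieldOn w t ν X‖ ≤ m t * (1 + ‖X‖ + moment1 ν) := by
  filter_upwards [h.fieldOn_apply (Ω := Ω), h.growth, ae_restrict_mem measurableSet_Icc]
    with t h1 h2 ht ν X
  have hm := h.growth_nonneg t ht
  have hM : 0 ≤ moment1 ν := integral_nonneg fun _ => norm_nonneg _
  refine (ContinuousMap.norm_le _ (by positivity)).2 fun o => ?_
  rw [h1]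
  refine (h2 _ _).trans ?_
  gcongr
  exact X.norm_coe_le_norm o

theorem norm_fieldOn_sub_le (h : LipField τ T m l L w) {R : ℝ} (hR : 0 < R) :
    ∀ᵐ t ∂volume.restrict (Icc τ T), ∀ (ν ν' : Pc d) (X Y : C(Ω, Rd d)),
      ν.LivesOn (ball0 d R) → ν'.LivesOn (ball0 d R) → ‖X‖ ≤ R → ‖Y‖ ≤ R → ∀ o,
      ‖fieldOn w t ν X o - fieldOn w t ν' Y o‖ ≤
        l R t * ‖X o - Y o‖ + L R t * wasserstein 1 ν ν' := by
  filter_upwards [h.fieldOn_apply (Ω := Ω), h.lipschitz_space R hR, h.lipschitz_measure R hR]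
    with t h1 h2 h3 ν ν' X Y hν hν' hX hY o
  have hXo : X o ∈ ball0 d R := mem_closedBall_zero_iff.2 ((X.norm_coe_le_norm o).trans hX)
  have hYo : Y o ∈ ball0 d R := mem_closedBall_zero_iff.2 ((Y.norm_coe_le_norm o).trans hY)
  rw [h1, h1]
  calc ‖w t ν (X o) - w t ν' (Y o)‖
      = ‖(w t ν (X o) - w t ν (Y o)) + (w t ν (Y o) - w t ν' (Y o))‖ := by congr 1; abel
    _ ≤ _ := (norm_add_le _ _).trans
      (add_le_add (h2 ν hν _ hXo _ hYo) (h3 ν ν' hν hν' _ hYo))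

variable [MeasurableSpace Ω] [BorelSpace Ω] (P : Measure Ω) [IsProbabilityMeasure P]

theorem _root_.MeanField.exists_boundedCurve_law (τ T : ℝ) {X : ℝ → C(Ω, Rd d)}
    (hX : Continuous X) : ∃ R > 0, (∀ t ∈ Icc τ T, ‖X t‖ ≤ R) ∧
      BoundedCurve τ T R fun t => law P (X t) := by
  obtain ⟨R, hR⟩ := isCompact_Icc.exists_bound_of_continuousOn (hX.continuousOn (s := Icc τ T))
  have hR' : ∀ t ∈ Icc τ T, ‖X t‖ ≤ max R 1 := fun t ht => (hR t ht).trans (le_max_left _ _)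
  refine ⟨max R 1, by positivity, hR', fun t ht => law_livesOn P (hR' t ht), fun t _ => ?_⟩
  refine squeeze_zero (fun _ => wasserstein_nonneg _ _ _)
    (fun s => wasserstein_law_le_norm P (X s) (X t)) ?_
  have : Continuous fun s => ‖X s - X t‖ := by fun_prop
  have := this.tendsto t
  simp only [sub_self, norm_zero] at this
  exact this.mono_left nhdsWithin_le_nhds

/-- Lagrangian solutions of the non-local equation. -/
theorem exists_lagrangian (h : LipField τ T m l L w) (hτ : τ ≤ T) (X₀ : C(Ω, Rd d)) :
    ∃ X : ℝ → C(Ω, Rd d), Continuous X ∧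
      IntegrableOn (fun t => fieldOn w t (law P (X t)) (X t)) (Icc τ T) ∧
      ∀ t ∈ Icc τ T, X t = X₀ + ∫ s in τ..t, fieldOn w s (law P (X s)) (X s) := by
  -- The first moment of the law of X is at most ‖X‖, so the growth bound becomes m(1 + 2‖X‖) ≤ 2m(1
  -- + ‖X‖).
  refine exists_caratheodory_solution hτ (fun t X => fieldOn w t (law P X) X)
    (m := fun t => 2 * m t) (h.growth_integrable.const_mul 2)
    (fun t ht => by have := h.growth_nonneg t ht; positivity) ?_ ?_ ?_ X₀
  · intro X hX
    obtain ⟨R, _, _, hR⟩ := exists_boundedCurve_law P τ T hX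
    exact h.aestronglyMeasurable_fieldOn hR hX
  · filter_upwards [h.norm_fieldOn_le (Ω := Ω), ae_restrict_mem measurableSet_Icc] with t ht htm X
    have h0 := h.growth_nonneg t htm
    calc ‖fieldOn w t (law P X) X‖ ≤ m t * (1 + ‖X‖ + moment1 (law P X)) := ht _ _
      _ ≤ m t * (2 * (1 + ‖X‖)) := by
          gcongr; linarith [moment1_law_le P X]
      _ = _ := by ring
  · intro R hR
    refine ⟨fun t => l R t + L R t, (h.space_integrable R hR).add (h.measure_integrable R hR),
      fun t ht => add_nonneg (h.space_nonneg R hR t ht) (h.measure_nonneg R hR t ht), ?_⟩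
    filter_upwards [h.norm_fieldOn_sub_le (Ω := Ω) hR, ae_restrict_mem measurableSet_Icc]
      with t ht htm X Y hX hY
    have hl0 := h.space_nonneg R hR t htm
    have hL0 := h.measure_nonneg R hR t htm
    refine (ContinuousMap.norm_le _ (by positivity)).2 fun o => ?_
    refine (ht _ _ X Y (law_livesOn P hX) (law_livesOn P hY) hX hY o).trans ?_
    rw [add_mul]
    gcongr
    · exact (X - Y).norm_coe_le_norm o
    · exact wasserstein_law_le_norm P X Y

/-- Lagrangian solutions of the linear equation obtained by freezing the measure argument. -/
theorem exists_lagrangian_frozen (h : LipField τ T m l L w) (hτ : τ ≤ T) {R₀ : ℝ} {N : ℝ → Pc d}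
    (hN : BoundedCurve τ T R₀ N) (X₀ : C(Ω, Rd d)) :
    ∃ X : ℝ → C(Ω, Rd d), Continuous X ∧
      IntegrableOn (fun t => fieldOn w t (N t) (X t)) (Icc τ T) ∧
      ∀ t ∈ Icc τ T, X t = X₀ + ∫ s in τ..t, fieldOn w s (N s) (X s) := by
  have hM : ∀ t ∈ Icc τ T, moment1 (N t) ≤ max R₀ 0 := by
    intro t ht
    have := hN.livesOn t ht
    rw [Pc.livesOn_iff] at this
    calc moment1 (N t) ≤ ∫ _, max R₀ 0 ∂(N t).meas := by
          refine integral_mono_ae ((N t).integrable_of_continuous continuous_norm)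
            (integrable_const _) ?_
          filter_upwards [this] with x hx using hx.trans (le_max_left _ _)
      _ = _ := by simp
  refine exists_caratheodory_solution hτ (fun t X => fieldOn w t (N t) X)
    (m := fun t => m t * (1 + max R₀ 0)) (h.growth_integrable.mul_const _)
    (fun t ht => by have := h.growth_nonneg t ht; positivity) ?_ ?_ ?_ X₀
  · intro X hX
    exact h.aestronglyMeasurable_fieldOn hN hX
  · filter_upwards [h.norm_fieldOn_le (Ω := Ω), ae_restrict_mem measurableSet_Icc] with t ht htm X
    have h0 := h.growth_nonneg t htm
    have h1 := hM t htm
    have h2 : (0 : ℝ) ≤ max R₀ 0 := le_max_right _ _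
    calc ‖fieldOn w t (N t) X‖ ≤ m t * (1 + ‖X‖ + moment1 (N t)) := ht _ _
      _ ≤ m t * ((1 + max R₀ 0) * (1 + ‖X‖)) := by
          gcongr; nlinarith [norm_nonneg X]
      _ = _ := by ring
  · intro R hR
    -- The Lipschitz bound in space asks for the points and the frozen measures to lie in the same
    -- ball.
    set R' := max R R₀
    have hR' : 0 < R' := hR.trans_le (le_max_left _ _)
    refine ⟨l R', h.space_integrable R' hR', h.space_nonneg R' hR', ?_⟩
    filter_upwards [h.fieldOn_apply (Ω := Ω), h.lipschitz_space R' hR',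
      ae_restrict_mem measurableSet_Icc] with t ht1 ht htm X Y hX hY
    have hl0 := h.space_nonneg R' hR' t htm
    refine (ContinuousMap.norm_le _ (by positivity)).2 fun o => ?_
    have hXo : X o ∈ ball0 d R' := mem_closedBall_zero_iff.2
      ((X.norm_coe_le_norm o).trans (hX.trans (le_max_left _ _)))
    have hYo : Y o ∈ ball0 d R' := mem_closedBall_zero_iff.2
      ((Y.norm_coe_le_norm o).trans (hY.trans (le_max_left _ _)))
    rw [ContinuousMap.sub_apply, ht1, ht1]
    refine (ht _ ((hN.livesOn t htm).mono (le_max_right _ _)) _ hXo _ hYo).trans ?_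
    gcongr
    exact (X - Y).norm_coe_le_norm o

/-- Grönwall for 1 + ‖X‖ with kernel 2m; the form `gronwall_integrable` doubles the exponent once
more. The bound is independent of the Lipschitz constants. -/
theorem norm_lagrangian_le (h : LipField τ T m l L w) {X₀ : C(Ω, Rd d)} {X : ℝ → C(Ω, Rd d)}
    (hX : Continuous X)
    (heq : ∀ t ∈ Icc τ T, X t = X₀ + ∫ s in τ..t, fieldOn w s (law P (X s)) (X s)) :
    ∀ t ∈ Icc τ T, ‖X t‖ ≤ 2 * (1 + ‖X₀‖) * Real.exp (4 * ∫ s in τ..T, m s) := by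
  intro t ht
  have hτ : τ ∈ Icc τ T := ⟨le_rfl, ht.1.trans ht.2⟩
  have hT : T ∈ Icc τ T := ⟨ht.1.trans ht.2, le_rfl⟩
  have hint : IntegrableOn (fun s => 2 * m s * (1 + ‖X s‖)) (Icc τ T) :=
    IntegrableOn.mul_continuousOn (h.growth_integrable.const_mul 2) (by fun_prop) isCompact_Icc
  have key := gronwall_integrable (l := fun s => 2 * m s) (f := fun s => 1 + ‖X s‖) (c := 1 + ‖X₀‖)
    (h.growth_integrable.const_mul 2)
    (fun t ht => by have := h.growth_nonneg t ht; positivity) (by fun_prop) (by positivity)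
    (fun t ht => by
      rw [heq t ht, add_assoc]
      gcongr
      refine (norm_add_le _ _).trans ?_
      gcongr
      refine norm_integral_le_of_ae_restrict hint ?_ hτ ht ht.1
      filter_upwards [h.norm_fieldOn_le (Ω := Ω), ae_restrict_mem measurableSet_Icc]
        with s hs hsm
      have h0 := h.growth_nonneg s hsm
      calc ‖fieldOn w s (law P (X s)) (X s)‖ ≤ m s * (1 + ‖X s‖ + moment1 (law P (X s))) := hs _ _
        _ ≤ m s * (2 * (1 + ‖X s‖)) := by
            gcongr; linarith [moment1_law_le P (X s)]
        _ = _ := by ring) t ht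
  have hmono := primitive_mono h.growth_integrable h.growth_nonneg ht hT ht.2
  rw [intervalIntegral.integral_const_mul] at key
  calc ‖X t‖ ≤ 1 + ‖X t‖ := by linarith
    _ ≤ _ := key
    _ ≤ _ := by
        gcongr ?_ * Real.exp ?_
        linarith

end LipField

end Field

/-! ### Laws of Lagrangian curves solve the continuity equation -/

section Lagrangian

variable {d : ℕ} {Ω : Type*} [MetricSpace Ω] [CompactSpace Ω] [MeasurableSpace Ω] [BorelSpace Ω]
  (P : Measure Ω) [IsProbabilityMeasure P]

/-- Differentiability in the sup norm bounds the increments of X uniformly over Ω by a multiple of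
|r - t|; together with a local Lipschitz constant of ξ this dominates the difference quotients. -/
theorem hasDerivAt_integral_comp_curve {X : ℝ → C(Ω, Rd d)} {G : C(Ω, Rd d)} {t : ℝ}
    (hX : HasDerivAt X G t) {ξ : ℝ × Rd d → ℝ} (hξ : ContDiff ℝ ∞ ξ) :
    HasDerivAt (fun r => ∫ o, ξ (r, X r o) ∂P) (∫ o, fderiv ℝ ξ (t, X t o) (1, G o) ∂P) t := by
  obtain ⟨K, hK⟩ := (hξ.contDiffOn (s := Metric.closedBall t 1 ×ˢ ball0 d (‖X t‖ + 1)))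
    |>.exists_lipschitzOnWith (by simp)
    ((convex_closedBall _ _).prod (convex_closedBall _ _))
    ((isCompact_closedBall _ _).prod (isCompact_closedBall _ _))
  obtain ⟨C, hC⟩ := hX.isBigO_sub.bound
  have hball : ∀ᶠ r in 𝓝 t, ‖X r - X t‖ < 1 := by
    have := (hX.continuousAt.sub (continuousAt_const (y := X t))).norm
    have h2 : ContinuousAt (fun r => ‖X r - X t‖) t := this
    have h3 := h2.tendsto
    simp only [sub_self, norm_zero] at h3
    exact h3.eventually (gt_mem_nhds one_pos)
  set S : Set ℝ := {r | ‖X r - X t‖ ≤ C * ‖r - t‖ ∧ ‖X r - X t‖ < 1 ∧ r ∈ Metric.closedBall t 1}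
  have hS : S ∈ 𝓝 t := (hC.and (hball.and (Metric.closedBall_mem_nhds t one_pos)))
  have hfd : Continuous fun o => fderiv ℝ ξ (t, X t o) (1, G o) := by
    have h1 : Continuous (fderiv ℝ ξ) := hξ.continuous_fderiv (by simp)
    have h2 : Continuous fun o => fderiv ℝ ξ (t, X t o) := h1.comp (by fun_prop)
    exact h2.clm_apply (by fun_prop)
  have key := hasFDerivAt_integral_of_dominated_loc_of_lip' (𝕜 := ℝ) (μ := P)
    (F := fun r o => ξ (r, X r o)) (x₀ := t) (s := S)
    (F' := fun o => ContinuousLinearMap.toSpanSingleton ℝ (fderiv ℝ ξ (t, X t o) (1, G o)))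
    (bound := fun _ => K * (1 + C)) hS
    (fun r _ => (hξ.continuous.comp (by fun_prop)).aestronglyMeasurable)
    (integrable_continuous P (hξ.continuous.comp (by fun_prop)))
    ((ContinuousLinearMap.toSpanSingletonCLE (𝕜 := ℝ) (E := ℝ)).continuous.comp hfd).aestronglyMeasurable
    (Eventually.of_forall fun o r hr => ?_) (integrable_const _)
    (Eventually.of_forall fun o => ?_)
  · have h2 := key.2.hasDerivAt
    rw [ContinuousLinearMap.integral_apply key.1] at h2
    simpa using h2
  · have hXr : ‖X r‖ ≤ ‖X t‖ + 1 := by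
      calc ‖X r‖ = ‖X t + (X r - X t)‖ := by congr 1; abel
        _ ≤ ‖X t‖ + ‖X r - X t‖ := norm_add_le _ _
        _ ≤ _ := by linarith [hr.2.1]
    have := hK.dist_le_mul (r, X r o)
      ⟨hr.2.2, mem_closedBall_zero_iff.2 (((X r).norm_coe_le_norm o).trans hXr)⟩ (t, X t o)
      ⟨Metric.mem_closedBall_self zero_le_one,
        mem_closedBall_zero_iff.2 (((X t).norm_coe_le_norm o).trans (by linarith))⟩
    rw [dist_eq_norm] at this
    refine this.trans ?_
    rw [mul_assoc]
    gcongr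
    rw [dist_eq_norm, Prod.mk_sub_mk, Prod.norm_mk]
    have h3 : ‖X r o - X t o‖ ≤ C * ‖r - t‖ := ((X r - X t).norm_coe_le_norm o).trans hr.1
    have h4 : 0 ≤ C * ‖r - t‖ := (norm_nonneg _).trans h3
    rw [add_mul, one_mul]
    exact max_le (by linarith) (by linarith [norm_nonneg (r - t)])
  · have h1 : HasDerivAt (fun r => (r, X r o)) ((1 : ℝ), G o) t := by
      refine (hasDerivAt_id t).prodMk ?_
      exact (ContinuousMap.evalCLM ℝ o).hasFDerivAt.comp_hasDerivAt t hX
    have h2 := ((hξ.differentiable (by simp)) (t, X t o)).hasFDerivAt.comp_hasDerivAt t h1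
    exact h2.hasFDerivAt

/-- The fundamental theorem of calculus for a test function along a Lagrangian curve. -/
theorem integral_comp_curve {τ T : ℝ} {X : ℝ → C(Ω, Rd d)} {X₀ : C(Ω, Rd d)}
    {G : ℝ → C(Ω, Rd d)} (hX : Continuous X) (hG : IntegrableOn G (Icc τ T))
    (heq : ∀ t ∈ Icc τ T, X t = X₀ + ∫ s in τ..t, G s)
    {ξ : ℝ × Rd d → ℝ} (hξ : ContDiff ℝ ∞ ξ) :
    IntegrableOn (fun r => ∫ o, fderiv ℝ ξ (r, X r o) (1, G r o) ∂P) (Icc τ T) ∧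
    ∀ s ∈ Icc τ T, ∀ t ∈ Icc τ T, s ≤ t →
      ∫ r in s..t, ∫ o, fderiv ℝ ξ (r, X r o) (1, G r o) ∂P =
        ∫ o, ξ (t, X t o) ∂P - ∫ o, ξ (s, X s o) ∂P := by
  rcases lt_or_ge T τ with hτT | hτT
  · simp [Icc_eq_empty_of_lt hτT]
  have hτ : τ ∈ Icc τ T := ⟨le_rfl, hτT⟩
  have hT : T ∈ Icc τ T := ⟨hτT, le_rfl⟩
  obtain ⟨R, hR⟩ := isCompact_Icc.exists_bound_of_continuousOn (hX.continuousOn (s := Icc τ T))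
  obtain ⟨K, hK⟩ := (hξ.contDiffOn (s := Icc τ T ×ˢ ball0 d R))
    |>.exists_lipschitzOnWith (by simp)
    ((convex_Icc _ _).prod (convex_closedBall _ _))
    (isCompact_Icc.prod (isCompact_closedBall _ _))
  set h : ℝ → ℝ := fun r => ∫ o, ξ (r, X r o) ∂P with hh
  have hGn : IntegrableOn (fun r => ‖G r‖) (Icc τ T) := hG.norm
  set A : ℝ → ℝ := fun t => ∫ r in τ..t, ‖G r‖ with hA
  -- The tested integral is Lipschitz with respect to t + ∫‖G‖, which measures the motion of both
  -- arguments of ξ; it is therefore absolutely continuous.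
  have hgAC : AbsolutelyContinuousOnInterval (fun t => t + A t) τ T := by
    refine AbsolutelyContinuousOnInterval.add (f := fun t => t) (g := A) ?_ ?_
    · exact (LipschitzWith.id.lipschitzOnWith (s := uIcc τ T)).absolutelyContinuousOnInterval
    · exact (intervalIntegrable_of_integrableOn_Icc hGn hτ hT)
        |>.absolutelyContinuousOnInterval_intervalIntegral (by simp)
  have hdist : ∀ a ∈ Icc τ T, ∀ b ∈ Icc τ T, a ≤ b →
      dist (h a) (h b) ≤ K * dist (a + A a) (b + A b) := by
    intro a ha b hb hab
    have hi : ∀ {s t : ℝ}, s ∈ Icc τ T → t ∈ Icc τ T → IntervalIntegrable G volume s t :=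
      fun hs ht => intervalIntegrable_of_integrableOn_Icc hG hs ht
    have h1 : X b - X a = ∫ r in a..b, G r := by
      rw [heq a ha, heq b hb, ← intervalIntegral.integral_add_adjacent_intervals
        (hi hτ ha) (hi ha hb)]
      abel
    have h2 : ‖X b - X a‖ ≤ A b - A a := by
      rw [h1]
      refine (norm_integral_le_of_ae_restrict hGn
        (Eventually.of_forall fun _ => le_rfl) ha hb hab).trans (le_of_eq ?_)
      simp only [hA]
      rw [eq_sub_iff_add_eq', intervalIntegral.integral_add_adjacent_intervals]
      · exact intervalIntegrable_of_integrableOn_Icc hGn hτ ha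
      · exact intervalIntegrable_of_integrableOn_Icc hGn ha hb
    have h3 : dist (a + A a) (b + A b) = (b - a) + (A b - A a) := by
      have := (norm_nonneg _).trans h2
      rw [dist_comm, Real.dist_eq, abs_of_nonneg (by linarith)]; ring
    rw [h3, dist_comm, dist_eq_norm]
    simp only [hh]
    have hci : ∀ r, Integrable (fun o => ξ (r, X r o)) P := fun r =>
      integrable_continuous P (hξ.continuous.comp (by fun_prop))
    rw [← integral_sub (hci b) (hci a)]
    have h4 : ∀ o, ‖ξ (b, X b o) - ξ (a, X a o)‖ ≤ K * ((b - a) + (A b - A a)) := by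
      intro o
      have h5 := hK.dist_le_mul (b, X b o)
        ⟨hb, mem_closedBall_zero_iff.2 (((X b).norm_coe_le_norm o).trans (hR b hb))⟩ (a, X a o)
        ⟨ha, mem_closedBall_zero_iff.2 (((X a).norm_coe_le_norm o).trans (hR a ha))⟩
      rw [dist_eq_norm] at h5
      refine h5.trans ?_
      gcongr
      rw [dist_eq_norm, Prod.mk_sub_mk, Prod.norm_mk]
      have h6 : ‖X b o - X a o‖ ≤ A b - A a := ((X b - X a).norm_coe_le_norm o).trans h2
      have h7 : ‖b - a‖ = b - a := by rw [Real.norm_eq_abs, abs_of_nonneg (by linarith)]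
      rw [h7]
      exact max_le (by linarith [(norm_nonneg _).trans h6]) (by linarith)
    calc ‖∫ o, (ξ (b, X b o) - ξ (a, X a o)) ∂P‖
        ≤ ∫ _, (K * ((b - a) + (A b - A a)) : ℝ) ∂P :=
          norm_integral_le_of_norm_le (integrable_const _) (Eventually.of_forall h4)
      _ = _ := by simp
  have hAC : AbsolutelyContinuousOnInterval h τ T := by
    refine absolutelyContinuousOnInterval_of_dist_le (C := K) hgAC fun a ha b hb => ?_
    rw [uIcc_of_le hτT] at ha hb
    rcases le_total a b with hab | hab
    · exact hdist a ha b hb hab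
    · rw [dist_comm, dist_comm (a + A a)]; exact hdist b hb a ha hab
  have hderiv : ∀ᵐ t, t ∈ Icc τ T →
      deriv h t = ∫ o, fderiv ℝ ξ (t, X t o) (1, G t o) ∂P := by
    have h1 := (intervalIntegrable_of_integrableOn_Icc hG hτ hT).ae_hasDerivAt_integral
    -- The integral equation only holds on [τ,T], so a two-sided derivative of X is available at
    -- interior times only.
    have h2 : ∀ᵐ t : ℝ, t ≠ τ := by simp [ae_iff, measure_singleton]
    have h3 : ∀ᵐ t : ℝ, t ≠ T := by simp [ae_iff, measure_singleton]
    filter_upwards [h1, h2, h3] with t ht ht1 ht2 htm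
    rw [uIcc_of_le hτT] at ht
    have h4 : HasDerivAt X (G t) t := by
      refine ((ht htm τ hτ).const_add X₀).congr_of_eventuallyEq ?_
      have : Ioo τ T ∈ 𝓝 t := Ioo_mem_nhds (lt_of_le_of_ne htm.1 (Ne.symm ht1))
        (lt_of_le_of_ne htm.2 ht2)
      filter_upwards [this] with r hr
      exact heq r (Ioo_subset_Icc_self hr)
    exact (hasDerivAt_integral_comp_curve P h4 hξ).deriv
  have hint : IntegrableOn (deriv h) (Icc τ T) :=
    (intervalIntegrable_iff_integrableOn_Icc_of_le hτT).1 hAC.intervalIntegrable_deriv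
  refine ⟨hint.congr_fun_ae ((ae_restrict_iff' measurableSet_Icc).2 hderiv), ?_⟩
  intro s hs t ht hst
  have hsub : uIcc s t ⊆ uIcc τ T := by
    rw [uIcc_of_le hτT]; exact uIcc_subset_Icc hs ht
  rw [← (hAC.mono hsub).integral_deriv_eq_sub]
  refine intervalIntegral.integral_congr_ae ?_
  filter_upwards [hderiv] with r hr hrm
  rw [uIcc_of_le hτT] at hsub
  exact (hr (hsub (uIoc_subset_uIcc hrm))).symm

theorem deriv_add_inner_gradient_eq_fderiv {ξ : ℝ × Rd d → ℝ} (hξ : ContDiff ℝ ∞ ξ) (t : ℝ)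
    (x y : Rd d) :
    deriv (fun s => ξ (s, x)) t + inner ℝ (gradient (fun y => ξ (t, y)) x) y
      = fderiv ℝ ξ (t, x) (1, y) := by
  have hd : HasFDerivAt ξ (fderiv ℝ ξ (t, x)) (t, x) :=
    ((hξ.differentiable (by simp)) (t, x)).hasFDerivAt
  have h1 : HasDerivAt (fun s => ξ (s, x)) (fderiv ℝ ξ (t, x) (1, 0)) t :=
    hd.comp_hasDerivAt t ((hasDerivAt_id t).prodMk (hasDerivAt_const t x))
  have h2 : HasFDerivAt (fun y => ξ (t, y))
      ((fderiv ℝ ξ (t, x)).comp (ContinuousLinearMap.inr ℝ ℝ (Rd d))) x :=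
    hd.comp x (hasFDerivAt_prodMk_right t x)
  rw [inner_gradient_left, h1.deriv, h2.fderiv]
  simp only [ContinuousLinearMap.comp_apply, ContinuousLinearMap.inr_apply]
  rw [← map_add]
  simp

variable {τ T : ℝ} {m : ℝ → ℝ} {l L : ℝ → ℝ → ℝ} {w : ℝ → Pc d → Rd d → Rd d}

/-- Along the curve the distributional equation is the integral of the time derivative of ∫ ξ(t, X
t) dP, and ξ vanishes at times τ and T. -/
theorem LipField.solvesCE_law (h : LipField τ T m l L w) (hτT : τ ≤ T) {X₀ : C(Ω, Rd d)}
    {X : ℝ → C(Ω, Rd d)} (hX : Continuous X)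
    (hint : IntegrableOn (fun t => fieldOn w t (law P (X t)) (X t)) (Icc τ T))
    (heq : ∀ t ∈ Icc τ T, X t = X₀ + ∫ s in τ..t, fieldOn w s (law P (X s)) (X s)) :
    SolvesCE T w τ (law P X₀) fun t => law P (X t) := by
  obtain ⟨R, -, -, hN⟩ := exists_boundedCurve_law P τ T hX
  have hτ : τ ∈ Icc τ T := ⟨le_rfl, hτT⟩
  have hT : T ∈ Icc τ T := ⟨hτT, le_rfl⟩
  refine ⟨hN.continuous, ?_, fun ξ hξ _ hsupp => ?_⟩
  · have := heq τ hτ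
    simp only [intervalIntegral.integral_same, add_zero] at this
    rw [this]
  obtain ⟨h1, h2⟩ := integral_comp_curve P hX hint heq hξ
  have hae : (fun t => ∫ x, (deriv (fun s => ξ (s, x)) t +
      inner ℝ (gradient (fun y => ξ (t, y)) x) (w t (law P (X t)) x)) ∂(law P (X t)).meas)
      =ᵐ[volume.restrict (Icc τ T)] fun t => ∫ o, fderiv ℝ ξ (t, X t o)
        (1, fieldOn w t (law P (X t)) (X t) o) ∂P := by
    filter_upwards [h.continuous_space, h.fieldOn_apply (Ω := Ω)] with t ht1 ht2
    simp only [deriv_add_inner_gradient_eq_fderiv hξ]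
    rw [integral_law P (X t)]
    · simp only [ht2]
    · have h3 : Continuous (fderiv ℝ ξ) := hξ.continuous_fderiv (by simp)
      have h4 : Continuous fun x => fderiv ℝ ξ (t, x) := h3.comp (by fun_prop)
      exact h4.clm_apply (continuous_const.prodMk (ht1 _))
  refine ⟨h1.congr hae.symm, ?_⟩
  rw [integral_congr_ae hae, integral_Icc_eq_integral_Ioc, ← intervalIntegral.integral_of_le hτT,
    h2 τ hτ T hT hτT]
  have hz : ∀ t, t ∉ Ioo τ T → ∀ x, ξ (t, x) = 0 := by
    intro t ht x
    by_contra hne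
    exact ht (hsupp (subset_tsupport _ (Function.mem_support.2 hne))).1
  simp [hz τ (by simp), hz T (by simp)]

end Lagrangian

/-! ### From distributional to integral identities in time -/

section TimeRegularity

theorem exists_bound_deriv_smoothTransition :
    ∃ c > 0, ∀ x, |deriv Real.smoothTransition x| ≤ c := by
  have hc : Continuous (deriv Real.smoothTransition) :=
    (Real.smoothTransition.contDiff (n := 1)).continuous_deriv le_rfl
  obtain ⟨c, hcb⟩ := isCompact_Icc.exists_bound_of_continuousOn (hc.continuousOn (s := Icc 0 1))
  refine ⟨max c 1, by positivity, fun x => ?_⟩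
  by_cases hx : x ∈ Icc (0 : ℝ) 1
  · exact (hcb x hx).trans (le_max_left _ _)
  · have : deriv Real.smoothTransition x = 0 := by
      rw [mem_Icc, not_and_or, not_le, not_le] at hx
      rcases hx with hx | hx
      · have : Real.smoothTransition =ᶠ[𝓝 x] fun _ => 0 := by
          filter_upwards [Iio_mem_nhds hx] with y hy
          exact Real.smoothTransition.zero_of_nonpos (le_of_lt hy)
        rw [this.deriv_eq]; simp
      · have : Real.smoothTransition =ᶠ[𝓝 x] fun _ => 1 := by
          filter_upwards [Ioi_mem_nhds hx] with y hy
          exact Real.smoothTransition.one_of_one_le (le_of_lt hy)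
        rw [this.deriv_eq]; simp
    rw [this]; simp

/-- The du Bois-Reymond lemma for continuous functions. The test function is an indicator of [s,t]
smoothed at scale δ; its derivative has two layers, of opposite sign and unit mass, near s and t.
After rescaling, the pairing is J(δ), which is continuous up to δ = 0, where it equals F(s) - F(t).
-/
theorem eq_of_forall_integral_deriv_mul_eq_zero {τ T : ℝ} {F : ℝ → ℝ} (hF : Continuous F)
    (h : ∀ η : ℝ → ℝ, ContDiff ℝ ∞ η → HasCompactSupport η → tsupport η ⊆ Ioo τ T →
      ∫ t in τ..T, deriv η t * F t = 0) {s t : ℝ} (hs : s ∈ Ioo τ T) (ht : t ∈ Ioo τ T)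
    (hst : s ≤ t) : F s = F t := by
  set S := Real.smoothTransition with hS
  have hSd : ∀ n : ℕ∞, ContDiff ℝ n S := fun n => Real.smoothTransition.contDiff
  have hS' : Continuous (deriv S) := (hSd 1).continuous_deriv le_rfl
  set J : ℝ → ℝ := fun δ => ∫ y in (0 : ℝ)..1, deriv S y * (F (s + δ * y) - F (t + δ * y)) with hJ
  have hJc : Continuous J := by
    refine intervalIntegral.continuous_parametric_intervalIntegral_of_continuous' ?_ 0 1
    simp only [Function.uncurry_def]
    exact (hS'.comp continuous_snd).mul (by fun_prop)
  have hJ0 : J 0 = F s - F t := by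
    simp only [hJ, zero_mul, add_zero, intervalIntegral.integral_mul_const]
    rw [intervalIntegral.integral_deriv_eq_sub (fun x _ => (hSd 1).differentiable (by simp) x)
      (hS'.intervalIntegrable _ _)]
    simp [hS]
  have hJδ : ∀ δ ∈ Ioo 0 (T - t), J δ = 0 := by
    rintro δ ⟨hδ, hδT⟩
    set η : ℝ → ℝ := fun r => S ((r - s) / δ) - S ((r - t) / δ) with hη
    have hηd : ContDiff ℝ ∞ η := ((hSd ⊤).comp (by fun_prop)).sub ((hSd ⊤).comp (by fun_prop))
    have hsup : Function.support η ⊆ Icc s (t + δ) := by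
      intro r hr
      by_contra hcon
      rw [mem_Icc, not_and_or, not_le, not_le] at hcon
      apply hr
      simp only [hη]
      rcases hcon with hcon | hcon
      · rw [hS, Real.smoothTransition.zero_of_nonpos, Real.smoothTransition.zero_of_nonpos, sub_zero]
        · exact div_nonpos_of_nonpos_of_nonneg (by linarith) hδ.le
        · exact div_nonpos_of_nonpos_of_nonneg (by linarith) hδ.le
      · rw [hS, Real.smoothTransition.one_of_one_le, Real.smoothTransition.one_of_one_le, sub_self]
        · rw [le_div_iff₀ hδ]; linarith
        · rw [le_div_iff₀ hδ]; linarith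
    have hts : tsupport η ⊆ Icc s (t + δ) := closure_minimal hsup isClosed_Icc
    have h0 := h η hηd (HasCompactSupport.of_support_subset_isCompact isCompact_Icc hsup)
      (hts.trans fun r hr => ⟨hs.1.trans_le hr.1, by linarith [hr.2]⟩)
    have hηder : ∀ r, deriv η r = deriv S ((r - s) / δ) / δ - deriv S ((r - t) / δ) / δ := by
      intro r
      have hd : ∀ a : ℝ, HasDerivAt (fun r => S ((r - a) / δ)) (deriv S ((r - a) / δ) / δ) r := by
        intro a
        have h1 : HasDerivAt S (deriv S ((r - a) / δ)) ((r - a) / δ) :=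
          ((hSd 1).differentiable (by simp) _).hasDerivAt
        have h2 : HasDerivAt (fun r => (r - a) / δ) (1 / δ) r :=
          ((hasDerivAt_id r).sub_const a).div_const δ
        have := h1.comp r h2
        rw [mul_one_div] at this
        exact this
      exact ((hd s).sub (hd t)).deriv
    have hpiece : ∀ a, τ ≤ a → a + δ ≤ T →
        ∫ r in τ..T, deriv S ((r - a) / δ) / δ * F r = ∫ y in (0 : ℝ)..1, deriv S y * F (a + δ * y) := by
      intro a ha haT
      have hc : Continuous fun r => deriv S ((r - a) / δ) / δ * F r :=
        ((hS'.comp (by fun_prop)).div_const _).mul hF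
      have hzero : ∀ y, y < 0 ∨ 1 < y → deriv S y = 0 := by
        rintro y (hy | hy)
        · have : S =ᶠ[𝓝 y] fun _ => 0 := by
            filter_upwards [Iio_mem_nhds hy] with z hz
            exact Real.smoothTransition.zero_of_nonpos (le_of_lt hz)
          rw [this.deriv_eq]; simp
        · have : S =ᶠ[𝓝 y] fun _ => 1 := by
            filter_upwards [Ioi_mem_nhds hy] with z hz
            exact Real.smoothTransition.one_of_one_le (le_of_lt hz)
          rw [this.deriv_eq]; simp
      have e1 : ∫ r in τ..a, deriv S ((r - a) / δ) / δ * F r = 0 := by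
        refine intervalIntegral.integral_zero_ae ?_
        filter_upwards [show ∀ᵐ r : ℝ, r ≠ a by simp [ae_iff, measure_singleton]] with r hr hrm
        rw [uIoc_of_le ha] at hrm
        rw [hzero _ (Or.inl (div_neg_of_neg_of_pos (by
          linarith [lt_of_le_of_ne hrm.2 hr]) hδ))]; simp
      have e2 : ∫ r in (a + δ)..T, deriv S ((r - a) / δ) / δ * F r = 0 := by
        refine intervalIntegral.integral_zero_ae ?_
        filter_upwards with r hrm
        rw [uIoc_of_le haT] at hrm
        rw [hzero _ (Or.inr (by rw [lt_div_iff₀ hδ]; linarith [hrm.1]))]; simp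
      rw [← intervalIntegral.integral_add_adjacent_intervals (hc.intervalIntegrable τ a)
        (hc.intervalIntegrable a T), e1, zero_add,
        ← intervalIntegral.integral_add_adjacent_intervals (hc.intervalIntegrable a (a + δ))
        (hc.intervalIntegrable (a + δ) T), e2, add_zero]
      have h3 := intervalIntegral.integral_comp_mul_add
        (fun r => deriv S ((r - a) / δ) / δ * F r) hδ.ne' a (a := 0) (b := 1)
      simp only [mul_zero, zero_add, mul_one, smul_eq_mul] at h3
      rw [add_comm δ a] at h3
      have h4 : ∫ r in a..(a + δ), deriv S ((r - a) / δ) / δ * F r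
          = δ * ∫ x in (0 : ℝ)..1, deriv S ((δ * x + a - a) / δ) / δ * F (δ * x + a) := by
        rw [h3, ← mul_assoc, mul_inv_cancel₀ hδ.ne', one_mul]
      rw [h4, ← intervalIntegral.integral_const_mul]
      refine intervalIntegral.integral_congr fun y _ => ?_
      have : (δ * y + a - a) / δ = y := by field_simp; ring
      simp only [this]
      rw [add_comm (δ * y) a]
      field_simp
    have hc : ∀ a, Continuous fun r => deriv S ((r - a) / δ) / δ * F r := fun a =>
      ((hS'.comp (by fun_prop)).div_const _).mul hF
    simp only [hηder, sub_mul] at h0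
    rw [intervalIntegral.integral_sub ((hc s).intervalIntegrable _ _)
      ((hc t).intervalIntegrable _ _), hpiece s hs.1.le (by linarith), hpiece t ht.1.le
      (by linarith)] at h0
    simp only [hJ, mul_sub]
    rw [intervalIntegral.integral_sub, h0]
    · exact (hS'.mul (by fun_prop)).intervalIntegrable _ _
    · exact (hS'.mul (by fun_prop)).intervalIntegrable _ _
  have hcl : J 0 = 0 := by
    have h1 : Tendsto J (𝓝[>] 0) (𝓝 (J 0)) := hJc.continuousWithinAt
    have h2 : J =ᶠ[𝓝[>] 0] fun _ => 0 := by
      filter_upwards [Ioo_mem_nhdsGT (show (0 : ℝ) < T - t by linarith [ht.2])] with δ hδ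
      exact hJδ δ hδ
    exact tendsto_nhds_unique (h1.congr' h2) tendsto_const_nhds
  linarith [hJ0.symm.trans hcl]

/-- Integration by parts shows that g minus the primitive of G has zero distributional derivative.
It is thus constant in the open interval, and by continuity up to the endpoints. -/
theorem sub_eq_integral_of_distributional {τ T : ℝ} {g G : ℝ → ℝ} (hg : ContinuousOn g (Icc τ T))
    (hG : IntegrableOn G (Icc τ T))
    (h : ∀ η : ℝ → ℝ, ContDiff ℝ ∞ η → HasCompactSupport η → tsupport η ⊆ Ioo τ T →
      ∫ t in Icc τ T, (deriv η t * g t + η t * G t) = 0)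
    {s t : ℝ} (hs : s ∈ Icc τ T) (ht : t ∈ Icc τ T) (hst : s ≤ t) :
    g t - g s = ∫ r in s..t, G r := by
  rcases eq_or_lt_of_le hst with rfl | hst'
  · simp
  have hτT : τ < T := hs.1.trans_lt (hst'.trans_le ht.2)
  have hτ : τ ∈ Icc τ T := ⟨le_rfl, hτT.le⟩
  have hT : T ∈ Icc τ T := ⟨hτT.le, le_rfl⟩
  set A : ℝ → ℝ := fun t => ∫ r in τ..t, G r with hA
  have hGi := intervalIntegrable_of_integrableOn_Icc hG hτ hT
  have hAAC : AbsolutelyContinuousOnInterval A τ T :=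
    hGi.absolutelyContinuousOnInterval_intervalIntegral (by simp)
  have hAc : ContinuousOn A (Icc τ T) := continuousOn_primitive_Icc hG hτT.le
  set F : ℝ → ℝ := fun r => (g - A) (projIcc τ T hτT.le r) with hF
  have hFc : Continuous F := (hg.sub hAc).comp_continuous
    (continuous_subtype_val.comp continuous_projIcc) fun r => (projIcc τ T hτT.le r).2
  have hFe : ∀ r ∈ Icc τ T, F r = g r - A r := fun r hr => by simp [hF, projIcc_of_mem hτT.le hr]
  have key : ∀ η : ℝ → ℝ, ContDiff ℝ ∞ η → HasCompactSupport η → tsupport η ⊆ Ioo τ T →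
      ∫ t in τ..T, deriv η t * F t = 0 := by
    intro η hη hηc hηs
    have h0 := h η hη hηc hηs
    rw [integral_Icc_eq_integral_Ioc, ← intervalIntegral.integral_of_le hτT.le] at h0
    have hη' : Continuous (deriv η) := hη.continuous_deriv (by simp)
    have hz : ∀ r, r ∉ Ioo τ T → η r = 0 := fun r hr => by
      by_contra hne
      exact hr (hηs (subset_tsupport _ hne))
    have hηAC : AbsolutelyContinuousOnInterval η τ T :=
      (hη.of_le (by simp)).contDiffOn.absolutelyContinuousOnInterval
    have hibp := hAAC.integral_mul_deriv_eq_deriv_mul hηAC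
    rw [hz τ (by simp), hz T (by simp)] at hibp
    have hdA : ∫ x in τ..T, deriv A x * η x = ∫ x in τ..T, η x * G x := by
      refine intervalIntegral.integral_congr_ae ?_
      filter_upwards [hGi.ae_hasDerivAt_integral] with x hx hxm
      rw [(hx (uIoc_subset_uIcc hxm) τ (by simp)).deriv, mul_comm]
    rw [hdA] at hibp
    have hgi : IntervalIntegrable (fun r => deriv η r * g r) volume τ T := by
      refine ContinuousOn.intervalIntegrable ?_
      rw [uIcc_of_le hτT.le]; exact hη'.continuousOn.mul hg
    have hAi : IntervalIntegrable (fun r => A r * deriv η r) volume τ T := by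
      refine ContinuousOn.intervalIntegrable ?_
      rw [uIcc_of_le hτT.le]; exact hAc.mul hη'.continuousOn
    rw [intervalIntegral.integral_add hgi (hGi.continuousOn_mul hη.continuous.continuousOn)] at h0
    have : ∫ t in τ..T, deriv η t * F t = ∫ t in τ..T, (deriv η t * g t - A t * deriv η t) := by
      refine intervalIntegral.integral_congr fun r hr => ?_
      rw [uIcc_of_le hτT.le] at hr
      simp only [hFe r hr]; ring
    rw [this, intervalIntegral.integral_sub hgi hAi, hibp]
    linarith
  have hconst : ∀ r ∈ Ioo τ T, ∀ r' ∈ Ioo τ T, F r = F r' := by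
    intro r hr r' hr'
    rcases le_total r r' with hle | hle
    · exact eq_of_forall_integral_deriv_mul_eq_zero hFc key hr hr' hle
    · exact (eq_of_forall_integral_deriv_mul_eq_zero hFc key hr' hr hle).symm
  obtain ⟨r₀, hr₀⟩ : (Ioo τ T).Nonempty := nonempty_Ioo.2 hτT
  have hconst' : ∀ r ∈ Icc τ T, F r = F r₀ := by
    have h1 : EqOn F (fun _ => F r₀) (Ioo τ T) := fun r hr => hconst r hr r₀ hr₀
    have h2 := h1.closure hFc continuous_const
    rwa [closure_Ioo hτT.ne] at h2
  have h1 := (hconst' s hs).trans (hconst' t ht).symm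
  rw [hFe s hs, hFe t ht] at h1
  have h2 : A s + ∫ r in s..t, G r = A t :=
    intervalIntegral.integral_add_adjacent_intervals
      (intervalIntegrable_of_integrableOn_Icc hG hτ hs)
      (intervalIntegrable_of_integrableOn_Icc hG hs ht)
  linarith

/-- The weak formulation only yields measurability of the tested combination. Subtracting η' g and
letting η increase to 1 on the open interval recovers G. -/
theorem aestronglyMeasurable_of_forall_cutoff {τ T : ℝ} {g G : ℝ → ℝ}
    (hg : ContinuousOn g (Icc τ T))
    (h : ∀ η : ℝ → ℝ, ContDiff ℝ ∞ η → HasCompactSupport η → tsupport η ⊆ Ioo τ T →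
      AEStronglyMeasurable (fun t => deriv η t * g t + η t * G t) (volume.restrict (Icc τ T))) :
    AEStronglyMeasurable G (volume.restrict (Icc τ T)) := by
  set S := Real.smoothTransition with hS
  let η : ℕ → ℝ → ℝ := fun n r => S (n * (r - τ) - 1) * S (n * (T - r) - 1)
  have hSd : ∀ n : ℕ∞, ContDiff ℝ n S := fun n => Real.smoothTransition.contDiff
  have hηd : ∀ n, ContDiff ℝ ∞ (η n) := fun n =>
    ((hSd ⊤).comp (by fun_prop)).mul ((hSd ⊤).comp (by fun_prop))
  have hsup : ∀ n, Function.support (η n) ⊆ Icc (τ + 1 / n) (T - 1 / n) := by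
    intro n r hr
    have h1 : S (n * (r - τ) - 1) ≠ 0 := left_ne_zero_of_mul hr
    have h2 : S (n * (T - r) - 1) ≠ 0 := right_ne_zero_of_mul hr
    have h1' : 0 < n * (r - τ) - 1 := by
      by_contra hc; exact h1 (Real.smoothTransition.zero_of_nonpos (not_lt.1 hc))
    have h2' : 0 < n * (T - r) - 1 := by
      by_contra hc; exact h2 (Real.smoothTransition.zero_of_nonpos (not_lt.1 hc))
    have hn : (0 : ℝ) < n := by
      rcases Nat.eq_zero_or_pos n with rfl | hn
      · simp at h1'; linarith
      · exact_mod_cast hn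
    constructor
    · have : 1 / (n : ℝ) ≤ r - τ := by rw [div_le_iff₀ hn]; linarith
      linarith
    · have : 1 / (n : ℝ) ≤ T - r := by rw [div_le_iff₀ hn]; linarith
      linarith
  -- The index n + 1 makes the margin 1/(n + 1) positive, so that the support lies in the open
  -- interval.
  have hm : ∀ n : ℕ, AEStronglyMeasurable
      (fun t => deriv (η (n + 1)) t * g t + η (n + 1) t * G t - deriv (η (n + 1)) t * g t)
      (volume.restrict (Icc τ T)) := by
    intro n
    refine (h (η (n + 1)) (hηd _)
      (HasCompactSupport.of_support_subset_isCompact isCompact_Icc (hsup _)) ?_).sub ?_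
    · refine (closure_minimal (hsup _) isClosed_Icc).trans fun r hr => ?_
      have : (0 : ℝ) < 1 / ((n + 1 : ℕ) : ℝ) := by positivity
      exact ⟨by linarith [hr.1], by linarith [hr.2]⟩
    · exact (((hηd (n + 1)).continuous_deriv (by simp)).continuousOn.mul hg).aestronglyMeasurable
        measurableSet_Icc
  refine aestronglyMeasurable_of_tendsto_ae atTop hm ?_
  have h2 : ∀ᵐ t : ℝ, t ≠ τ := by simp [ae_iff, measure_singleton]
  have h3 : ∀ᵐ t : ℝ, t ≠ T := by simp [ae_iff, measure_singleton]
  filter_upwards [ae_restrict_of_ae h2, ae_restrict_of_ae h3, ae_restrict_mem measurableSet_Icc]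
    with t ht1 ht2 ht
  have hτt : 0 < t - τ := sub_pos.2 (lt_of_le_of_ne ht.1 (Ne.symm ht1))
  have htT : 0 < T - t := sub_pos.2 (lt_of_le_of_ne ht.2 ht2)
  refine tendsto_const_nhds.congr' ?_
  obtain ⟨n1, hn1⟩ := exists_nat_ge (2 / (t - τ))
  obtain ⟨n2, hn2⟩ := exists_nat_ge (2 / (T - t))
  rw [div_le_iff₀ hτt] at hn1
  rw [div_le_iff₀ htT] at hn2
  filter_upwards [eventually_ge_atTop (max n1 n2)] with n hn
  have e1 : (n1 : ℝ) ≤ ((n + 1 : ℕ) : ℝ) := by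
    exact_mod_cast ((le_max_left _ _).trans hn).trans (Nat.le_succ n)
  have e2 : (n2 : ℝ) ≤ ((n + 1 : ℕ) : ℝ) := by
    exact_mod_cast ((le_max_right _ _).trans hn).trans (Nat.le_succ n)
  have : η (n + 1) t = 1 := by
    simp only [η]
    rw [hS, Real.smoothTransition.one_of_one_le, Real.smoothTransition.one_of_one_le, one_mul]
    · nlinarith
    · nlinarith
  rw [this]; ring

end TimeRegularity

/-! ### Test functions of the space variable, slow cutoffs -/

section Eulerian

variable {d : ℕ} {τ T : ℝ} {m : ℝ → ℝ} {l L : ℝ → ℝ → ℝ} {w : ℝ → Pc d → Rd d → Rd d}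
  {μτ : Pc d} {μ : ℝ → Pc d}

theorem continuousOn_integral_lipschitz
    (hμ : ∀ t ∈ Icc τ T, Tendsto (fun s => wasserstein 1 (μ s) (μ t)) (𝓝[Icc τ T] t) (𝓝 0))
    {K : NNReal} {f : Rd d → ℝ} (hf : LipschitzWith K f) :
    ContinuousOn (fun t => ∫ x, f x ∂(μ t).meas) (Icc τ T) := by
  intro t ht
  rw [ContinuousWithinAt, tendsto_iff_norm_sub_tendsto_zero]
  refine squeeze_zero (fun _ => norm_nonneg _)
    (fun s => abs_integral_sub_le_wasserstein hf (μ s) (μ t)) ?_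
  simpa using (hμ t ht).const_mul (K : ℝ)

theorem SolvesCE.exists_moment_bound (hs : SolvesCE T w τ μτ μ) :
    ∃ M ≥ 0, ∀ t ∈ Icc τ T, moment1 (μ t) ≤ M := by
  obtain ⟨M, hM⟩ := isCompact_Icc.exists_bound_of_continuousOn
    (continuousOn_integral_lipschitz hs.continuous (f := fun x : Rd d => ‖x‖)
      lipschitzWith_one_norm)
  refine ⟨max M 0, le_max_right _ _, fun t ht => ?_⟩
  exact ((le_abs_self _).trans (hM t ht)).trans (le_max_left _ _)

theorem exists_lipschitzWith_of_compactSupport {ψ : Rd d → ℝ} (hψ : ContDiff ℝ ∞ ψ)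
    (hψc : HasCompactSupport ψ) : ∃ K, LipschitzWith K ψ :=
  hψ.lipschitzWith_of_hasCompactSupport hψc (by simp)

theorem continuous_fderiv_apply {ψ : Rd d → ℝ} (hψ : ContDiff ℝ ∞ ψ) {f : Rd d → Rd d}
    (hf : Continuous f) : Continuous fun x => fderiv ℝ ψ x (f x) :=
  (hψ.continuous_fderiv (by simp)).clm_apply hf

/-- The weak formulation against test functions of the space variable. -/
theorem SolvesCE.sub_eq_integral (h : LipField τ T m l L w) (hs : SolvesCE T w τ μτ μ)
    {ψ : Rd d → ℝ} (hψ : ContDiff ℝ ∞ ψ) (hψc : HasCompactSupport ψ) :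
    IntegrableOn (fun t => ∫ x, fderiv ℝ ψ x (w t (μ t) x) ∂(μ t).meas) (Icc τ T) ∧
    ∀ s ∈ Icc τ T, ∀ t ∈ Icc τ T, s ≤ t →
      ∫ x, ψ x ∂(μ t).meas - ∫ x, ψ x ∂(μ s).meas =
        ∫ r in s..t, ∫ x, fderiv ℝ ψ x (w r (μ r) x) ∂(μ r).meas := by
  obtain ⟨K, hK⟩ := exists_lipschitzWith_of_compactSupport hψ hψc
  obtain ⟨M, hM0, hM⟩ := hs.exists_moment_bound
  have hg := continuousOn_integral_lipschitz hs.continuous hK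
  set g : ℝ → ℝ := fun t => ∫ x, ψ x ∂(μ t).meas with hgdef
  set G : ℝ → ℝ := fun t => ∫ x, fderiv ℝ ψ x (w t (μ t) x) ∂(μ t).meas with hGdef
  -- Product test functions η(t)ψ(x) reduce the equation to a scalar distributional identity g' = G.
  have heq : ∀ η : ℝ → ℝ, ContDiff ℝ ∞ η → HasCompactSupport η → tsupport η ⊆ Ioo τ T →
      IntegrableOn (fun t => deriv η t * g t + η t * G t) (Icc τ T) ∧
      ∫ t in Icc τ T, (deriv η t * g t + η t * G t) = 0 := by
    intro η hη hηc hηs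
    have hsub : Function.support (fun p : ℝ × Rd d => η p.1 * ψ p.2) ⊆ tsupport η ×ˢ tsupport ψ :=
      fun p hp => ⟨subset_tsupport _ (left_ne_zero_of_mul hp),
        subset_tsupport _ (right_ne_zero_of_mul hp)⟩
    obtain ⟨h1, h2⟩ := hs.equation (fun p => η p.1 * ψ p.2)
      ((hη.comp contDiff_fst).mul (hψ.comp contDiff_snd))
      (HasCompactSupport.of_support_subset_isCompact
        (hηc.isCompact.prod hψc.isCompact) hsub)
      ((closure_minimal hsub ((isClosed_tsupport _).prod (isClosed_tsupport _))).trans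
        (prod_mono hηs (subset_univ _)))
    have hae : (fun t => ∫ x, (deriv (fun s => η s * ψ x) t +
        inner ℝ (gradient (fun y => η t * ψ y) x) (w t (μ t) x)) ∂(μ t).meas)
        =ᵐ[volume.restrict (Icc τ T)] fun t => deriv η t * g t + η t * G t := by
      filter_upwards [h.continuous_space] with t ht
      have e1 : ∀ x, deriv (fun s => η s * ψ x) t = deriv η t * ψ x := fun x =>
        deriv_mul_const ((hη.differentiable (by simp)) t) _
      have e2 : ∀ x, inner ℝ (gradient (fun y => η t * ψ y) x) (w t (μ t) x) =
          η t * fderiv ℝ ψ x (w t (μ t) x) := by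
        intro x
        rw [inner_gradient_left, fderiv_const_mul ((hψ.differentiable (by simp)) x)]
        rfl
      simp only [e1, e2]
      rw [integral_add, integral_const_mul, integral_const_mul]
      · exact ((μ t).integrable_of_continuous hψ.continuous).const_mul _
      · exact ((μ t).integrable_of_continuous (continuous_fderiv_apply hψ (ht _))).const_mul _
    exact ⟨h1.congr hae, by rw [← integral_congr_ae hae]; exact h2⟩
  have hGm : AEStronglyMeasurable G (volume.restrict (Icc τ T)) :=
    aestronglyMeasurable_of_forall_cutoff hg fun η h1 h2 h3 => (heq η h1 h2 h3).1.1
  obtain ⟨R, hR⟩ : ∃ R, ∀ x ∈ tsupport ψ, ‖x‖ ≤ R :=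
    hψc.isCompact.isBounded.exists_norm_le
  have hGb : ∀ᵐ t ∂volume.restrict (Icc τ T), ‖G t‖ ≤ m t * (K * (1 + max R 0 + M)) := by
    filter_upwards [h.growth, ae_restrict_mem measurableSet_Icc] with t ht htm
    have hm := h.growth_nonneg t htm
    have : ∀ x, ‖fderiv ℝ ψ x (w t (μ t) x)‖ ≤ m t * (K * (1 + max R 0 + M)) := by
      intro x
      by_cases hx : x ∈ tsupport ψ
      · calc ‖fderiv ℝ ψ x (w t (μ t) x)‖ ≤ ‖fderiv ℝ ψ x‖ * ‖w t (μ t) x‖ :=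
              ContinuousLinearMap.le_opNorm _ _
          _ ≤ K * (m t * (1 + max R 0 + M)) := by
              gcongr
              · exact norm_fderiv_le_of_lipschitz ℝ hK
              · refine (ht _ _).trans ?_
                gcongr
                · exact (hR x hx).trans (le_max_left _ _)
                · exact hM t htm
          _ = _ := by ring
      · have : fderiv ℝ ψ x = 0 := by
          by_contra hne
          exact hx (support_fderiv_subset ℝ hne)
        rw [this]
        simp only [zero_apply, norm_zero]
        have : (0 : ℝ) ≤ max R 0 := le_max_right _ _
        positivity
    calc ‖G t‖ ≤ ∫ _, m t * (K * (1 + max R 0 + M)) ∂(μ t).meas :=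
          norm_integral_le_of_norm_le (integrable_const _) (Eventually.of_forall this)
      _ = _ := by simp
  have hGi : IntegrableOn G (Icc τ T) :=
    Integrable.mono' (h.growth_integrable.mul_const _) hGm hGb
  exact ⟨hGi, fun s hs' t ht hst =>
    sub_eq_integral_of_distributional hg hGi (fun η h1 h2 h3 => (heq η h1 h2 h3).2) hs' ht hst⟩

/-- A smooth function that vanishes on a given ball, is `1` far away and has a small logarithmic
slope. -/
theorem exists_slow_cutoff (d : ℕ) (r : ℝ) {ε : ℝ} (hε : 0 < ε) :
    ∃ (R : ℝ) (h : Rd d → ℝ), ContDiff ℝ ∞ h ∧ (∀ x, ‖x‖ ≤ r → h x = 0) ∧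
      (∀ x, R ≤ ‖x‖ → h x = 1) ∧ ∀ x y, |fderiv ℝ h x y| * (1 + ‖x‖) ≤ ε * ‖y‖ := by
  obtain ⟨c, hc, hcb⟩ := exists_bound_deriv_smoothTransition
  -- The function log(1 + |x|²)/Θ has gradient of norm 2|x|/(Θ(1 + |x|²)), and 2|x|(1 + |x|) ≤ 3(1 +
  -- |x|²); the factor c bounds the slope of the smooth step.
  set Θ : ℝ := 3 * c / ε with hΘ
  have hΘ0 : 0 < Θ := by positivity
  let q : Rd d → ℝ := fun x => (Real.log (1 + ‖x‖ ^ 2) - Real.log (1 + r ^ 2)) / Θ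
  have hpos : ∀ x : Rd d, 0 < 1 + ‖x‖ ^ 2 := fun x => by positivity
  have hn : ContDiff ℝ ∞ fun x : Rd d => 1 + ‖x‖ ^ 2 := contDiff_const.add (contDiff_norm_sq ℝ)
  have hq : ContDiff ℝ ∞ q :=
    ((hn.log fun x => (hpos x).ne').sub contDiff_const).div_const Θ
  have hS : ContDiff ℝ ∞ Real.smoothTransition := Real.smoothTransition.contDiff (n := ⊤)
  have key : ∀ x y, |fderiv ℝ (fun x => Real.smoothTransition (q x)) x y| * (1 + ‖x‖) ≤ ε * ‖y‖ := by
    intro x y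
    have h1 : HasFDerivAt (fun x : Rd d => 1 + ‖x‖ ^ 2) ((2 : ℕ) • (innerSL ℝ x : Rd d →L[ℝ] ℝ)) x :=
      (hasStrictFDerivAt_norm_sq x).hasFDerivAt.const_add 1
    have h2 := ((h1.log (hpos x).ne').sub_const (Real.log (1 + r ^ 2))).mul_const Θ⁻¹
    have hqe : q = fun x => (Real.log (1 + ‖x‖ ^ 2) - Real.log (1 + r ^ 2)) * Θ⁻¹ := by
      simp only [q, div_eq_mul_inv]
    rw [← hqe] at h2
    have h4 := ((hS.differentiable (by simp)) (q x)).hasDerivAt.comp_hasFDerivAt x h2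
    have h5 := h4.fderiv
    simp only [Function.comp_def] at h5
    rw [h5]
    simp only [_root_.smul_apply, smul_eq_mul, innerSL_apply_apply, nsmul_eq_mul]
    have h6 : |inner ℝ x y| ≤ ‖x‖ * ‖y‖ := abs_real_inner_le_norm x y
    have h7 : |deriv Real.smoothTransition (q x)| ≤ c := hcb _
    rw [abs_mul, abs_mul, abs_mul, abs_mul, abs_inv, abs_inv, abs_of_pos hΘ0, abs_of_pos (hpos x)]
    have h8 : ‖x‖ * (1 + ‖x‖) ≤ 3 / 2 * (1 + ‖x‖ ^ 2) := by nlinarith [sq_nonneg (‖x‖ - 1)]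
    have h9 : (1 + ‖x‖ ^ 2)⁻¹ * (‖x‖ * (1 + ‖x‖)) ≤ 3 / 2 := by
      rw [inv_mul_le_iff₀ (hpos x)]; linarith
    have h10 : |((2 : ℕ) : ℝ)| = 2 := by norm_num
    rw [h10]
    calc |deriv Real.smoothTransition (q x)| * (Θ⁻¹ * ((1 + ‖x‖ ^ 2)⁻¹ * (2 * |inner ℝ x y|))) * (1 + ‖x‖)
        ≤ c * (Θ⁻¹ * ((1 + ‖x‖ ^ 2)⁻¹ * (2 * (‖x‖ * ‖y‖)))) * (1 + ‖x‖) := by gcongr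
      _ = 2 * c * Θ⁻¹ * ‖y‖ * ((1 + ‖x‖ ^ 2)⁻¹ * (‖x‖ * (1 + ‖x‖))) := by ring
      _ ≤ 2 * c * Θ⁻¹ * ‖y‖ * (3 / 2) := by gcongr
      _ = ε * ‖y‖ := by rw [hΘ]; field_simp
  -- The radius is such that |x|² ≥ exp(Θ + log(1 + r²)), which forces q(x) ≥ 1.
  refine ⟨Real.sqrt (Real.exp (Θ + Real.log (1 + r ^ 2))), fun x => Real.smoothTransition (q x),
    hS.comp hq, fun x hx => ?_, fun x hx => ?_,
    key⟩
  · apply Real.smoothTransition.zero_of_nonpos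
    refine div_nonpos_of_nonpos_of_nonneg ?_ hΘ0.le
    rw [sub_nonpos]
    apply Real.log_le_log (hpos x)
    have := norm_nonneg x
    gcongr
  · apply Real.smoothTransition.one_of_one_le
    rw [one_le_div hΘ0, le_sub_iff_add_le, Real.le_log_iff_exp_le (hpos x)]
    have := (Real.sqrt_le_left (norm_nonneg x)).1 hx
    linarith

end Eulerian

/-! ### Solutions live on a common ball -/

section Support

variable {d : ℕ} {τ T : ℝ} {m : ℝ → ℝ} {l L : ℝ → ℝ → ℝ} {w : ℝ → Pc d → Rd d → Rd d}
  {μτ : Pc d} {μ : ℝ → Pc d}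

/-- The exponential moments of a bounded test function with a small logarithmic slope. -/
theorem SolvesCE.integral_exp_le (hF : LipField τ T m l L w) (hs : SolvesCE T w τ μτ μ)
    {M : ℝ} (hM0 : 0 ≤ M) (hM : ∀ t ∈ Icc τ T, moment1 (μ t) ≤ M) {ε r R : ℝ} (hε : 0 ≤ ε)
    {h : Rd d → ℝ} (hh : ContDiff ℝ ∞ h) (hr : ∀ x, ‖x‖ ≤ r → h x = 0)
    (hR : ∀ x, R ≤ ‖x‖ → h x = 1)
    (hslope : ∀ x y, |fderiv ℝ h x y| * (1 + ‖x‖) ≤ ε * ‖y‖)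
    (hμτ : μτ.LivesOn (ball0 d r)) (k : ℕ) :
    ∀ t ∈ Icc τ T, ∫ x, Real.exp (k * h x) ∂(μ t).meas ≤
      2 * Real.exp (2 * k * (ε * (1 + M)) * ∫ s in τ..T, m s) := by
  intro t ht
  have hτ : τ ∈ Icc τ T := ⟨le_rfl, ht.1.trans ht.2⟩
  have hT : T ∈ Icc τ T := ⟨ht.1.trans ht.2, le_rfl⟩
  set f : Rd d → ℝ := fun x => Real.exp (k * h x) with hf
  have hfd : ContDiff ℝ ∞ f := (contDiff_const.mul hh).exp
  -- Beyond the radius R the function f equals exp(k); subtracting this constant makes the support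
  -- compact and shifts every integral against a probability measure by the same amount.
  set ψ : Rd d → ℝ := fun x => f x - Real.exp k with hψ
  have hψd : ContDiff ℝ ∞ ψ := hfd.sub contDiff_const
  have hψc : HasCompactSupport ψ := by
    refine HasCompactSupport.of_support_subset_isCompact (isCompact_closedBall (0 : Rd d) R) ?_
    intro x hx
    by_contra hcon
    rw [mem_closedBall_zero_iff, not_le] at hcon
    exact hx (by simp [hψ, hf, hR x hcon.le])
  have hint : ∀ ν : Pc d, ∫ x, ψ x ∂ν.meas = ∫ x, f x ∂ν.meas - Real.exp k := by
    intro ν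
    rw [integral_sub (ν.integrable_of_continuous hfd.continuous) (integrable_const _)]
    simp
  obtain ⟨h1, h2⟩ := hs.sub_eq_integral hF hψd hψc
  set E : ℝ → ℝ := fun t => ∫ x, f x ∂(μ t).meas with hE
  have hE0 : E τ = 1 := by
    simp only [hE, hs.initial]
    rw [Pc.livesOn_iff] at hμτ
    have : ∫ x, f x ∂μτ.meas = ∫ _, (1 : ℝ) ∂μτ.meas := by
      refine integral_congr_ae ?_
      filter_upwards [hμτ] with x hx
      simp [hf, hr x hx]
    rw [this]; simp
  have hEc : ContinuousOn E (Icc τ T) := by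
    obtain ⟨K, hK⟩ := exists_lipschitzWith_of_compactSupport hψd hψc
    have := (continuousOn_integral_lipschitz hs.continuous hK).add
      (continuousOn_const (c := Real.exp k))
    refine this.congr fun t _ => ?_
    simp only [hint, hE, Pi.add_apply]; ring
  have hb : ∀ᵐ s ∂volume.restrict (Icc τ T),
      ‖∫ x, fderiv ℝ ψ x (w s (μ s) x) ∂(μ s).meas‖ ≤ (k * (ε * (1 + M)) * m s) * E s := by
    filter_upwards [hF.growth, ae_restrict_mem measurableSet_Icc] with s hsg hsm
    have hm := hF.growth_nonneg s hsm
    have hMs := hM s hsm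
    have hpt : ∀ x, ‖fderiv ℝ ψ x (w s (μ s) x)‖ ≤ (k * (ε * (1 + M)) * m s) * f x := by
      intro x
      have hd : HasFDerivAt ψ (Real.exp (k * h x) • ((k : ℝ) • fderiv ℝ h x)) x :=
        ((((hh.differentiable (by simp)) x).hasFDerivAt.const_mul (k : ℝ)).exp).sub_const _
      rw [hd.fderiv]
      simp only [_root_.smul_apply, smul_eq_mul, norm_mul, Real.norm_eq_abs, Real.abs_exp,
        Nat.abs_cast]
      -- The logarithmic slope of h exactly offsets the linear growth of the field, so the
      -- derivative along the field is bounded uniformly in x.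
      have h3 : |fderiv ℝ h x (w s (μ s) x)| ≤ ε * (1 + M) * m s := by
        have h4 := hslope x (w s (μ s) x)
        have h5 : ‖w s (μ s) x‖ ≤ m s * (1 + M) * (1 + ‖x‖) := by
          refine (hsg _ _).trans ?_
          rw [mul_assoc]
          gcongr
          nlinarith [norm_nonneg x]
        have h6 : |fderiv ℝ h x (w s (μ s) x)| * (1 + ‖x‖) ≤ ε * (1 + M) * m s * (1 + ‖x‖) := by
          refine h4.trans ?_
          calc ε * ‖w s (μ s) x‖ ≤ ε * (m s * (1 + M) * (1 + ‖x‖)) := by gcongr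
            _ = _ := by ring
        exact le_of_mul_le_mul_right h6 (by positivity)
      calc Real.exp (k * h x) * (k * |fderiv ℝ h x (w s (μ s) x)|)
          ≤ Real.exp (k * h x) * (k * (ε * (1 + M) * m s)) := by gcongr
        _ = _ := by simp only [hf]; ring
    refine (norm_integral_le_of_norm_le
      (((μ s).integrable_of_continuous hfd.continuous).const_mul _)
      (Eventually.of_forall hpt)).trans (le_of_eq ?_)
    rw [integral_const_mul]
  have hl : IntegrableOn (fun s => k * (ε * (1 + M)) * m s) (Icc τ T) :=
    hF.growth_integrable.const_mul _
  have hgr := gronwall_integrable (c := 1) hl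
    (fun s hs' => by have := hF.growth_nonneg s hs'; positivity) hEc zero_le_one
    (fun s hs' => by
      have h3 := h2 τ hτ s hs' hs'.1
      rw [hint, hint] at h3
      have h4 := norm_integral_le_of_ae_restrict
        (IntegrableOn.mul_continuousOn hl hEc isCompact_Icc) hb hτ hs' hs'.1
      rw [← h3] at h4
      have h5 := (le_abs_self _).trans h4
      have h6 : E s - E τ ≤ ∫ r in τ..s, (k * (ε * (1 + M)) * m r) * E r := by
        simp only [hE]; linarith
      rw [hE0] at h6
      linarith) t ht
  refine hgr.trans ?_
  rw [mul_one, intervalIntegral.integral_const_mul]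
  have hmono := primitive_mono hF.growth_integrable hF.growth_nonneg ht hT ht.2
  gcongr 2 * Real.exp ?_
  calc 2 * (k * (ε * (1 + M)) * ∫ s in τ..t, m s) ≤ 2 * (k * (ε * (1 + M)) * ∫ s in τ..T, m s) := by
        gcongr
    _ = _ := by ring

/-- Each measure of the curve has compact support, but no common radius is given. For a slow enough
cutoff the moment ∫ exp(kh) stays below 2 exp(k/2), whereas mass beyond the outer radius contributes
with weight exp(k). Letting k tend to infinity shows that this mass is zero. -/
theorem SolvesCE.exists_boundedCurve (hF : LipField τ T m l L w) (hτT : τ ≤ T)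
    (hs : SolvesCE T w τ μτ μ) : ∃ R > 0, BoundedCurve τ T R μ := by
  obtain ⟨r, hr0, hr⟩ := μτ.exists_livesOn
  obtain ⟨M, hM0, hM⟩ := hs.exists_moment_bound
  have hI : 0 ≤ ∫ s in τ..T, m s := primitive_nonneg hF.growth_nonneg ⟨hτT, le_rfl⟩
  -- With this ε the exponent 2kε(1 + M)∫m of the moment estimate is at most k/2.
  set ε : ℝ := 1 / (4 * (1 + M) * (1 + ∫ s in τ..T, m s)) with hε
  have hε0 : 0 < ε := by positivity
  obtain ⟨R, h, hh, hhr, hhR, hslope⟩ := exists_slow_cutoff d r hε0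
  refine ⟨max R 1, by positivity, fun t ht => ?_, hs.continuous⟩
  have hexp : ∀ k : ℕ, (μ t).meas.real {x | max R 1 < ‖x‖} ≤ 2 * Real.exp (-(1 / 2)) ^ k := by
    intro k
    have h1 := hs.integral_exp_le hF hM0 hM hε0.le hh hhr hhR hslope hr k t ht
    have h2 : 2 * k * (ε * (1 + M)) * ∫ s in τ..T, m s ≤ k / 2 := by
      rw [hε]
      have : 2 * (k : ℝ) * (1 / (4 * (1 + M) * (1 + ∫ s in τ..T, m s)) * (1 + M)) *
          ∫ s in τ..T, m s = k / 2 * ((∫ s in τ..T, m s) / (1 + ∫ s in τ..T, m s)) := by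
        field_simp; ring
      rw [this]
      have : (∫ s in τ..T, m s) / (1 + ∫ s in τ..T, m s) ≤ 1 := by
        rw [div_le_one (by positivity)]; linarith
      calc (k : ℝ) / 2 * _ ≤ k / 2 * 1 := by gcongr
        _ = _ := mul_one _
    have h3 : Real.exp k * (μ t).meas.real {x | max R 1 < ‖x‖} ≤
        ∫ x, Real.exp (k * h x) ∂(μ t).meas := by
      have hms : MeasurableSet {x : Rd d | max R 1 < ‖x‖} :=
        measurableSet_lt measurable_const measurable_norm
      have hi : Integrable (fun x => Real.exp (k * h x)) (μ t).meas :=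
        (μ t).integrable_of_continuous (contDiff_const.mul hh).exp.continuous
      calc Real.exp k * (μ t).meas.real {x | max R 1 < ‖x‖}
          = ∫ x in {x | max R 1 < ‖x‖}, Real.exp k ∂(μ t).meas := by
            rw [setIntegral_const, smul_eq_mul, mul_comm]
        _ = ∫ x in {x | max R 1 < ‖x‖}, Real.exp (k * h x) ∂(μ t).meas := by
            refine setIntegral_congr_fun hms fun x hx => ?_
            have : R ≤ ‖x‖ := (le_max_left _ _).trans (le_of_lt hx)
            simp [hhR x this]
        _ ≤ _ := setIntegral_le_integral hi (Eventually.of_forall fun x => (Real.exp_pos _).le)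
    have h4 : Real.exp k * (μ t).meas.real {x | max R 1 < ‖x‖} ≤ 2 * Real.exp (k / 2) :=
      h3.trans (h1.trans (by gcongr))
    rw [← Real.exp_nat_mul]
    have h5 : Real.exp (k * -(1 / 2)) = Real.exp (k / 2) / Real.exp k := by
      rw [← Real.exp_sub]; congr 1; ring
    rw [h5, ← mul_div_assoc, le_div_iff₀ (Real.exp_pos _)]
    linarith
  have hlim : Tendsto (fun k : ℕ => 2 * Real.exp (-(1 / 2)) ^ k) atTop (𝓝 (2 * 0)) :=
    (tendsto_pow_atTop_nhds_zero_of_lt_one (Real.exp_pos _).le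
      (by rw [← Real.exp_zero]; exact Real.exp_lt_exp.2 (by norm_num))).const_mul 2
  have h0 : (μ t).meas.real {x | max R 1 < ‖x‖} ≤ 2 * 0 := ge_of_tendsto' hlim hexp
  rw [mul_zero] at h0
  have h00 : (μ t).meas.real {x | max R 1 < ‖x‖} = 0 := le_antisymm h0 measureReal_nonneg
  rw [measureReal_eq_zero_iff] at h00
  rw [Pc.LivesOn]
  convert h00 using 2
  ext x
  rw [mem_compl_iff, mem_closedBall_zero_iff, not_le, mem_ofPred_eq]

/-- The weak formulation for smooth test functions without compact support. -/
theorem SolvesCE.sub_eq_integral_of_boundedCurve (h : LipField τ T m l L w)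
    (hs : SolvesCE T w τ μτ μ) {R : ℝ} (hμ : BoundedCurve τ T R μ) {ψ : Rd d → ℝ}
    (hψ : ContDiff ℝ ∞ ψ) :
    IntegrableOn (fun t => ∫ x, fderiv ℝ ψ x (w t (μ t) x) ∂(μ t).meas) (Icc τ T) ∧
    ∀ s ∈ Icc τ T, ∀ t ∈ Icc τ T, s ≤ t →
      ∫ x, ψ x ∂(μ t).meas - ∫ x, ψ x ∂(μ s).meas =
        ∫ r in s..t, ∫ x, fderiv ℝ ψ x (w r (μ r) x) ∂(μ r).meas := by
  -- The bump is 1 on a neighbourhood of the ball that carries all the measures, so neither ψ nor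
  -- its derivative changes there.
  set b : ContDiffBump (0 : Rd d) := ⟨max R 0 + 1, max R 0 + 2, by positivity, by linarith⟩
  set f : Rd d → ℝ := fun x => b x * ψ x with hf
  have hfd : ContDiff ℝ ∞ f := b.contDiff.mul hψ
  have hfc : HasCompactSupport f := b.hasCompactSupport.mul_right
  have hev : ∀ x : Rd d, ‖x‖ ≤ R → f =ᶠ[𝓝 x] ψ := by
    intro x hx
    have : Metric.closedBall (0 : Rd d) (max R 0 + 1) ∈ 𝓝 x := by
      refine Metric.closedBall_mem_nhds_of_mem ?_
      rw [mem_ball_zero_iff]; linarith [le_max_left R 0]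
    filter_upwards [this] with y hy
    simp [hf, b.one_of_mem_closedBall hy]
  have e1 : ∀ t ∈ Icc τ T, ∫ x, f x ∂(μ t).meas = ∫ x, ψ x ∂(μ t).meas := by
    intro t ht
    refine integral_congr_ae ?_
    filter_upwards [Pc.livesOn_iff.1 (hμ.livesOn t ht)] with x hx using (hev x hx).eq_of_nhds
  have e2 : ∀ t ∈ Icc τ T, ∫ x, fderiv ℝ f x (w t (μ t) x) ∂(μ t).meas =
      ∫ x, fderiv ℝ ψ x (w t (μ t) x) ∂(μ t).meas := by
    intro t ht
    refine integral_congr_ae ?_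
    filter_upwards [Pc.livesOn_iff.1 (hμ.livesOn t ht)] with x hx
    rw [(hev x hx).fderiv_eq]
  obtain ⟨h1, h2⟩ := hs.sub_eq_integral h hfd hfc
  refine ⟨h1.congr_fun e2 measurableSet_Icc, fun s hs' t ht hst => ?_⟩
  rw [← e1 s hs', ← e1 t ht, h2 s hs' t ht hst]
  refine intervalIntegral.integral_congr fun r hr => ?_
  rw [uIcc_of_le hst] at hr
  exact e2 r ⟨hs'.1.trans hr.1, hr.2.trans ht.2⟩

end Support

/-! ### Smooth approximation of Lipschitz fields -/

section Mollification

open scoped Convolution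

variable {d : ℕ}

/-- Convolution with a bump of radius δ. The constant C is the L¹ norm of the derivative of the
kernel, so it depends on δ but not on f. -/
theorem exists_mollification (F : Type*) [NormedAddCommGroup F] [NormedSpace ℝ F] [CompleteSpace F]
    {δ : ℝ} (hδ : 0 < δ) : ∃ C ≥ 0, ∀ (K : NNReal) (f : Rd d → F), LipschitzWith K f →
      ∃ V : Rd d → F, ContDiff ℝ ∞ V ∧ (∀ x, ‖V x - f x‖ ≤ δ * K) ∧ (∀ x, ‖fderiv ℝ V x‖ ≤ K) ∧
        ∀ x y, ‖fderiv ℝ V x - fderiv ℝ V y‖ ≤ C * K * ‖x - y‖ := by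
  set b : ContDiffBump (0 : Rd d) := ⟨δ / 2, δ, by positivity, by linarith⟩
  set ρ : Rd d → ℝ := b.normed volume with hρ
  have hρd : ContDiff ℝ ∞ ρ := b.contDiff_normed
  have hρc : HasCompactSupport ρ := b.hasCompactSupport_normed
  have hρ' : Continuous (fderiv ℝ ρ) := hρd.continuous_fderiv (by simp)
  have hρi : Integrable (fun t => ‖fderiv ℝ ρ t‖) (volume : Measure (Rd d)) :=
    (hρ'.integrable_of_hasCompactSupport (hρc.fderiv (𝕜 := ℝ))).norm
  refine ⟨∫ t, ‖fderiv ℝ ρ t‖, integral_nonneg fun _ => norm_nonneg _, fun K f hf => ?_⟩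
  have hfl : LocallyIntegrable f (volume : Measure (Rd d)) := hf.continuous.locallyIntegrable
  set lm := ContinuousLinearMap.lsmul ℝ ℝ (E := F) with hlm
  set V : Rd d → F := ρ ⋆[lm, volume] f with hV
  have hVd : ContDiff ℝ ∞ V := hρc.contDiff_convolution_left lm hρd hfl
  have hex : ∀ x, ConvolutionExistsAt ρ f x lm volume :=
    hρc.convolutionExists_left lm hρd.continuous hfl
  have hVlip : LipschitzWith K V := by
    refine LipschitzWith.of_dist_le_mul fun x y => ?_
    rw [dist_eq_norm]
    change ‖(∫ t, lm (ρ t) (f (x - t))) - ∫ t, lm (ρ t) (f (y - t))‖ ≤ _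
    rw [← integral_sub (hex x) (hex y)]
    have h1 : ∀ t, ‖lm (ρ t) (f (x - t)) - lm (ρ t) (f (y - t))‖ ≤ ρ t * (K * dist x y) := by
      intro t
      rw [← map_sub]
      simp only [hlm, ContinuousLinearMap.lsmul_apply, norm_smul]
      rw [Real.norm_of_nonneg (b.nonneg_normed t)]
      gcongr
      · exact b.nonneg_normed t
      · rw [← dist_eq_norm]
        refine (hf.dist_le_mul _ _).trans (le_of_eq ?_)
        rw [dist_sub_right]
    refine (norm_integral_le_of_norm_le (b.integrable_normed.mul_const _)
      (Eventually.of_forall h1)).trans (le_of_eq ?_)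
    rw [integral_mul_const, b.integral_normed, one_mul]
  refine ⟨V, hVd, fun x => ?_, fun x => norm_fderiv_le_of_lipschitz ℝ hVlip, fun x y => ?_⟩
  · rw [← dist_eq_norm]
    refine b.dist_normed_convolution_le hf.continuous.aestronglyMeasurable fun y hy => ?_
    refine (hf.dist_le_mul _ _).trans ?_
    rw [mul_comm]
    gcongr
    exact (Metric.mem_ball.1 hy).le
  · have hfd : ∀ x, fderiv ℝ V x = (fderiv ℝ ρ ⋆[lm.precompL (Rd d), volume] f) x := fun x =>
      (hρc.hasFDerivAt_convolution_left lm (hρd.of_le (by simp)) hfl x).fderiv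
    have hex' : ∀ x, ConvolutionExistsAt (fderiv ℝ ρ) f x (lm.precompL (Rd d)) volume :=
      (hρc.fderiv (𝕜 := ℝ)).convolutionExists_left _ hρ' hfl
    rw [hfd, hfd]
    change ‖(∫ t, lm.precompL (Rd d) (fderiv ℝ ρ t) (f (x - t))) -
      ∫ t, lm.precompL (Rd d) (fderiv ℝ ρ t) (f (y - t))‖ ≤ _
    rw [← integral_sub (hex' x) (hex' y)]
    have h1 : ∀ t, ‖lm.precompL (Rd d) (fderiv ℝ ρ t) (f (x - t)) -
        lm.precompL (Rd d) (fderiv ℝ ρ t) (f (y - t))‖ ≤ ‖fderiv ℝ ρ t‖ * (K * ‖x - y‖) := by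
      intro t
      rw [← map_sub]
      have h2 : ∀ (A : Rd d →L[ℝ] ℝ) (u : F), ‖lm.precompL (Rd d) A u‖ ≤ ‖A‖ * ‖u‖ := by
        intro A u
        refine ContinuousLinearMap.opNorm_le_bound _ (by positivity) fun z => ?_
        rw [ContinuousLinearMap.precompL_apply, hlm, ContinuousLinearMap.lsmul_apply, norm_smul]
        calc ‖A z‖ * ‖u‖ ≤ (‖A‖ * ‖z‖) * ‖u‖ := by gcongr; exact A.le_opNorm z
          _ = _ := by ring
      have h3 : ‖f (x - t) - f (y - t)‖ ≤ K * ‖x - y‖ := by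
        rw [← dist_eq_norm]
        refine (hf.dist_le_mul _ _).trans (le_of_eq ?_)
        rw [dist_sub_right, dist_eq_norm]
      exact (h2 _ _).trans (by gcongr)
    refine (norm_integral_le_of_norm_le (hρi.mul_const _)
      (Eventually.of_forall h1)).trans (le_of_eq ?_)
    rw [integral_mul_const]; ring

/-- Lipschitz extension to the whole space costs the factor c, and mollification at scale δ/c
follows. The order of the constants is essential: c does not depend on δ, and C depends on neither κ
nor W. Derivative bounds can then be propagated through arbitrarily many small steps. -/
theorem exists_smooth_extension (d : ℕ) (R : ℝ) : ∃ c > 0, ∀ δ > 0, ∃ C ≥ 0, ∀ κ ≥ 0,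
    ∀ W : C(BallSpace d R, Rd d), (∀ x y, ‖W x - W y‖ ≤ κ * ‖(x : Rd d) - y‖) →
      ∃ V : Rd d → Rd d, ContDiff ℝ ∞ V ∧ (∀ x : BallSpace d R, ‖V x - W x‖ ≤ δ * κ) ∧
        (∀ x, ‖fderiv ℝ V x‖ ≤ c * κ) ∧
        ∀ x y, ‖fderiv ℝ V x - fderiv ℝ V y‖ ≤ C * κ * ‖x - y‖ := by
  set c : NNReal := lipschitzExtensionConstant (Rd d) with hc
  have hc0 : (0 : ℝ) < c := lipschitzExtensionConstant_pos _
  refine ⟨c, hc0, fun δ hδ => ?_⟩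
  obtain ⟨C, hC, hmol⟩ := exists_mollification (d := d) (Rd d) (show 0 < δ / c by positivity)
  refine ⟨C * c, by positivity, fun κ hκ W hW => ?_⟩
  set f : Rd d → Rd d := Function.extend Subtype.val W 0 with hf
  have hfW : ∀ x : BallSpace d R, f x = W x := fun x => Subtype.val_injective.extend_apply _ _ x
  have hfl : LipschitzOnWith κ.toNNReal f (Metric.closedBall 0 R) := by
    refine LipschitzOnWith.of_dist_le_mul fun x hx y hy => ?_
    have := hW ⟨x, hx⟩ ⟨y, hy⟩
    rw [← hfW, ← hfW] at this
    rw [dist_eq_norm, dist_eq_norm, Real.coe_toNNReal _ hκ]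
    exact this
  obtain ⟨g, hg, hfg⟩ := hfl.extend_finite_dimension
  obtain ⟨V, hV, h1, h2, h3⟩ := hmol _ g hg
  simp only [NNReal.coe_mul, Real.coe_toNNReal _ hκ] at h1 h2 h3
  refine ⟨V, hV, fun x => ?_, h2, fun x y => (h3 x y).trans (le_of_eq ?_)⟩
  · rw [← hfW, hfg x.2]
    refine (h1 x).trans (le_of_eq ?_)
    rw [← mul_assoc, div_mul_cancel₀ _ hc0.ne']
  · rw [← hc]; ring

end Mollification

/-! ### The linear continuity equation on a ball: one dual step -/

section LinearUniqueness

variable {d : ℕ} {R τ T : ℝ}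

/-- A time-dependent velocity field on a ball, with an integrable bound on its Lipschitz norm. -/
structure BallField (τ T : ℝ) (k : ℝ → ℝ) (W : ℝ → C(BallSpace d R, Rd d)) : Prop where
  bound_integrable : IntegrableOn k (Icc τ T)
  bound_nonneg : ∀ t ∈ Icc τ T, 0 ≤ k t
  integrable : IntegrableOn W (Icc τ T)
  norm_le : ∀ᵐ t ∂volume.restrict (Icc τ T), ‖W t‖ ≤ k t
  lipschitz : ∀ᵐ t ∂volume.restrict (Icc τ T), ∀ x y, ‖W t x - W t y‖ ≤ k t * ‖(x : Rd d) - y‖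

/-- Weak solutions of the linear continuity equation on a ball. -/
structure WeaklyTransported (τ T : ℝ) (W : ℝ → C(BallSpace d R, Rd d))
    (Q : ℝ → Measure (BallSpace d R)) : Prop where
  prob : ∀ t ∈ Icc τ T, IsProbabilityMeasure (Q t)
  integrable : ∀ ψ : Rd d → ℝ, ContDiff ℝ ∞ ψ →
    IntegrableOn (fun t => ∫ x, fderiv ℝ ψ x (W t x) ∂Q t) (Icc τ T)
  equation : ∀ ψ : Rd d → ℝ, ContDiff ℝ ∞ ψ → ∀ s ∈ Icc τ T, ∀ t ∈ Icc τ T, s ≤ t →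
    ∫ x, ψ x ∂Q t - ∫ x, ψ x ∂Q s = ∫ r in s..t, ∫ x, fderiv ℝ ψ x (W r x) ∂Q r

variable {k : ℝ → ℝ} {W : ℝ → C(BallSpace d R, Rd d)} {Q : ℝ → Measure (BallSpace d R)}

theorem abs_integral_le_of_forall {Ω : Type*} [MeasurableSpace Ω] {P : Measure Ω}
    [IsProbabilityMeasure P] {f : Ω → ℝ} {C : ℝ} (h : ∀ x, |f x| ≤ C) : |∫ x, f x ∂P| ≤ C := by
  have := norm_integral_le_of_norm_le (μ := P) (f := f) (integrable_const C)
    (Eventually.of_forall h)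
  simpa using this

/-- The equation only tests smooth functions, so f is mollified with an error below ε. The extension
to Lipschitz functions serves to test with x ↦ Dψ(x) W(x), which is no smoother than the field. -/
theorem WeaklyTransported.abs_integral_sub_le (hQ : WeaklyTransported τ T W Q)
    (hW : BallField τ T k W) {f : Rd d → ℝ} {K : NNReal} (hf : LipschitzWith K f) {s t : ℝ}
    (hs : s ∈ Icc τ T) (ht : t ∈ Icc τ T) (hst : s ≤ t) :
    |∫ x, f x ∂Q t - ∫ x, f x ∂Q s| ≤ K * ∫ r in s..t, k r := by
  have hQs := hQ.prob s hs
  have hQt := hQ.prob t ht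
  refine le_of_forall_pos_le_add fun ε hε => ?_
  set δ : ℝ := ε / (2 * (K + 1)) with hδ
  obtain ⟨C, _, hmol⟩ := exists_mollification (d := d) (F := ℝ) (show 0 < δ by positivity)
  obtain ⟨V, hV, hV1, hV2, _⟩ := hmol K f hf
  have hVi : ∀ t ∈ Icc τ T, Integrable (fun x : BallSpace d R => V x) (Q t) := fun t ht =>
    have := hQ.prob t ht
    integrable_continuous _ (hV.continuous.comp continuous_subtype_val)
  have hfi : ∀ t ∈ Icc τ T, Integrable (fun x : BallSpace d R => f x) (Q t) := fun t ht =>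
    have := hQ.prob t ht
    integrable_continuous _ (hf.continuous.comp continuous_subtype_val)
  have hap : ∀ t ∈ Icc τ T, |∫ x, V x ∂Q t - ∫ x, f x ∂Q t| ≤ δ * K := by
    intro t ht
    have := hQ.prob t ht
    rw [← integral_sub (hVi t ht) (hfi t ht)]
    exact abs_integral_le_of_forall fun x => hV1 x
  have hb : |∫ x, V x ∂Q t - ∫ x, V x ∂Q s| ≤ K * ∫ r in s..t, k r := by
    rw [hQ.equation V hV s hs t ht hst, ← intervalIntegral.integral_const_mul]
    refine norm_integral_le_of_ae_restrict (g := fun r => K * k r) (E := ℝ) (hW.bound_integrable.const_mul _) ?_ hs ht hst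
    filter_upwards [hW.norm_le, ae_restrict_mem measurableSet_Icc] with r hr hrm
    have := hQ.prob r hrm
    refine abs_integral_le_of_forall fun x => ?_
    refine (ContinuousLinearMap.le_opNorm (fderiv ℝ V (x : Rd d)) (W r x)).trans ?_
    gcongr
    · exact hV2 x
    · exact ((W r).norm_coe_le_norm x).trans hr
  have h1 := abs_le.1 (hap t ht)
  have h2 := abs_le.1 (hap s hs)
  have h3 := abs_le.1 hb
  have h4 : 2 * (δ * K) ≤ ε := by
    rw [hδ]
    have : 2 * (ε / (2 * ((K : ℝ) + 1)) * K) = ε * (K / (K + 1)) := by field_simp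
    rw [this]
    have : (K : ℝ) / (K + 1) ≤ 1 := by rw [div_le_one (by positivity)]; linarith
    nlinarith
  rw [abs_le]
  constructor <;> linarith

/-- Smooth functions with a bounded and Lipschitz derivative. -/
structure BoundedTest (A B : ℝ) (ψ : Rd d → ℝ) : Prop where
  contDiff : ContDiff ℝ ∞ ψ
  norm_fderiv_le : ∀ x, ‖fderiv ℝ ψ x‖ ≤ A
  norm_fderiv_sub_le : ∀ x y, ‖fderiv ℝ ψ x - fderiv ℝ ψ y‖ ≤ B * ‖x - y‖

theorem BoundedTest.nonneg_left {A B : ℝ} {ψ : Rd d → ℝ} (h : BoundedTest A B ψ) : 0 ≤ A :=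
  (norm_nonneg _).trans (h.norm_fderiv_le 0)

theorem BoundedTest.abs_sub_sub_le {A B : ℝ} (hB : 0 ≤ B) {ψ : Rd d → ℝ} (h : BoundedTest A B ψ)
    (x y z : Rd d) :
    |ψ (x + y) - ψ x - fderiv ℝ ψ x z| ≤ B * ‖y‖ ^ 2 + A * ‖y - z‖ := by
  have h1 : |ψ (x + y) - ψ x - fderiv ℝ ψ x y| ≤ B * ‖y‖ ^ 2 := by
    have := (convex_segment x (x + y)).norm_image_sub_le_of_norm_hasFDerivWithin_le'
      (f := ψ) (f' := fderiv ℝ ψ) (φ := fderiv ℝ ψ x) (C := B * ‖y‖)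
      (fun z _ => ((h.contDiff.differentiable (by simp)) z).hasFDerivAt.hasFDerivWithinAt)
      (fun z hz => (h.norm_fderiv_sub_le z x).trans (by
        gcongr
        have := norm_sub_le_of_mem_segment hz
        simpa using this))
      (left_mem_segment ℝ x (x + y)) (right_mem_segment ℝ x (x + y))
    simp only [add_sub_cancel_left] at this
    calc _ ≤ B * ‖y‖ * ‖y‖ := this
      _ = _ := by ring
  have h2 : |fderiv ℝ ψ x (y - z)| ≤ A * ‖y - z‖ :=
    ((fderiv ℝ ψ x).le_opNorm _).trans (by gcongr; exact h.norm_fderiv_le x)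
  calc |ψ (x + y) - ψ x - fderiv ℝ ψ x z|
      = |(ψ (x + y) - ψ x - fderiv ℝ ψ x y) + fderiv ℝ ψ x (y - z)| := by
        rw [map_sub]; congr 1; ring
    _ ≤ _ := (abs_add_le _ _).trans (add_le_add h1 h2)

/-- Chain rule. When c₁ and c₂ are proportional to the size of a time step, A and B are multiplied
by 1 + O(step) up to an O(step) term, so they stay bounded under iteration. -/
theorem BoundedTest.comp_id_add {A B c₁ c₂ : ℝ} (hB : 0 ≤ B) (hc₁ : 0 ≤ c₁)
    {ψ : Rd d → ℝ} (h : BoundedTest A B ψ) {V : Rd d → Rd d} (hV : ContDiff ℝ ∞ V)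
    (h1 : ∀ x, ‖fderiv ℝ V x‖ ≤ c₁) (h2 : ∀ x y, ‖fderiv ℝ V x - fderiv ℝ V y‖ ≤ c₂ * ‖x - y‖) :
    BoundedTest (A * (1 + c₁)) (B * (1 + c₁) ^ 2 + A * c₂) fun x => ψ (x + V x) := by
  have hA := h.nonneg_left
  have hVlip : ∀ x y, ‖V x - V y‖ ≤ c₁ * ‖x - y‖ := fun x y =>
    convex_univ.norm_image_sub_le_of_norm_fderiv_le (𝕜 := ℝ)
      (fun z _ => (hV.differentiable (by simp)) z) (fun z _ => h1 z) (mem_univ y) (mem_univ x)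
  have hfd : ∀ x, fderiv ℝ (fun x => ψ (x + V x)) x =
      (fderiv ℝ ψ (x + V x)).comp (ContinuousLinearMap.id ℝ (Rd d) + fderiv ℝ V x) := by
    intro x
    have e1 : HasFDerivAt (fun x => x + V x) (ContinuousLinearMap.id ℝ (Rd d) + fderiv ℝ V x) x :=
      (hasFDerivAt_id x).add ((hV.differentiable (by simp)) x).hasFDerivAt
    exact (((h.contDiff.differentiable (by simp)) (x + V x)).hasFDerivAt.comp x e1).fderiv
  have hid : ∀ x, ‖ContinuousLinearMap.id ℝ (Rd d) + fderiv ℝ V x‖ ≤ 1 + c₁ := fun x =>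
    (norm_add_le _ _).trans (add_le_add ContinuousLinearMap.norm_id_le (h1 x))
  refine ⟨h.contDiff.comp (contDiff_id.add hV), fun x => ?_, fun x y => ?_⟩
  · rw [hfd]
    refine (ContinuousLinearMap.opNorm_comp_le _ _).trans ?_
    gcongr
    · exact h.norm_fderiv_le _
    · exact hid x
  · rw [hfd, hfd]
    set a := fderiv ℝ ψ (x + V x)
    set b := fderiv ℝ ψ (y + V y)
    set p := ContinuousLinearMap.id ℝ (Rd d) + fderiv ℝ V x
    set q := ContinuousLinearMap.id ℝ (Rd d) + fderiv ℝ V y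
    have e : a.comp p - b.comp q = (a - b).comp p + b.comp (p - q) := by
      ext z
      simp
    have h3 : ‖a - b‖ ≤ B * ((1 + c₁) * ‖x - y‖) := by
      refine (h.norm_fderiv_sub_le _ _).trans ?_
      gcongr
      calc ‖x + V x - (y + V y)‖ = ‖(x - y) + (V x - V y)‖ := by congr 1; abel
        _ ≤ ‖x - y‖ + c₁ * ‖x - y‖ := (norm_add_le _ _).trans (by gcongr; exact hVlip x y)
        _ = _ := by ring
    have h4 : ‖p - q‖ ≤ c₂ * ‖x - y‖ := by
      simp only [p, q, add_sub_add_left_eq_sub]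
      exact h2 x y
    have h5 : ‖b‖ ≤ A := h.norm_fderiv_le _
    rw [e]
    calc ‖(a - b).comp p + b.comp (p - q)‖ ≤ ‖a - b‖ * ‖p‖ + ‖b‖ * ‖p - q‖ :=
          (norm_add_le _ _).trans (add_le_add (ContinuousLinearMap.opNorm_comp_le _ _)
            (ContinuousLinearMap.opNorm_comp_le _ _))
      _ ≤ B * ((1 + c₁) * ‖x - y‖) * (1 + c₁) + A * (c₂ * ‖x - y‖) := by
          gcongr
          exact hid x
      _ = _ := by ring

/-- Integration of a continuous family of linear forms against a probability measure. -/
theorem exists_integral_clm (P : Measure (BallSpace d R)) [IsProbabilityMeasure P]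
    {g : BallSpace d R → Rd d →L[ℝ] ℝ} (hg : Continuous g) :
    ∃ Λ : C(BallSpace d R, Rd d) →L[ℝ] ℝ, ∀ Y, Λ Y = ∫ x, g x (Y x) ∂P := by
  obtain ⟨A, hA0, hA⟩ : ∃ A, 0 ≤ A ∧ ∀ x, ‖g x‖ ≤ A := by
    obtain ⟨A, hA⟩ := isCompact_univ.exists_bound_of_continuousOn (hg.continuousOn (s := univ))
    exact ⟨max A 0, le_max_right _ _, fun x => (hA x (mem_univ x)).trans (le_max_left _ _)⟩
  have hi : ∀ Y : C(BallSpace d R, Rd d), Integrable (fun x => g x (Y x)) P := fun Y =>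
    integrable_continuous P (hg.clm_apply Y.continuous)
  refine ⟨LinearMap.mkContinuous
    { toFun := fun Y => ∫ x, g x (Y x) ∂P
      map_add' := fun Y Z => by
        simp only [ContinuousMap.add_apply, map_add]
        exact integral_add (hi Y) (hi Z)
      map_smul' := fun a Y => by
        simp only [ContinuousMap.smul_apply, map_smul, smul_eq_mul, RingHom.id_apply]
        exact integral_const_mul _ _ } A fun Y => ?_, fun Y => rfl⟩
  refine abs_integral_le_of_forall fun x => ((g x).le_opNorm _).trans ?_
  gcongr
  · exact hA x
  · exact Y.norm_coe_le_norm x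

/-- One step of the backward Euler scheme for the dual transport equation. -/
theorem WeaklyTransported.abs_sub_comp_le (hQ : WeaklyTransported τ T W Q)
    (hW : BallField τ T k W) {A B δ : ℝ} (hB : 0 ≤ B) (hδ1 : δ ≤ 1)
    {ψ : Rd d → ℝ} (hψ : BoundedTest A B ψ) {s t : ℝ}
    (hs : s ∈ Icc τ T) (ht : t ∈ Icc τ T) (hst : s ≤ t) {V : Rd d → Rd d} (hVc : Continuous V)
    (hV : ∀ x : BallSpace d R, ‖V x - (∫ r in s..t, W r) x‖ ≤ δ * ∫ r in s..t, k r) :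
    |∫ x, ψ x ∂Q t - ∫ x, ψ (x + V x) ∂Q s| ≤
      (∫ r in s..t, k r) * ((5 * B + A) * (∫ r in s..t, k r) + A * δ) := by
  have hQs := hQ.prob s hs
  have hA := hψ.nonneg_left
  set κ := ∫ r in s..t, k r with hκ
  have hκ0 : 0 ≤ κ := intervalIntegral.integral_nonneg hst fun r hr =>
    hW.bound_nonneg r ⟨hs.1.trans hr.1, hr.2.trans ht.2⟩
  set Wb := ∫ r in s..t, W r with hWb
  have hψc : Continuous (fderiv ℝ ψ) := hψ.contDiff.continuous_fderiv (by simp)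
  obtain ⟨Λ, hΛ⟩ := exists_integral_clm (Q s) (hψc.comp continuous_subtype_val)
  simp only [Function.comp_apply] at hΛ
  have hWi := intervalIntegrable_of_integrableOn_Icc hW.integrable hs ht
  have hΛW : ∫ r in s..t, Λ (W r) = Λ Wb := Λ.intervalIntegral_comp_comm hWi
  have hWbn : ‖Wb‖ ≤ κ :=
    norm_integral_le_of_ae_restrict hW.bound_integrable hW.norm_le hs ht hst
  -- First-order expansion: the measure is frozen at time s inside the time integral. The integrand
  -- is Lipschitz in x with constant (B + A)k(r) and Q moves by at most κ, so the error is quadratic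
  -- in κ.
  have e1 : |(∫ x, ψ x ∂Q t - ∫ x, ψ x ∂Q s) - Λ Wb| ≤ κ * ((B + A) * κ) := by
    rw [hQ.equation ψ hψ.contDiff s hs t ht hst, ← hΛW, ← intervalIntegral.integral_sub
      (intervalIntegrable_of_integrableOn_Icc (hQ.integrable ψ hψ.contDiff) hs ht)
      ⟨Λ.integrable_comp hWi.1, Λ.integrable_comp hWi.2⟩, hκ,
      ← intervalIntegral.integral_mul_const, ← Real.norm_eq_abs]
    refine norm_integral_le_of_ae_restrict (a := s) (b := t) ?_ ?_ ⟨le_rfl, hst⟩ ⟨hst, le_rfl⟩ hst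
    · exact (hW.bound_integrable.mono_set (Icc_subset_Icc hs.1 ht.2)).mul_const _
    have hle : volume.restrict (Icc s t) ≤ volume.restrict (Icc τ T) :=
      Measure.restrict_mono (Icc_subset_Icc hs.1 ht.2) le_rfl
    filter_upwards [ae_mono hle hW.norm_le, ae_mono hle hW.lipschitz,
      ae_restrict_mem measurableSet_Icc] with r hr1 hr2 hrm
    have hr : r ∈ Icc τ T := ⟨hs.1.trans hrm.1, hrm.2.trans ht.2⟩
    have hkr := hW.bound_nonneg r hr
    -- The field is defined on the ball only; the integrand is extended to a Lipschitz function on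
    -- the whole space.
    set f : Rd d → ℝ := Function.extend Subtype.val
      (fun x : BallSpace d R => fderiv ℝ ψ x (W r x)) 0 with hf
    have hfe : ∀ x : BallSpace d R, f x = fderiv ℝ ψ x (W r x) := fun x =>
      Subtype.val_injective.extend_apply _ _ x
    have hfl : LipschitzOnWith ((B + A) * k r).toNNReal f (Metric.closedBall 0 R) := by
      refine LipschitzOnWith.of_dist_le_mul fun x hx y hy => ?_
      rw [hfe ⟨x, hx⟩, hfe ⟨y, hy⟩, Real.coe_toNNReal _ (by positivity), dist_eq_norm, dist_eq_norm]
      have h1 : ‖W r ⟨x, hx⟩‖ ≤ k r := ((W r).norm_coe_le_norm _).trans hr1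
      have h2 := hr2 ⟨x, hx⟩ ⟨y, hy⟩
      calc ‖fderiv ℝ ψ x (W r ⟨x, hx⟩) - fderiv ℝ ψ y (W r ⟨y, hy⟩)‖
          = ‖(fderiv ℝ ψ x - fderiv ℝ ψ y) (W r ⟨x, hx⟩) +
              fderiv ℝ ψ y (W r ⟨x, hx⟩ - W r ⟨y, hy⟩)‖ := by
            rw [map_sub, _root_.sub_apply]; congr 1; ring
        _ ≤ B * ‖x - y‖ * k r + A * (k r * ‖x - y‖) := by
            refine (norm_add_le _ _).trans (add_le_add ?_ ?_)
            · refine (ContinuousLinearMap.le_opNorm _ _).trans ?_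
              gcongr
              exact hψ.norm_fderiv_sub_le x y
            · refine (ContinuousLinearMap.le_opNorm _ _).trans ?_
              gcongr
              exact hψ.norm_fderiv_le y
        _ = _ := by ring
    obtain ⟨g, hg, hfg⟩ := hfl.extend_real
    have hge : ∀ x : BallSpace d R, g x = fderiv ℝ ψ x (W r x) := fun x => by
      rw [← hfe, hfg x.2]
    have h3 := hQ.abs_integral_sub_le hW hg hs hr hrm.1
    simp only [hge] at h3
    rw [Real.coe_toNNReal _ (by positivity)] at h3
    rw [hΛ, Real.norm_eq_abs]
    refine h3.trans ?_
    have h4 : ∫ r in s..r, k r ≤ κ :=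
      primitive_mono (a := s) (b := t)
        (hW.bound_integrable.mono_set (Icc_subset_Icc hs.1 ht.2))
        (fun r hr => hW.bound_nonneg r ⟨hs.1.trans hr.1, hr.2.trans ht.2⟩) hrm ⟨hst, le_rfl⟩ hrm.2
    calc (B + A) * k r * ∫ r in s..r, k r ≤ (B + A) * k r * κ := by gcongr
      _ = _ := by ring
  have hψi : ∀ {f : Rd d → ℝ}, Continuous f → Integrable (fun x : BallSpace d R => f x) (Q s) :=
    fun hf => integrable_continuous _ (hf.comp continuous_subtype_val)
  -- Taylor expansion of ψ(x + V x), with ‖V‖ ≤ 2κ on the ball and V within δκ of the integrated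
  -- field.
  have e2 : |(∫ x, ψ (x + V x) ∂Q s - ∫ x, ψ x ∂Q s) - Λ Wb| ≤ 4 * B * κ ^ 2 + A * (δ * κ) := by
    have hVi : Integrable (fun x : BallSpace d R => ψ (x + V x)) (Q s) :=
      hψi (hψ.contDiff.continuous.comp (continuous_id.add hVc))
    rw [hΛ, ← integral_sub hVi (hψi hψ.contDiff.continuous), ← integral_sub]
    · refine abs_integral_le_of_forall fun x => ?_
      refine (hψ.abs_sub_sub_le hB _ _ _).trans ?_
      have h1 : ‖V x‖ ≤ 2 * κ := by
        calc ‖V x‖ = ‖(V x - Wb x) + Wb x‖ := by congr 1; abel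
          _ ≤ δ * κ + κ := (norm_add_le _ _).trans
              (add_le_add (hV x) ((Wb.norm_coe_le_norm x).trans hWbn))
          _ ≤ _ := by nlinarith
      have h2 := hV x
      calc B * ‖V x‖ ^ 2 + A * ‖V x - Wb x‖ ≤ B * (2 * κ) ^ 2 + A * (δ * κ) := by gcongr
        _ = _ := by ring
    · exact hVi.sub (hψi hψ.contDiff.continuous)
    · exact integrable_continuous _ ((hψc.comp continuous_subtype_val).clm_apply Wb.continuous)
  have h1 := abs_le.1 e1
  have h2 := abs_le.1 e2
  have h3 : κ * ((5 * B + A) * κ + A * δ) = κ * ((B + A) * κ) + (4 * B * κ ^ 2 + A * (δ * κ)) := by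
    ring
  rw [h3, abs_le]
  constructor <;> linarith

end LinearUniqueness

/-! ### Approximate dual solutions and uniqueness -/

section LinearUniqueness

variable {d : ℕ} {R τ T : ℝ}
variable {k : ℝ → ℝ} {W : ℝ → C(BallSpace d R, Rd d)}

theorem BoundedTest.mono {A A' B B' : ℝ} {ψ : Rd d → ℝ} (h : BoundedTest A B ψ) (hA : A ≤ A')
    (hB : B ≤ B') : BoundedTest A' B' ψ :=
  ⟨h.contDiff, fun x => (h.norm_fderiv_le x).trans hA, fun x y =>
    (h.norm_fderiv_sub_le x y).trans (by gcongr)⟩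

/-- The witness ψ ∘ (id + V), with V a smooth approximation of the integrated field, depends on the
field alone, so the same ψ' serves every weak solution. -/
theorem BallField.exists_approx_dual_step (hW : BallField τ T k W) {c C δ : ℝ} (hc : 0 ≤ c)
    (hδ1 : δ ≤ 1)
    (hext : ∀ κ ≥ 0, ∀ W : C(BallSpace d R, Rd d),
      (∀ x y, ‖W x - W y‖ ≤ κ * ‖(x : Rd d) - y‖) →
      ∃ V : Rd d → Rd d, ContDiff ℝ ∞ V ∧ (∀ x : BallSpace d R, ‖V x - W x‖ ≤ δ * κ) ∧
        (∀ x, ‖fderiv ℝ V x‖ ≤ c * κ) ∧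
        ∀ x y, ‖fderiv ℝ V x - fderiv ℝ V y‖ ≤ C * κ * ‖x - y‖)
    {A B : ℝ} (hB : 0 ≤ B) {ψ : Rd d → ℝ} (hψ : BoundedTest A B ψ) {s t : ℝ}
    (hs : s ∈ Icc τ T) (ht : t ∈ Icc τ T) (hst : s ≤ t) :
    ∃ ψ' : Rd d → ℝ, BoundedTest (A * (1 + c * ∫ r in s..t, k r))
        (B * (1 + c * ∫ r in s..t, k r) ^ 2 + A * (C * ∫ r in s..t, k r)) ψ' ∧
      ∀ Q : ℝ → Measure (BallSpace d R), WeaklyTransported τ T W Q →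
        |∫ x, ψ x ∂Q t - ∫ x, ψ' x ∂Q s| ≤
          (∫ r in s..t, k r) * ((5 * B + A) * (∫ r in s..t, k r) + A * δ) := by
  have hκ0 : 0 ≤ ∫ r in s..t, k r := intervalIntegral.integral_nonneg hst fun r hr =>
    hW.bound_nonneg r ⟨hs.1.trans hr.1, hr.2.trans ht.2⟩
  have hlip : ∀ x y : BallSpace d R, ‖(∫ r in s..t, W r) x - (∫ r in s..t, W r) y‖ ≤
      (∫ r in s..t, k r) * ‖(x : Rd d) - y‖ := by
    intro x y
    have e := (ContinuousMap.evalCLM ℝ x - ContinuousMap.evalCLM ℝ y :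
      C(BallSpace d R, Rd d) →L[ℝ] Rd d).intervalIntegral_comp_comm
      (intervalIntegrable_of_integrableOn_Icc hW.integrable hs ht)
    have e' : (∫ r in s..t, W r) x - (∫ r in s..t, W r) y = ∫ r in s..t, (W r x - W r y) := e.symm
    rw [e', ← intervalIntegral.integral_mul_const]
    refine norm_integral_le_of_ae_restrict (g := fun r => k r * ‖(x : Rd d) - y‖)
      (hW.bound_integrable.mul_const _) ?_ hs ht hst
    filter_upwards [hW.lipschitz] with r hr
    exact hr x y
  obtain ⟨V, hV, hV1, hV2, hV3⟩ := hext _ hκ0 _ hlip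
  exact ⟨_, hψ.comp_id_add hB (by positivity) hV hV2 hV3, fun Q hQ =>
    hQ.abs_sub_comp_le hW hB hδ1 hψ hs ht hst hV.continuous hV1⟩

/-- Backward steps are composed from t down to τ. A step of size q costs at most q·e, so the costs
add up to e times the total integral of k, and one final ψ' works for all weak solutions. -/
theorem BallField.exists_approx_dual (hW : BallField τ T k W) {t : ℝ}
    (ht : t ∈ Icc τ T) {a b : ℝ} (hb : 0 ≤ b) {ψ : Rd d → ℝ} (hψ : BoundedTest a b ψ) {e : ℝ}
    (he : 0 < e) :
    ∃ ψ' : Rd d → ℝ, ∀ Q : ℝ → Measure (BallSpace d R), WeaklyTransported τ T W Q →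
      |∫ x, ψ x ∂Q t - ∫ x, ψ' x ∂Q τ| ≤ (∫ r in τ..t, k r) * e := by
  have ha := hψ.nonneg_left
  obtain ⟨c, hc, hext⟩ := exists_smooth_extension d R
  set κ : ℝ → ℝ := fun s => ∫ r in s..t, k r with hκ
  have hκ0 : ∀ s ∈ Icc τ t, 0 ≤ κ s := fun s hs => intervalIntegral.integral_nonneg hs.2 fun r hr =>
    hW.bound_nonneg r ⟨hs.1.trans hr.1, hr.2.trans ht.2⟩
  have hadd : ∀ s' ∈ Icc τ t, ∀ s ∈ Icc τ t, (∫ r in s'..s, k r) + κ s = κ s' := fun s' hs' s hs =>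
    intervalIntegral.integral_add_adjacent_intervals
      (intervalIntegrable_of_integrableOn_Icc hW.bound_integrable ⟨hs'.1, hs'.2.trans ht.2⟩
        ⟨hs.1, hs.2.trans ht.2⟩)
      (intervalIntegrable_of_integrableOn_Icc hW.bound_integrable ⟨hs.1, hs.2.trans ht.2⟩ ht)
  have hκle : ∀ s ∈ Icc τ t, κ s ≤ κ τ := by
    intro s hs
    have h1 := hadd τ ⟨le_rfl, ht.1⟩ s hs
    have h2 : 0 ≤ ∫ r in τ..s, k r := primitive_nonneg hW.bound_nonneg ⟨hs.1, hs.2.trans ht.2⟩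
    linarith
  set Am := a * Real.exp (c * κ τ) with hAm
  have hAm0 : 0 ≤ Am := by positivity
  -- The first-derivative bound Am involves only c, so δ can be fixed from it; C then depends on δ,
  -- the second-derivative bound Bm on C, and the step size η comes last.
  set δ := min 1 (e / (2 * (Am + 1))) with hδ
  have hδ0 : 0 < δ := lt_min one_pos (by positivity)
  have hδe : Am * δ ≤ e / 2 := by
    calc Am * δ ≤ (Am + 1) * (e / (2 * (Am + 1))) := by
          gcongr
          · linarith
          · exact min_le_right _ _
      _ = e / 2 := by field_simp
  obtain ⟨C, hC, hext⟩ := hext δ hδ0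
  have hκτ := hκ0 τ ⟨le_rfl, ht.1⟩
  -- Bm and Am are the values at τ, hence the largest ones, of the bounds carried through the
  -- induction; the exponent 3c absorbs the factor (1 + cq)² of each step.
  set Bm := (b + C * a * κ τ) * Real.exp (3 * c * κ τ) with hBm
  have hBm0 : 0 ≤ Bm := by positivity
  set η := e / (2 * (5 * Bm + Am + 1)) with hη
  have hη0 : 0 < η := by positivity
  have hηe : (5 * Bm + Am) * η ≤ e / 2 := by
    calc (5 * Bm + Am) * η ≤ (5 * Bm + Am + 1) * η := mul_le_mul_of_nonneg_right (by linarith) hη0.le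
      _ = e / 2 := by rw [hη]; field_simp
  -- Uniform continuity of the primitive of k provides a mesh on which each step has size at most η,
  -- although k is only integrable.
  obtain ⟨ρ, hρ0, hρ⟩ : ∃ ρ > 0, ∀ s' ∈ Icc τ t, ∀ s ∈ Icc τ t, s' ≤ s → s - s' ≤ ρ →
      ∫ r in s'..s, k r ≤ η := by
    have huc := isCompact_Icc.uniformContinuousOn_of_continuous
      (continuousOn_primitive_Icc hW.bound_integrable (ht.1.trans ht.2))
    obtain ⟨ρ, hρ0, hρ⟩ := Metric.uniformContinuousOn_iff_le.1 huc η hη0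
    refine ⟨ρ, hρ0, fun s' hs' s hs hle hd => ?_⟩
    have h1 : s' ∈ Icc τ T := ⟨hs'.1, hs'.2.trans ht.2⟩
    have h2 : s ∈ Icc τ T := ⟨hs.1, hs.2.trans ht.2⟩
    have h3 := hρ s h2 s' h1 (by rw [Real.dist_eq, abs_of_nonneg (by linarith)]; exact hd)
    have h4 : τ ∈ Icc τ T := ⟨le_rfl, ht.1.trans ht.2⟩
    rw [Real.dist_eq, intervalIntegral.integral_interval_sub_left
      (intervalIntegrable_of_integrableOn_Icc hW.bound_integrable h4 h2)
      (intervalIntegrable_of_integrableOn_Icc hW.bound_integrable h4 h1)] at h3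
    exact (le_abs_self _).trans h3
  have main : ∀ n : ℕ, ∀ s ∈ Icc τ t, t - s ≤ n * ρ → ∃ ψ' : Rd d → ℝ,
      BoundedTest (a * Real.exp (c * κ s)) ((b + C * a * κ s) * Real.exp (3 * c * κ s)) ψ' ∧
      ∀ Q : ℝ → Measure (BallSpace d R), WeaklyTransported τ T W Q →
        |∫ x, ψ x ∂Q t - ∫ x, ψ' x ∂Q s| ≤ κ s * e := by
    intro n
    induction n with
    | zero =>
      intro s hs h
      have : s = t := le_antisymm hs.2 (by simpa using h)
      subst this
      refine ⟨ψ, ?_, fun Q _ => by simp [hκ]⟩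
      simpa [hκ] using hψ
    | succ n ih =>
      intro s' hs' h
      set s := min t (s' + ρ) with hs
      have hss : s' ≤ s := le_min hs'.2 (by linarith)
      have hsm : s ∈ Icc τ t := ⟨hs'.1.trans hss, min_le_left _ _⟩
      obtain ⟨ψ₁, hψ₁, hQ₁⟩ := ih s hsm (by
        rcases min_choice t (s' + ρ) with h' | h' <;> rw [hs, h']
        · simp; positivity
        · push_cast at h; linarith)
      have hκs := hκ0 s hsm
      have hκ1 : 0 ≤ ∫ r in s'..s, k r := intervalIntegral.integral_nonneg hss fun r hr =>
        hW.bound_nonneg r ⟨hs'.1.trans hr.1, hr.2.trans (hsm.2.trans ht.2)⟩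
      obtain ⟨ψ₂, hψ₂, hQ₂⟩ := hW.exists_approx_dual_step hc.le (min_le_left _ _) hext
        (B := (b + C * a * κ s) * Real.exp (3 * c * κ s)) (by positivity)
        hψ₁ ⟨hs'.1, hs'.2.trans ht.2⟩ ⟨hsm.1, hsm.2.trans ht.2⟩ hss
      have hκ' := hadd s' hs' s hsm
      set q := ∫ r in s'..s, k r with hq
      have hqη : q ≤ η := hρ s' hs' s hsm hss (by
        have := min_le_right t (s' + ρ)
        linarith)
      have hexp : 1 + c * q ≤ Real.exp (c * q) := by
        have := Real.add_one_le_exp (c * q); linarith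
      refine ⟨ψ₂, hψ₂.mono ?_ ?_, fun Q hQ => ?_⟩
      · calc a * Real.exp (c * κ s) * (1 + c * q) ≤ a * Real.exp (c * κ s) * Real.exp (c * q) := by
              gcongr
          _ = _ := by rw [mul_assoc, ← Real.exp_add, ← hκ']; ring_nf
      · have e1 : (b + C * a * κ s) * Real.exp (3 * c * κ s) * (1 + c * q) ^ 2 ≤
            (b + C * a * κ s) * Real.exp (3 * c * κ s') := by
          calc (b + C * a * κ s) * Real.exp (3 * c * κ s) * (1 + c * q) ^ 2 ≤
              (b + C * a * κ s) * Real.exp (3 * c * κ s) * Real.exp (c * q) ^ 2 := by gcongr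
            _ = (b + C * a * κ s) * Real.exp (3 * c * κ s + 2 * (c * q)) := by
                rw [Real.exp_add, mul_assoc, two_mul, Real.exp_add, sq]
            _ ≤ _ := by
                gcongr
                rw [← hκ']
                nlinarith [mul_nonneg hc.le hκ1]
        have e2 : a * Real.exp (c * κ s) * (C * q) ≤ C * a * q * Real.exp (3 * c * κ s') := by
          calc a * Real.exp (c * κ s) * (C * q) = C * a * q * Real.exp (c * κ s) := by ring
            _ ≤ _ := by
                refine mul_le_mul_of_nonneg_left (Real.exp_le_exp.2 ?_) (by positivity)
                rw [← hκ']
                nlinarith [mul_nonneg hc.le hκ1, mul_nonneg hc.le hκs]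
        calc _ ≤ _ := add_le_add e1 e2
          _ = _ := by rw [← hκ']; ring
      · have h1 := hQ₁ Q hQ
        have h2 := hQ₂ Q hQ
        have h3 : κ s ≤ κ τ := hκle s hsm
        have h4 : q * ((5 * ((b + C * a * κ s) * Real.exp (3 * c * κ s)) +
            a * Real.exp (c * κ s)) * q + a * Real.exp (c * κ s) * δ) ≤ q * e := by
          gcongr
          calc _ ≤ (5 * Bm + Am) * η + Am * δ := by
                rw [hAm, hBm]
                gcongr
            _ ≤ e := by linarith
        calc |∫ x, ψ x ∂Q t - ∫ x, ψ₂ x ∂Q s'|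
            = |(∫ x, ψ x ∂Q t - ∫ x, ψ₁ x ∂Q s) + (∫ x, ψ₁ x ∂Q s - ∫ x, ψ₂ x ∂Q s')| := by
              congr 1; ring
          _ ≤ κ s * e + q * e := (abs_add_le _ _).trans (add_le_add h1 (h2.trans h4))
          _ = _ := by rw [← hκ']; ring
  obtain ⟨n, hn⟩ := exists_nat_ge ((t - τ) / ρ)
  obtain ⟨ψ', -, h⟩ := main n τ ⟨le_rfl, ht.1⟩ ((div_le_iff₀ hρ0).1 hn)
  exact ⟨ψ', h⟩

/-- Weak solutions of the linear continuity equation are determined by their initial datum. -/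
theorem WeaklyTransported.integral_eq (hW : BallField τ T k W)
    {Q Q' : ℝ → Measure (BallSpace d R)} (hQ : WeaklyTransported τ T W Q)
    (hQ' : WeaklyTransported τ T W Q') (h0 : Q τ = Q' τ) {t : ℝ} (ht : t ∈ Icc τ T)
    {a b : ℝ} (hb : 0 ≤ b) {ψ : Rd d → ℝ} (hψ : BoundedTest a b ψ) :
    ∫ x, ψ x ∂Q t = ∫ x, ψ x ∂Q' t := by
  have hκ := primitive_nonneg hW.bound_nonneg ht
  set κ := ∫ r in τ..t, k r
  rw [← sub_eq_zero, ← abs_nonpos_iff]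
  refine le_of_forall_pos_le_add fun ε hε => ?_
  obtain ⟨ψ', h⟩ := hW.exists_approx_dual ht hb hψ (e := ε / (2 * (κ + 1))) (by positivity)
  have h1 := abs_le.1 (h Q hQ)
  have h2 := abs_le.1 (h Q' hQ')
  rw [h0] at h1
  have h3 : κ * (ε / (2 * (κ + 1))) ≤ ε / 2 := by
    calc κ * (ε / (2 * (κ + 1))) ≤ (κ + 1) * (ε / (2 * (κ + 1))) := by gcongr; linarith
      _ = ε / 2 := by field_simp
  rw [abs_le]
  constructor <;> linarith

theorem boundedTest_cos (a : Rd d) (θ : ℝ) :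
    BoundedTest ‖a‖ (‖a‖ ^ 2) fun x => Real.cos (inner ℝ a x + θ) := by
  have hfd : ∀ x, fderiv ℝ (fun x => Real.cos (inner ℝ a x + θ)) x =
      -Real.sin (inner ℝ a x + θ) • innerSL ℝ a := fun x =>
    (((innerSL ℝ a).hasFDerivAt (x := x)).add_const θ).cos.fderiv
  have hn : ‖innerSL ℝ a‖ = ‖a‖ := innerSL_apply_norm ℝ a
  refine ⟨?_, fun x => ?_, fun x y => ?_⟩
  · exact Real.contDiff_cos.comp (((innerSL ℝ a).contDiff).add contDiff_const)
  · rw [hfd, norm_smul, hn, norm_neg]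
    exact mul_le_of_le_one_left (norm_nonneg _) (Real.abs_sin_le_one _)
  · rw [hfd, hfd, ← sub_smul, norm_smul, hn]
    have h1 : |Real.sin (inner ℝ a x + θ) - Real.sin (inner ℝ a y + θ)| ≤ ‖a‖ * ‖x - y‖ := by
      refine (Real.abs_sin_sub_sin_le _ _).trans ?_
      rw [add_sub_add_right_eq_sub, ← inner_sub_right]
      exact abs_real_inner_le_norm _ _
    rw [← neg_sub_neg, neg_neg, neg_neg, Real.norm_eq_abs, abs_sub_comm]
    calc _ ≤ ‖a‖ * ‖x - y‖ * ‖a‖ := by gcongr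
      _ = _ := by ring

/-- The phases 0 and -π/2 recover the real and imaginary parts of the characteristic function.
Cosines are used because they have bounded and Lipschitz derivatives. -/
theorem measure_eq_of_integral_cos_eq {P Q : Measure (Rd d)} [IsFiniteMeasure P] [IsFiniteMeasure Q]
    (h : ∀ (a : Rd d) (θ : ℝ), ∫ x, Real.cos (inner ℝ a x + θ) ∂P =
      ∫ x, Real.cos (inner ℝ a x + θ) ∂Q) : P = Q := by
  refine Measure.ext_of_charFun (funext fun a => ?_)
  have hi : ∀ (P : Measure (Rd d)) [IsFiniteMeasure P],
      Integrable (fun x => Complex.exp (inner ℝ x a * Complex.I)) P := fun P _ =>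
    (integrable_const (1 : ℝ)).mono' (by fun_prop) (Eventually.of_forall fun x => by
      rw [Complex.norm_exp_ofReal_mul_I])
  have key : ∀ (P : Measure (Rd d)) [IsFiniteMeasure P], charFun P a =
      ((∫ x, Real.cos (inner ℝ a x + 0) ∂P : ℝ) : ℂ) +
        ((∫ x, Real.cos (inner ℝ a x + -(Real.pi / 2)) ∂P : ℝ) : ℂ) * Complex.I := by
    intro P _
    rw [charFun_apply, ← integral_re_add_im (hi P)]
    simp [Complex.exp_ofReal_mul_I_re, Complex.exp_ofReal_mul_I_im, real_inner_comm a,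
      ← sub_eq_add_neg, Real.cos_sub_pi_div_two]
  rw [key P, key Q, h, h]

end LinearUniqueness

/-! ### Every solution is the law of a Lagrangian curve -/

section Representation

variable {d : ℕ} {τ T : ℝ} {m : ℝ → ℝ} {l L : ℝ → ℝ → ℝ} {w : ℝ → Pc d → Rd d → Rd d}

/-- The weak form of the continuity equation driven by the field `g`. -/
def WeakForm (τ T : ℝ) (g : ℝ → Rd d → Rd d) (ν : ℝ → Pc d) : Prop :=
  ∀ ψ : Rd d → ℝ, ContDiff ℝ ∞ ψ →
    IntegrableOn (fun t => ∫ x, fderiv ℝ ψ x (g t x) ∂(ν t).meas) (Icc τ T) ∧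
    ∀ s ∈ Icc τ T, ∀ t ∈ Icc τ T, s ≤ t →
      ∫ x, ψ x ∂(ν t).meas - ∫ x, ψ x ∂(ν s).meas =
        ∫ r in s..t, ∫ x, fderiv ℝ ψ x (g r x) ∂(ν r).meas

theorem measurableEmbedding_ball (d : ℕ) (R : ℝ) :
    MeasurableEmbedding (Subtype.val : BallSpace d R → Rd d) :=
  MeasurableEmbedding.subtype_coe Metric.isClosed_closedBall.measurableSet

theorem exists_measure_ball {μ : Pc d} {R : ℝ} (hμ : μ.LivesOn (ball0 d R)) :
    ∃ P : Measure (BallSpace d R), IsProbabilityMeasure P ∧ P.map Subtype.val = μ.meas := by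
  obtain ⟨P, hP, h⟩ := exists_law_ballIncl hμ
  exact ⟨P, hP, congrArg Pc.meas h⟩

theorem WeakForm.weaklyTransported {R : ℝ} {g : ℝ → Rd d → Rd d} {ν : ℝ → Pc d}
    (h : WeakForm τ T g ν) {W : ℝ → C(BallSpace d R, Rd d)}
    (hWg : ∀ᵐ t ∂volume.restrict (Icc τ T), ∀ x, W t x = g t x)
    {Q : ℝ → Measure (BallSpace d R)} (hp : ∀ t ∈ Icc τ T, IsProbabilityMeasure (Q t))
    (hmap : ∀ t ∈ Icc τ T, (Q t).map Subtype.val = (ν t).meas) :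
    WeaklyTransported τ T W Q := by
  have hi : ∀ t ∈ Icc τ T, ∀ f : Rd d → ℝ, ∫ x, f x ∂Q t = ∫ x, f x ∂(ν t).meas :=
    fun t ht f => by rw [← hmap t ht, (measurableEmbedding_ball d R).integral_map]
  have hae : ∀ ψ : Rd d → ℝ, ∀ᵐ t ∂volume.restrict (Icc τ T),
      ∫ x, fderiv ℝ ψ x (W t x) ∂Q t = ∫ x, fderiv ℝ ψ x (g t x) ∂(ν t).meas := by
    intro ψ
    filter_upwards [hWg, ae_restrict_mem measurableSet_Icc] with t ht htm
    rw [← hi t htm]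
    simp only [ht]
  refine ⟨hp, fun ψ hψ => ?_, fun ψ hψ s hs t ht hst => ?_⟩
  · exact (h ψ hψ).1.congr ((hae ψ).mono fun t ht => ht.symm)
  · rw [hi t ht, hi s hs, (h ψ hψ).2 s hs t ht hst]
    refine intervalIntegral.integral_congr_ae_restrict ?_
    rw [uIoc_of_le hst]
    have hle : volume.restrict (Ioc s t) ≤ volume.restrict (Icc τ T) :=
      Measure.restrict_mono (Ioc_subset_Icc_self.trans (Icc_subset_Icc hs.1 ht.2)) le_rfl
    filter_upwards [ae_mono hle (hae ψ)] with t ht using ht.symm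

/-- One function must dominate both the sup norm and the Lipschitz constant of the field on the
ball; hence the sum of the two bounds. -/
theorem LipField.ballField (h : LipField τ T m l L w) {R : ℝ} (hR : 0 < R) {N : ℝ → Pc d}
    (hN : BoundedCurve τ T R N) :
    BallField τ T (fun t => m t * (1 + R + R) + l R t)
      (fun t => fieldOn w t (N t) (ballIncl d R)) := by
  have hι : ‖ballIncl d R‖ ≤ R :=
    (ContinuousMap.norm_le _ hR.le).2 fun x => mem_closedBall_zero_iff.1 x.2
  have hM : ∀ t ∈ Icc τ T, moment1 (N t) ≤ R := by
    intro t ht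
    obtain ⟨P, hP, hPN⟩ := exists_law_ballIncl (hN.livesOn t ht)
    rw [← hPN]
    exact (moment1_law_le P _).trans hι
  have hk : IntegrableOn (fun t => m t * (1 + R + R) + l R t) (Icc τ T) :=
    (h.growth_integrable.mul_const _).add (h.space_integrable R hR)
  have hn : ∀ᵐ t ∂volume.restrict (Icc τ T),
      ‖fieldOn w t (N t) (ballIncl d R)‖ ≤ m t * (1 + R + R) + l R t := by
    filter_upwards [h.norm_fieldOn_le (Ω := BallSpace d R),
      ae_restrict_mem measurableSet_Icc] with t ht htm
    have h0 := h.growth_nonneg t htm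
    have h1 := h.space_nonneg R hR t htm
    have h2 := hM t htm
    calc _ ≤ m t * (1 + ‖ballIncl d R‖ + moment1 (N t)) := ht _ _
      _ ≤ m t * (1 + R + R) := by gcongr
      _ ≤ _ := by linarith
  refine ⟨hk, fun t ht => ?_, ?_, hn, ?_⟩
  · have h0 := h.growth_nonneg t ht
    have h1 := h.space_nonneg R hR t ht
    positivity
  · exact hk.mono' (h.aestronglyMeasurable_fieldOn hN continuous_const) hn
  · filter_upwards [h.fieldOn_apply (Ω := BallSpace d R), h.lipschitz_space R hR,
      ae_restrict_mem measurableSet_Icc] with t ht1 ht2 htm x y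
    have h0 := h.growth_nonneg t htm
    rw [ht1, ht1]
    refine (ht2 _ (hN.livesOn t htm) _ x.2 _ y.2).trans ?_
    gcongr
    have : 0 ≤ m t * (1 + R + R) := by positivity
    linarith

/-- With the measure argument frozen along N the equation is linear. Both curves are lifted to the
ball, where duality determines all cosine integrals from the initial datum. -/
theorem LipField.eq_of_weakForm (h : LipField τ T m l L w) {R : ℝ} {N : ℝ → Pc d}
    (hN : BoundedCurve τ T R N) {μ ν : ℝ → Pc d}
    (hμR : ∀ t ∈ Icc τ T, (μ t).LivesOn (ball0 d R))
    (hνR : ∀ t ∈ Icc τ T, (ν t).LivesOn (ball0 d R))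
    (hμ : WeakForm τ T (fun t => w t (N t)) μ) (hν : WeakForm τ T (fun t => w t (N t)) ν)
    (h0 : μ τ = ν τ) : ∀ t ∈ Icc τ T, μ t = ν t := by
  intro t ht
  set R' := max R 1
  have hRR : R ≤ R' := le_max_left _ _
  have hR : 0 < R' := lt_max_of_lt_right one_pos
  have hW := h.ballField hR (hN.mono hRR)
  have hWg : ∀ᵐ t ∂volume.restrict (Icc τ T), ∀ x,
      fieldOn w t (N t) (ballIncl d R') x = w t (N t) x := by
    filter_upwards [h.fieldOn_apply (Ω := BallSpace d R')] with t ht x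
    exact ht _ _ _
  -- The lift is a function of the measure, so equal initial measures have equal lifts.
  choose! q hq using fun (ρ : Pc d) (hρ : ρ.LivesOn (ball0 d R')) => exists_measure_ball hρ
  have hp : ∀ {ν : ℝ → Pc d}, (∀ t ∈ Icc τ T, (ν t).LivesOn (ball0 d R)) → ∀ t ∈ Icc τ T,
      IsProbabilityMeasure (q (ν t)) ∧ (q (ν t)).map Subtype.val = (ν t).meas :=
    fun hν t ht => hq _ ((hν t ht).mono hRR)
  have hQ : ∀ {ν : ℝ → Pc d}, (∀ t ∈ Icc τ T, (ν t).LivesOn (ball0 d R)) →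
      WeakForm τ T (fun t => w t (N t)) ν → WeaklyTransported τ T
        (fun t => fieldOn w t (N t) (ballIncl d R')) (fun t => q (ν t)) := fun hν hw =>
    hw.weaklyTransported hWg (fun t ht => (hp hν t ht).1) fun t ht => (hp hν t ht).2
  refine Subtype.ext (measure_eq_of_integral_cos_eq (P := (μ t).meas) (Q := (ν t).meas)
    fun a θ => ?_)
  have := WeaklyTransported.integral_eq hW (hQ hμR hμ) (hQ hνR hν) (by simp only [h0]) ht
    (by positivity) (boundedTest_cos a θ)
  rw [← (hp hμR t ht).2, ← (hp hνR t ht).2, (measurableEmbedding_ball d R').integral_map,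
    (measurableEmbedding_ball d R').integral_map]
  exact this

variable {Ω : Type*} [MetricSpace Ω] [CompactSpace Ω] [MeasurableSpace Ω] [BorelSpace Ω]
  (P : Measure Ω) [IsProbabilityMeasure P]

theorem LipField.weakForm_law (h : LipField τ T m l L w) {N : ℝ → Pc d} {X₀ : C(Ω, Rd d)}
    {X : ℝ → C(Ω, Rd d)} (hX : Continuous X)
    (hint : IntegrableOn (fun t => fieldOn w t (N t) (X t)) (Icc τ T))
    (heq : ∀ t ∈ Icc τ T, X t = X₀ + ∫ s in τ..t, fieldOn w s (N s) (X s)) :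
    WeakForm τ T (fun t => w t (N t)) fun t => law P (X t) := by
  intro ψ hψ
  obtain ⟨h1, h2⟩ := integral_comp_curve P hX hint heq (ξ := fun p => ψ p.2)
    (hψ.comp contDiff_snd)
  have hψc : Continuous (fderiv ℝ ψ) := hψ.continuous_fderiv (by simp)
  have hfd : ∀ (p : ℝ × Rd d) (y : Rd d), fderiv ℝ (fun p : ℝ × Rd d => ψ p.2) p (1, y) =
      fderiv ℝ ψ p.2 y := by
    intro p y
    have : HasFDerivAt (fun p : ℝ × Rd d => ψ p.2)
        ((fderiv ℝ ψ p.2).comp (ContinuousLinearMap.snd ℝ ℝ (Rd d))) p :=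
      ((hψ.differentiable (by simp)) p.2).hasFDerivAt.comp p hasFDerivAt_snd
    rw [this.fderiv]
    rfl
  simp only [hfd] at h1 h2
  have hae : ∀ᵐ t ∂volume.restrict (Icc τ T),
      ∫ o, fderiv ℝ ψ (X t o) (fieldOn w t (N t) (X t) o) ∂P =
        ∫ x, fderiv ℝ ψ x (w t (N t) x) ∂(law P (X t)).meas := by
    filter_upwards [h.fieldOn_apply (Ω := Ω), h.continuous_space] with t ht1 ht2
    rw [integral_law P (X t) (hψc.clm_apply (ht2 (N t)))]
    simp only [ht1]
  refine ⟨h1.congr hae, fun s hs t ht hst => ?_⟩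
  rw [integral_law P (X t) hψ.continuous, integral_law P (X s) hψ.continuous,
    ← h2 s hs t ht hst]
  refine intervalIntegral.integral_congr_ae_restrict ?_
  rw [uIoc_of_le hst]
  exact ae_mono (Measure.restrict_mono (Ioc_subset_Icc_self.trans (Icc_subset_Icc hs.1 ht.2))
    le_rfl) hae

/-- Every solution of the continuity equation is the law of a Lagrangian flow. -/
theorem SolvesCE.exists_lagrangian (h : LipField τ T m l L w) (hτT : τ ≤ T) {X₀ : C(Ω, Rd d)}
    {μ : ℝ → Pc d} (hs : SolvesCE T w τ (law P X₀) μ) :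
    ∃ X : ℝ → C(Ω, Rd d), Continuous X ∧
      IntegrableOn (fun t => fieldOn w t (law P (X t)) (X t)) (Icc τ T) ∧
      (∀ t ∈ Icc τ T, X t = X₀ + ∫ s in τ..t, fieldOn w s (law P (X s)) (X s)) ∧
      ∀ t ∈ Icc τ T, μ t = law P (X t) := by
  obtain ⟨R, hR, hμ⟩ := hs.exists_boundedCurve h hτT
  obtain ⟨X, hX, hint, heq⟩ := h.exists_lagrangian_frozen hτT hμ X₀
  obtain ⟨R', hR', -, hν⟩ := exists_boundedCurve_law P τ T hX
  -- X follows the field frozen along μ, and its law solves the same linear equation as μ. Once the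
  -- two are identified, the frozen field is the non-local field along X itself.
  have hμX : ∀ t ∈ Icc τ T, μ t = law P (X t) := by
    refine h.eq_of_weakForm (R := max R R') (hμ.mono (le_max_left _ _))
      (fun t ht => (hμ.livesOn t ht).mono (le_max_left _ _))
      (fun t ht => (hν.livesOn t ht).mono (le_max_right _ _))
      (fun ψ hψ => hs.sub_eq_integral_of_boundedCurve h hμ hψ)
      (h.weakForm_law P hX hint heq) ?_
    rw [hs.initial, heq τ ⟨le_rfl, hτT⟩]
    simp
  refine ⟨X, hX, hint.congr_fun (fun t ht => by simp only [hμX t ht]) measurableSet_Icc,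
    fun t ht => ?_, hμX⟩
  rw [heq t ht]
  congr 1
  refine intervalIntegral.integral_congr fun r hr => ?_
  rw [uIcc_of_le ht.1] at hr
  simp only [hμX r ⟨hr.1, hr.2.trans ht.2⟩]

end Representation

/-! ### Stability of Lagrangian curves in L² and L¹ -/

section Stability

/-- Grönwall in a weaker norm: the curve lives in C(Ω, ℝ^d), while J embeds it in L¹ or L², where
the averaged estimates close. -/
theorem norm_clm_le_of_integral_eq {E F : Type*} [NormedAddCommGroup E] [NormedSpace ℝ E]
    [CompleteSpace E] [NormedAddCommGroup F] [NormedSpace ℝ F] [CompleteSpace F] (J : E →L[ℝ] F)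
    {τ T : ℝ} {X G : ℝ → E} {X₀ : E} (hX : Continuous X) (hG : IntegrableOn G (Icc τ T))
    (heq : ∀ t ∈ Icc τ T, X t = X₀ + ∫ s in τ..t, G s) {a b : ℝ → ℝ}
    (ha : IntegrableOn a (Icc τ T)) (ha0 : ∀ t ∈ Icc τ T, 0 ≤ a t)
    (hb : IntegrableOn b (Icc τ T)) (hb0 : ∀ t ∈ Icc τ T, 0 ≤ b t)
    (h : ∀ᵐ t ∂volume.restrict (Icc τ T), ‖J (G t)‖ ≤ b t + a t * ‖J (X t)‖) :
    ∀ t ∈ Icc τ T, ‖J (X t)‖ ≤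
      2 * (‖J X₀‖ + ∫ s in τ..T, b s) * Real.exp (2 * ∫ s in τ..t, a s) := by
  intro t ht
  have hτT : τ ≤ T := ht.1.trans ht.2
  have hJX : Continuous fun t => ‖J (X t)‖ := (J.continuous.comp hX).norm
  have hτ : τ ∈ Icc τ T := ⟨le_rfl, hτT⟩
  have hbT : 0 ≤ ∫ s in τ..T, b s := primitive_nonneg hb0 ⟨hτT, le_rfl⟩
  have haX : IntegrableOn (fun s => a s * ‖J (X s)‖) (Icc τ T) :=
    ha.mul_continuousOn hJX.continuousOn isCompact_Icc
  refine gronwall_integrable ha ha0 hJX.continuousOn (by positivity) (fun t ht => ?_) t ht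
  rw [heq t ht, map_add, ← J.intervalIntegral_comp_comm
    (intervalIntegrable_of_integrableOn_Icc hG hτ ht)]
  have h1 : ‖∫ s in τ..t, J (G s)‖ ≤ ∫ s in τ..t, (b s + a s * ‖J (X s)‖) :=
    norm_integral_le_of_ae_restrict (hb.add haX) h hτ ht ht.1
  rw [intervalIntegral.integral_add (intervalIntegrable_of_integrableOn_Icc hb hτ ht)
    (intervalIntegrable_of_integrableOn_Icc haX hτ ht)] at h1
  have h2 := primitive_mono hb hb0 ht ⟨hτT, le_rfl⟩ ht.2
  refine (norm_add_le _ _).trans ?_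
  linarith

variable {d : ℕ} {Ω : Type*} [MetricSpace Ω] [CompactSpace Ω] [MeasurableSpace Ω] [BorelSpace Ω]
  (P : Measure Ω) [IsProbabilityMeasure P]

theorem norm_toLp_two_sq (g : C(Ω, Rd d)) :
    ‖ContinuousMap.toLp (E := Rd d) 2 P ℝ g‖ ^ 2 = ∫ o, ‖g o‖ ^ 2 ∂P := by
  rw [← real_inner_self_eq_norm_sq, L2.inner_def]
  refine integral_congr_ae ?_
  filter_upwards [ContinuousMap.coeFn_toLp (p := 2) P (𝕜 := ℝ) g] with o ho
  rw [ho, real_inner_self_eq_norm_sq]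

theorem norm_toLp_one (g : C(Ω, Rd d)) :
    ‖ContinuousMap.toLp (E := Rd d) 1 P ℝ g‖ = ∫ o, ‖g o‖ ∂P := by
  rw [L1.norm_eq_integral_norm]
  refine integral_congr_ae ?_
  filter_upwards [ContinuousMap.coeFn_toLp (p := 1) P (𝕜 := ℝ) g] with o ho
  rw [ho]

/-- Nonnegativity of the variance of ‖g‖. -/
theorem sq_integral_norm_le (g : C(Ω, Rd d)) : (∫ o, ‖g o‖ ∂P) ^ 2 ≤ ∫ o, ‖g o‖ ^ 2 ∂P := by
  set c := ∫ o, ‖g o‖ ∂P with hc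
  have h : 0 ≤ ∫ o, (‖g o‖ - c) ^ 2 ∂P := integral_nonneg fun o => sq_nonneg _
  have h1 : Integrable (fun o => ‖g o‖ ^ 2) P := integrable_continuous P (by fun_prop)
  have h2 : Integrable (fun o => 2 * c * ‖g o‖) P := integrable_continuous P (by fun_prop)
  have e : ∀ o, (‖g o‖ - c) ^ 2 = (‖g o‖ ^ 2 - 2 * c * ‖g o‖) + c ^ 2 := fun o => by ring
  simp only [e] at h
  have h12 : Integrable (fun o => ‖g o‖ ^ 2 - 2 * c * ‖g o‖) P := h1.sub h2
  rw [integral_add h12 (integrable_const _), integral_sub h1 h2, integral_const_mul, ← hc] at h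
  simp at h
  nlinarith

/-- By (x + c)² ≤ 2x² + 2c² and Jensen, the L² norm of the velocity difference is at most 2a times
that of X - Y. Grönwall has prefactor 2 and exponent 4∫a; squaring gives 4 and 8. -/
theorem integral_norm_sq_sub_le {τ T : ℝ} {X Y G H : ℝ → C(Ω, Rd d)} {X₀ Y₀ : C(Ω, Rd d)}
    (hX : Continuous X) (hY : Continuous Y) (hG : IntegrableOn G (Icc τ T))
    (hH : IntegrableOn H (Icc τ T)) (heqX : ∀ t ∈ Icc τ T, X t = X₀ + ∫ s in τ..t, G s)
    (heqY : ∀ t ∈ Icc τ T, Y t = Y₀ + ∫ s in τ..t, H s) {a : ℝ → ℝ}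
    (ha : IntegrableOn a (Icc τ T)) (ha0 : ∀ t ∈ Icc τ T, 0 ≤ a t)
    (h : ∀ᵐ t ∂volume.restrict (Icc τ T), ∀ o,
      ‖G t o - H t o‖ ≤ a t * (‖X t o - Y t o‖ + ∫ o, ‖X t o - Y t o‖ ∂P)) :
    ∀ t ∈ Icc τ T, ∫ o, ‖X t o - Y t o‖ ^ 2 ∂P ≤
      4 * (∫ o, ‖X₀ o - Y₀ o‖ ^ 2 ∂P) * Real.exp (8 * ∫ s in τ..t, a s) := by
  intro t ht
  have hτ : τ ∈ Icc τ T := ⟨le_rfl, ht.1.trans ht.2⟩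
  set J := ContinuousMap.toLp (E := Rd d) 2 P ℝ with hJ
  have key := norm_clm_le_of_integral_eq J (X := fun t => X t - Y t) (G := fun t => G t - H t)
    (X₀ := X₀ - Y₀) (hX.sub hY) (hG.sub hH) (fun t ht => by
      rw [heqX t ht, heqY t ht, intervalIntegral.integral_sub
        (intervalIntegrable_of_integrableOn_Icc hG hτ ht)
        (intervalIntegrable_of_integrableOn_Icc hH hτ ht)]
      abel) (a := fun t => 2 * a t) (b := fun _ => 0) (ha.const_mul 2)
      (fun t ht => mul_nonneg zero_le_two (ha0 t ht)) integrableOn_zero (fun _ _ => le_rfl) (by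
      filter_upwards [h, ae_restrict_mem measurableSet_Icc] with t h htm
      have hat := ha0 t htm
      rw [zero_add]
      refine (pow_le_pow_iff_left₀ (norm_nonneg _) (by positivity) two_ne_zero).1 ?_
      rw [mul_pow, hJ, norm_toLp_two_sq, norm_toLp_two_sq]
      have h2 := sq_integral_norm_le P (X t - Y t)
      simp only [ContinuousMap.sub_apply] at h2 ⊢
      set c := ∫ o, ‖X t o - Y t o‖ ∂P
      have hc : 0 ≤ c := integral_nonneg fun o => norm_nonneg _
      have i1 : Integrable (fun o => ‖X t o - Y t o‖ ^ 2) P := integrable_continuous P (by fun_prop)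
      calc ∫ o, ‖G t o - H t o‖ ^ 2 ∂P
          ≤ ∫ o, (a t ^ 2 * 2 * ‖X t o - Y t o‖ ^ 2 + a t ^ 2 * 2 * c ^ 2) ∂P := by
            refine integral_mono (integrable_continuous P (by fun_prop))
              ((i1.const_mul _).add (integrable_const _)) fun o => ?_
            calc ‖G t o - H t o‖ ^ 2 ≤ (a t * (‖X t o - Y t o‖ + c)) ^ 2 := by
                  gcongr
                  exact h o
              _ ≤ _ := by
                  have := mul_nonneg (sq_nonneg (a t)) (sq_nonneg (‖X t o - Y t o‖ - c))
                  nlinarith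
        _ = a t ^ 2 * 2 * ∫ o, ‖X t o - Y t o‖ ^ 2 ∂P + a t ^ 2 * 2 * c ^ 2 := by
            rw [integral_add (i1.const_mul _) (integrable_const _), integral_const_mul]
            simp
        _ ≤ (2 * a t) ^ 2 * ∫ o, ‖X t o - Y t o‖ ^ 2 ∂P := by
            have := mul_le_mul_of_nonneg_left h2 (sq_nonneg (a t))
            nlinarith) t ht
  have h2 := pow_le_pow_left₀ (norm_nonneg _) key 2
  rw [hJ, norm_toLp_two_sq] at h2
  simp only [ContinuousMap.sub_apply] at h2
  refine h2.trans (le_of_eq ?_)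
  rw [intervalIntegral.integral_const_mul, mul_pow, mul_pow]
  simp only [intervalIntegral.integral_zero, add_zero]
  rw [norm_toLp_two_sq, ← Real.exp_nat_mul]
  simp only [ContinuousMap.sub_apply]
  push_cast
  ring_nf

/-- The source is quadratic in D, so L¹ is the norm in which it is controlled by E|D|² alone, with
no fourth moment. This is also the norm that bounds W₁. -/
theorem integral_norm_le_of_integral_eq {τ T : ℝ} {Z G : ℝ → C(Ω, Rd d)}
    (hZ : Continuous Z) (hG : IntegrableOn G (Icc τ T))
    (heq : ∀ t ∈ Icc τ T, Z t = ∫ s in τ..t, G s) {a c : ℝ → ℝ}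
    (ha : IntegrableOn a (Icc τ T)) (ha0 : ∀ t ∈ Icc τ T, 0 ≤ a t)
    (hc : IntegrableOn c (Icc τ T)) (hc0 : ∀ t ∈ Icc τ T, 0 ≤ c t) {D : ℝ → C(Ω, Rd d)} {E : ℝ}
    (hD : ∀ t ∈ Icc τ T, ∫ o, ‖D t o‖ ^ 2 ∂P ≤ E)
    (h : ∀ᵐ t ∂volume.restrict (Icc τ T), ∀ o,
      ‖G t o‖ ≤ c t * (‖D t o‖ ^ 2 + ∫ o, ‖D t o‖ ^ 2 ∂P) +
        a t * (‖Z t o‖ + ∫ o, ‖Z t o‖ ∂P)) :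
    ∀ t ∈ Icc τ T, ∫ o, ‖Z t o‖ ∂P ≤
      4 * E * (∫ s in τ..T, c s) * Real.exp (4 * ∫ s in τ..t, a s) := by
  intro t ht
  have hτ : τ ∈ Icc τ T := ⟨le_rfl, ht.1.trans ht.2⟩
  have hE : 0 ≤ E := (integral_nonneg fun o => by positivity).trans (hD t ht)
  set J := ContinuousMap.toLp (E := Rd d) 1 P ℝ with hJ
  have key := norm_clm_le_of_integral_eq J (X₀ := 0) hZ hG (fun t ht => by rw [heq t ht, zero_add])
      (a := fun t => 2 * a t) (b := fun t => 2 * E * c t) (ha.const_mul 2)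
      (fun t ht => mul_nonneg zero_le_two (ha0 t ht)) (hc.const_mul _)
      (fun t ht => mul_nonneg (by positivity) (hc0 t ht)) (by
      filter_upwards [h, ae_restrict_mem measurableSet_Icc] with t h htm
      have hct := hc0 t htm
      have hEt := hD t htm
      rw [hJ, norm_toLp_one, norm_toLp_one]
      have i1 : Integrable (fun o => ‖D t o‖ ^ 2) P := integrable_continuous P (by fun_prop)
      have i2 : Integrable (fun o => ‖Z t o‖) P := integrable_continuous P (by fun_prop)
      set q := ∫ o, ‖D t o‖ ^ 2 ∂P with hq
      set z := ∫ o, ‖Z t o‖ ∂P with hz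
      have i3 : Integrable (fun o => c t * (‖D t o‖ ^ 2 + q)) P :=
        (i1.add (integrable_const q)).const_mul _
      have i4 : Integrable (fun o => a t * (‖Z t o‖ + z)) P :=
        (i2.add (integrable_const z)).const_mul _
      calc ∫ o, ‖G t o‖ ∂P ≤ ∫ o, (c t * (‖D t o‖ ^ 2 + q) + a t * (‖Z t o‖ + z)) ∂P :=
            integral_mono (integrable_continuous P (by fun_prop)) (i3.add i4) h
        _ = c t * (q + q) + a t * (z + z) := by
            rw [integral_add i3 i4, integral_const_mul, integral_const_mul,
              integral_add i1 (integrable_const q), integral_add i2 (integrable_const z)]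
            simp [← hq, ← hz]
        _ ≤ c t * (E + E) + a t * (z + z) := by gcongr
        _ = _ := by ring) t ht
  rw [hJ, norm_toLp_one] at key
  refine key.trans (le_of_eq ?_)
  rw [intervalIntegral.integral_const_mul, intervalIntegral.integral_const_mul, map_zero, norm_zero]
  ring_nf

end Stability

/-! ### Interpolation along curves and uniform bounds -/

section Semiconcavity

variable {d : ℕ} {U : Type*} [MetricSpace U] [CompactSpace U]
  {T : ℝ} {m : ℝ → ℝ} {l L : ℝ → ℝ → ℝ} {v : ℝ → Pc d → U → Rd d → Rd d}
  {Ω : Type*} [MetricSpace Ω] [CompactSpace Ω] [MeasurableSpace Ω] [BorelSpace Ω]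
  (P : Measure Ω) [IsProbabilityMeasure P]

theorem UniformField.continuous_along_law (h : UniformField T m l L v) {τ R : ℝ}
    {X : ℝ → C(Ω, Rd d)} (hX : Continuous X) (hR : ∀ t ∈ Icc τ T, ‖X t‖ ≤ R) :
    ∀ᵐ t ∂volume.restrict (Icc 0 T), Continuous fun p : (Icc τ T × Ω) × U =>
      v t (law P (X p.1.1)) p.2 (X p.1.1 p.1.2) := by
  have hc : Continuous fun q : Icc τ T × Ω => X q.1 :=
    hX.comp (continuous_subtype_val.comp continuous_fst)
  refine h.continuous_along (S := Icc τ T × Ω) (N := fun q => law P (X q.1))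
    (x := fun q => X q.1 q.2) (R := R) (fun q => law_livesOn P (hR _ q.1.2)) (fun q => ?_) ?_
    fun q => ((X q.1).norm_coe_le_norm _).trans (hR _ q.1.2)
  · refine squeeze_zero (fun _ => wasserstein_nonneg _ _ _)
      (fun q' => wasserstein_law_le_norm P (X q'.1) (X q.1)) ?_
    have := ((hc.sub (continuous_const (y := X q.1))).norm).tendsto q
    simpa using this
  · exact hc.eval continuous_snd

/-- In the hypothesis the null set depends on the control, the plan and the points. Both sides are
continuous in (q, o, u) on the separable space [τ,T] × Ω × U, where q is a frozen time of the curves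
independent of t. One null set therefore suffices, and q = t, u = u(t) may be substituted
afterwards. -/
theorem UniformField.interpolation_along (h : UniformField T m l L v) {R : ℝ} {C : ℝ → ℝ}
    (hC : ∀ u : U, ∀ μ₁ μ₂ : Pc d,
      μ₁.LivesOn (ball0 d R) → μ₂.LivesOn (ball0 d R) → ∀ γ : transportPlans μ₁ μ₂,
      ∀ x ∈ ball0 d R, ∀ y ∈ ball0 d R,
      ∀ᵐ t ∂volume.restrict (Icc 0 T), ∀ s ∈ Icc (0 : ℝ) 1,
        ‖(1 - s) • v t μ₁ u x + s • v t μ₂ u y - v t (interp γ s) u ((1 - s) • x + s • y)‖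
          ≤ C t * (s * (1 - s)) * (‖x - y‖ ^ 2 + planCost 2 γ.1 ^ 2))
    {τ : ℝ} {X Y Z : ℝ → C(Ω, Rd d)} (hX : Continuous X) (hY : Continuous Y)
    (hXR : ∀ t ∈ Icc τ T, ‖X t‖ ≤ R) (hYR : ∀ t ∈ Icc τ T, ‖Y t‖ ≤ R) {s : ℝ}
    (hs : s ∈ Icc (0 : ℝ) 1) (hZ : ∀ t, Z t = (1 - s) • X t + s • Y t)
    (hZR : ∀ t ∈ Icc τ T, ‖Z t‖ ≤ R) :
    ∀ᵐ t ∂volume.restrict (Icc 0 T), ∀ q ∈ Icc τ T, ∀ (u : U) (o : Ω),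
      ‖(1 - s) • v t (law P (X q)) u (X q o) + s • v t (law P (Y q)) u (Y q o)
        - v t (law P (Z q)) u (Z q o)‖ ≤
        C t * (s * (1 - s)) * (‖X q o - Y q o‖ ^ 2 + ∫ o, ‖X q o - Y q o‖ ^ 2 ∂P) := by
  have hZc : Continuous Z := by
    rw [funext hZ]
    exact (hX.const_smul (1 - s)).add (hY.const_smul s)
  have key := ae_forall_of_forall_ae (μ := volume.restrict (Icc 0 T)) (S := (Icc τ T × Ω) × U)
    (p := fun t p => ‖(1 - s) • v t (law P (X p.1.1)) p.2 (X p.1.1 p.1.2) +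
        s • v t (law P (Y p.1.1)) p.2 (Y p.1.1 p.1.2)
        - v t (law P (Z p.1.1)) p.2 (Z p.1.1 p.1.2)‖ ≤
        C t * (s * (1 - s)) * (‖X p.1.1 p.1.2 - Y p.1.1 p.1.2‖ ^ 2 +
          ∫ o, ‖X p.1.1 o - Y p.1.1 o‖ ^ 2 ∂P)) ?_ ?_
  · filter_upwards [key] with t ht q hq u o
    exact ht ((⟨q, hq⟩, o), u)
  · filter_upwards [h.continuous_along_law P hX hXR, h.continuous_along_law P hY hYR,
      h.continuous_along_law P hZc hZR] with t h1 h2 h3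
    have hev : ∀ {X : ℝ → C(Ω, Rd d)}, Continuous X →
        Continuous fun p : (Icc τ T × Ω) × U => X p.1.1 := fun hX =>
      hX.comp (continuous_subtype_val.comp (continuous_fst.comp continuous_fst))
    have hsnd : Continuous fun p : (Icc τ T × Ω) × U => p.1.2 := continuous_snd.comp continuous_fst
    have hint : Continuous fun p : (Icc τ T × Ω) × U => ∫ o, ‖X p.1.1 o - Y p.1.1 o‖ ^ 2 ∂P := by
      have e : ∀ p : (Icc τ T × Ω) × U, ∫ o, ‖X p.1.1 o - Y p.1.1 o‖ ^ 2 ∂P =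
          ‖ContinuousMap.toLp (E := Rd d) 2 P ℝ (X p.1.1 - Y p.1.1)‖ ^ 2 := fun p => by
        rw [norm_toLp_two_sq]
        rfl
      simp only [e]
      exact (((ContinuousMap.toLp (E := Rd d) 2 P ℝ).continuous.comp
        ((hev hX).sub (hev hY))).norm).pow 2
    have hXo : Continuous fun p : (Icc τ T × Ω) × U => X p.1.1 p.1.2 := (hev hX).eval hsnd
    have hYo : Continuous fun p : (Icc τ T × Ω) × U => Y p.1.1 p.1.2 := (hev hY).eval hsnd
    refine isClosed_le ?_ ?_
    · exact (((h1.const_smul (1 - s)).add (h2.const_smul s)).sub h3).norm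
    · exact continuous_const.mul (((hXo.sub hYo).norm.pow 2).add hint)
  · rintro ⟨⟨⟨q, hq⟩, o⟩, u⟩
    have hmem : ∀ {X : ℝ → C(Ω, Rd d)}, ‖X q‖ ≤ R → X q o ∈ ball0 d R := fun hX =>
      mem_closedBall_zero_iff.2 (((_ : C(Ω, Rd d)).norm_coe_le_norm _).trans hX)
    filter_upwards [hC u (law P (X q)) (law P (Y q)) (law_livesOn P (hXR q hq))
      (law_livesOn P (hYR q hq)) (jointPlan P (X q) (Y q)) (X q o) (hmem (hXR q hq)) (Y q o)
      (hmem (hYR q hq))] with t ht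
    have := ht s hs
    rw [interp_jointPlan, planCost_two_jointPlan_sq, ← hZ] at this
    simpa [hZ] using this

theorem integral_le_of_Icc {f : ℝ → ℝ} (hf : IntegrableOn f (Icc 0 T))
    (hf0 : ∀ t ∈ Icc 0 T, 0 ≤ f t) {τ t : ℝ} (hτ : τ ∈ Icc 0 T) (ht : t ∈ Icc τ T) :
    ∫ r in τ..t, f r ≤ ∫ r in 0..T, f r := by
  have hT : T ∈ Icc 0 T := ⟨hτ.1.trans hτ.2, le_rfl⟩
  have ht' : t ∈ Icc 0 T := ⟨hτ.1.trans ht.1, ht.2⟩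
  have h0 : (0 : ℝ) ∈ Icc 0 T := ⟨le_rfl, hτ.1.trans hτ.2⟩
  have h1 := intervalIntegral.integral_add_adjacent_intervals
    (intervalIntegrable_of_integrableOn_Icc hf h0 hτ)
    (intervalIntegrable_of_integrableOn_Icc hf hτ ht')
  have h2 := primitive_nonneg hf0 hτ
  have h3 := primitive_mono hf hf0 ht' hT ht.2
  linarith

theorem UniformField.norm_lagrangian_le [MeasurableSpace U] [BorelSpace U]
    (h : UniformField T m l L v) {u : ℝ → U}
    (hu : AEMeasurable u (volume.restrict (Icc 0 T))) {τ r : ℝ} (hτ : τ ∈ Icc 0 T)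
    {X₀ : C(Ω, Rd d)} (hX₀ : ‖X₀‖ ≤ r) {X : ℝ → C(Ω, Rd d)} (hX : Continuous X)
    (heq : ∀ t ∈ Icc τ T, X t = X₀ +
      ∫ s in τ..t, fieldOn (fun t ν x => v t ν (u t) x) s (law P (X s)) (X s)) :
    ∀ t ∈ Icc τ T, ‖X t‖ ≤ 2 * (1 + r) * Real.exp (4 * ∫ s in 0..T, m s) := by
  intro t ht
  have hr : 0 ≤ r := (norm_nonneg _).trans hX₀
  refine ((h.lipField hu hτ).norm_lagrangian_le P hX heq t ht).trans ?_
  have := integral_le_of_Icc h.growth_integrable.1 h.growth_integrable.2 hτ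
    (t := T) ⟨hτ.2, le_rfl⟩
  gcongr

end Semiconcavity

/-! ### Comparison of costs and the value function -/

section Semiconcavity

variable {d : ℕ} {U : Type*} [MetricSpace U] [CompactSpace U] [MeasurableSpace U] [BorelSpace U]
  {T : ℝ} {m : ℝ → ℝ} {l L : ℝ → ℝ → ℝ} {v : ℝ → Pc d → U → Rd d → Rd d} {φ : Pc d → ℝ}

theorem UniformField.exists_mem_attainableCosts {Ω : Type*} [MetricSpace Ω] [CompactSpace Ω]
    [MeasurableSpace Ω] [BorelSpace Ω] (P : Measure Ω) [IsProbabilityMeasure P]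
    (h : UniformField T m l L v) (φ : Pc d → ℝ)
    {u : ℝ → U} (hu : AEMeasurable u (volume.restrict (Icc 0 T))) {τ : ℝ} (hτ : τ ∈ Icc 0 T)
    (X₀ : C(Ω, Rd d)) :
    ∃ X : ℝ → C(Ω, Rd d), Continuous X ∧
      IntegrableOn (fun t => fieldOn (fun t ν x => v t ν (u t) x) t (law P (X t)) (X t))
        (Icc τ T) ∧
      (∀ t ∈ Icc τ T, X t = X₀ +
        ∫ s in τ..t, fieldOn (fun t ν x => v t ν (u t) x) s (law P (X s)) (X s)) ∧
      φ (law P (X T)) ∈ attainableCosts T v φ τ (law P X₀) := by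
  have hF := h.lipField hu hτ
  obtain ⟨X, hX, hint, heq⟩ := hF.exists_lagrangian P hτ.2 X₀
  exact ⟨X, hX, hint, heq, u, _, hu, hF.solvesCE_law P hτ.2 hX hint heq, rfl⟩

/-- M = (1 - s)X + sY and Z have the same initial value. Their velocities differ by the
interpolation defect, quadratic in X - Y, plus a term that is Lipschitz in M - Z; Grönwall in L¹
concludes. -/
theorem UniformField.integral_norm_interpolation_sub_le {Ω : Type*} [MetricSpace Ω]
    [CompactSpace Ω] [MeasurableSpace Ω] [BorelSpace Ω] (P : Measure Ω) [IsProbabilityMeasure P]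
    (h : UniformField T m l L v) {R : ℝ} (hR : 0 < R) {C : ℝ → ℝ} (hCi : IsL1Nonneg T C)
    (hC : ∀ u : U, ∀ μ₁ μ₂ : Pc d,
      μ₁.LivesOn (ball0 d R) → μ₂.LivesOn (ball0 d R) → ∀ γ : transportPlans μ₁ μ₂,
      ∀ x ∈ ball0 d R, ∀ y ∈ ball0 d R,
      ∀ᵐ t ∂volume.restrict (Icc 0 T), ∀ s ∈ Icc (0 : ℝ) 1,
        ‖(1 - s) • v t μ₁ u x + s • v t μ₂ u y - v t (interp γ s) u ((1 - s) • x + s • y)‖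
          ≤ C t * (s * (1 - s)) * (‖x - y‖ ^ 2 + planCost 2 γ.1 ^ 2))
    {u : ℝ → U} (hu : AEMeasurable u (volume.restrict (Icc 0 T))) {τ : ℝ} (hτ : τ ∈ Icc 0 T)
    {s : ℝ} (hs : s ∈ Icc (0 : ℝ) 1) {X Y Z : ℝ → C(Ω, Rd d)} {X₀ Y₀ : C(Ω, Rd d)}
    (hX : Continuous X) (hY : Continuous Y) (hZ : Continuous Z)
    (hXR : ∀ t ∈ Icc τ T, ‖X t‖ ≤ R) (hYR : ∀ t ∈ Icc τ T, ‖Y t‖ ≤ R)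
    (hZR : ∀ t ∈ Icc τ T, ‖Z t‖ ≤ R) {w : ℝ → Pc d → Rd d → Rd d}
    (hw : w = fun t ν x => v t ν (u t) x)
    (hXi : IntegrableOn (fun t => fieldOn w t (law P (X t)) (X t)) (Icc τ T))
    (hYi : IntegrableOn (fun t => fieldOn w t (law P (Y t)) (Y t)) (Icc τ T))
    (hZi : IntegrableOn (fun t => fieldOn w t (law P (Z t)) (Z t)) (Icc τ T))
    (hXe : ∀ t ∈ Icc τ T, X t = X₀ + ∫ r in τ..t, fieldOn w r (law P (X r)) (X r))
    (hYe : ∀ t ∈ Icc τ T, Y t = Y₀ + ∫ r in τ..t, fieldOn w r (law P (Y r)) (Y r))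
    (hZe : ∀ t ∈ Icc τ T, Z t = ((1 - s) • X₀ + s • Y₀) +
      ∫ r in τ..t, fieldOn w r (law P (Z r)) (Z r)) {E : ℝ}
    (hE : ∀ t ∈ Icc τ T, ∫ o, ‖X t o - Y t o‖ ^ 2 ∂P ≤ E) :
    ∫ o, ‖((1 - s) • X T + s • Y T - Z T) o‖ ∂P ≤
      4 * (s * (1 - s) * E) * (∫ t in 0..T, C t) * Real.exp (4 * ∫ t in 0..T, (l R t + L R t)) := by
  have hs1 : 0 ≤ 1 - s := sub_nonneg.2 hs.2
  have hs0 := hs.1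
  have hle : Icc τ T ⊆ Icc 0 T := Icc_subset_Icc hτ.1 le_rfl
  have hmle : volume.restrict (Icc τ T) ≤ volume.restrict (Icc 0 T) :=
    Measure.restrict_mono hle le_rfl
  have hF := h.lipField hu hτ
  rw [← hw] at hF
  set M : ℝ → C(Ω, Rd d) := fun t => (1 - s) • X t + s • Y t with hM
  have hMc : Continuous M := (hX.const_smul (1 - s)).add (hY.const_smul s)
  have hMR : ∀ t ∈ Icc τ T, ‖M t‖ ≤ R := fun t ht => by
    calc ‖(1 - s) • X t + s • Y t‖ ≤ (1 - s) * ‖X t‖ + s * ‖Y t‖ := by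
          refine (norm_add_le _ _).trans (le_of_eq ?_)
          rw [norm_smul, norm_smul, Real.norm_of_nonneg hs1, Real.norm_of_nonneg hs0]
      _ ≤ (1 - s) * R + s * R := by gcongr; exacts [hXR t ht, hYR t ht]
      _ = R := by ring
  have hτ' : τ ∈ Icc τ T := ⟨le_rfl, hτ.2⟩
  have hT' : T ∈ Icc τ T := ⟨hτ.2, le_rfl⟩
  have hsum : IsL1Nonneg T fun t => l R t + L R t :=
    ⟨(h.space_integrable R hR).1.add (h.measure_integrable R hR).1, fun t ht =>
      add_nonneg ((h.space_integrable R hR).2 t ht) ((h.measure_integrable R hR).2 t ht)⟩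
  have hE0 : 0 ≤ E := (integral_nonneg fun o => by positivity).trans (hE T hT')
  have hc0 : 0 ≤ ∫ t in τ..T, C t := primitive_nonneg (fun t ht => hCi.2 t (hle ht)) hT'
  have key := integral_norm_le_of_integral_eq P (Z := fun t => M t - Z t)
    (G := fun t => (1 - s) • fieldOn w t (law P (X t)) (X t) +
      s • fieldOn w t (law P (Y t)) (Y t) - fieldOn w t (law P (Z t)) (Z t))
    (hMc.sub hZ) (((hXi.smul (1 - s)).add (hYi.smul s)).sub hZi) (fun t ht => by
      have i1 := intervalIntegrable_of_integrableOn_Icc hXi hτ' ht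
      have i2 := intervalIntegrable_of_integrableOn_Icc hYi hτ' ht
      have i3 := intervalIntegrable_of_integrableOn_Icc hZi hτ' ht
      have j1 : IntervalIntegrable (fun r => (1 - s) • fieldOn w r (law P (X r)) (X r))
        volume τ t := i1.smul (1 - s)
      have j2 : IntervalIntegrable (fun r => s • fieldOn w r (law P (Y r)) (Y r))
        volume τ t := i2.smul s
      rw [intervalIntegral.integral_sub (j1.add j2) i3, intervalIntegral.integral_add j1 j2,
        intervalIntegral.integral_smul, intervalIntegral.integral_smul]
      simp only [hM]
      rw [hXe t ht, hYe t ht, hZe t ht]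
      module)
    (a := fun t => l R t + L R t) (c := fun t => s * (1 - s) * C t)
    (hsum.1.mono_set hle) (fun t ht => hsum.2 t (hle ht))
    ((hCi.1.mono_set hle).const_mul _)
    (fun t ht => mul_nonneg (mul_nonneg hs0 hs1) (hCi.2 t (hle ht)))
    (D := fun t => X t - Y t) hE (by
      filter_upwards [hF.fieldOn_apply (Ω := Ω), hF.norm_fieldOn_sub_le (Ω := Ω) hR,
        ae_mono hmle (h.interpolation_along P hC hX hY hXR hYR hs (fun _ => rfl) hMR),
        ae_restrict_mem measurableSet_Icc] with t hap hsub hint htm o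
      have hl := (h.space_integrable R hR).2 t (hle htm)
      have hL := (h.measure_integrable R hR).2 t (hle htm)
      have h1 := hint t htm (u t) o
      have h2 := hsub (law P (M t)) (law P (Z t)) (M t) (Z t) (law_livesOn P (hMR t htm))
        (law_livesOn P (hZR t htm)) (hMR t htm) (hZR t htm) o
      have h3 := wasserstein_law_le P (M t) (Z t)
      have h4 : fieldOn w t (law P (M t)) (M t) o = v t (law P (M t)) (u t) (M t o) := by
        rw [hap, hw]
      have h5 : fieldOn w t (law P (X t)) (X t) o = v t (law P (X t)) (u t) (X t o) := by
        rw [hap, hw]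
      have h6 : fieldOn w t (law P (Y t)) (Y t) o = v t (law P (Y t)) (u t) (Y t o) := by
        rw [hap, hw]
      simp only [ContinuousMap.sub_apply, ContinuousMap.add_apply, ContinuousMap.smul_apply]
      change ‖(1 - s) • fieldOn w t (law P (X t)) (X t) o + s • fieldOn w t (law P (Y t)) (Y t) o
        - fieldOn w t (law P (Z t)) (Z t) o‖ ≤ _ * _ + _ * (‖M t o - Z t o‖ + _)
      set W := ∫ o, ‖M t o - Z t o‖ ∂P with hW
      have hW0 : 0 ≤ W := integral_nonneg fun o => norm_nonneg _
      calc _ = ‖((1 - s) • fieldOn w t (law P (X t)) (X t) o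
              + s • fieldOn w t (law P (Y t)) (Y t) o - fieldOn w t (law P (M t)) (M t) o)
            + (fieldOn w t (law P (M t)) (M t) o - fieldOn w t (law P (Z t)) (Z t) o)‖ := by
            congr 1; abel
        _ ≤ C t * (s * (1 - s)) * (‖X t o - Y t o‖ ^ 2 + ∫ o, ‖X t o - Y t o‖ ^ 2 ∂P)
            + (l R t * ‖M t o - Z t o‖ + L R t * W) := by
            refine (norm_add_le _ _).trans (add_le_add ?_ (h2.trans ?_))
            · rw [h4, h5, h6]
              exact h1
            · gcongr
        _ ≤ s * (1 - s) * C t * (‖X t o - Y t o‖ ^ 2 + ∫ o, ‖X t o - Y t o‖ ^ 2 ∂P)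
            + (l R t + L R t) * (‖M t o - Z t o‖ + W) := by
            have e1 := mul_nonneg hl hW0
            have e2 := mul_nonneg hL (norm_nonneg (M t o - Z t o))
            nlinarith) T hT'
  refine key.trans ?_
  rw [intervalIntegral.integral_const_mul]
  have h1 := integral_le_of_Icc hCi.1 hCi.2 hτ hT'
  have h2 := integral_le_of_Icc hsum.1 hsum.2 hτ hT'
  have h3 := hc0.trans h1
  calc 4 * E * (s * (1 - s) * ∫ t in τ..T, C t) * Real.exp (4 * ∫ t in τ..T, (l R t + L R t))
      ≤ 4 * E * (s * (1 - s) * ∫ t in 0..T, C t) *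
          Real.exp (4 * ∫ t in 0..T, (l R t + L R t)) := by gcongr
    _ = _ := by ring

/-- Each trajectory from the interpolation is compared with two trajectories driven by the same
control, started from the endpoints of the plan. The infimum is taken only afterwards, so optimal
controls play no role. -/
theorem exists_semiconcavity_bound (h : UniformField T m l L v) (hO : OCP T v φ)
    (hSC : SC2 T v φ) {r : ℝ} (hr : 0 < r) :
    ∃ C > 0, ∀ τ ∈ Icc 0 T, ∀ μ₁ μ₂ : Pc d, μ₁.LivesOn (ball0 d r) → μ₂.LivesOn (ball0 d r) →
      ∀ s ∈ Icc (0 : ℝ) 1, ∀ γ : transportPlans μ₁ μ₂, ∀ c ∈ attainableCosts T v φ τ (interp γ s),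
        ∃ c₁ ∈ attainableCosts T v φ τ μ₁, ∃ c₂ ∈ attainableCosts T v φ τ μ₂,
          (1 - s) * c₁ + s * c₂ - c ≤ C * (s * (1 - s)) * planCost 2 γ.1 ^ 2 := by
  -- This radius bounds all Lagrangian curves started in B(0, r), uniformly in the control and in τ;
  -- the constants of the data are then taken on this larger ball.
  set R := 2 * (1 + r) * Real.exp (4 * ∫ s in 0..T, m s) with hRdef
  have hR : 0 < R := by positivity
  obtain ⟨C, hCi, hC⟩ := hSC.velocity R hR
  obtain ⟨C₁, hC₁, hcost⟩ := hSC.cost R hR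
  obtain ⟨C₂, hlip⟩ := hO.cost_lipschitz R hR
  set A := ∫ t in 0..T, (l R t + L R t) with hA
  set I := |∫ t in 0..T, C t| with hI
  -- The first term is the semiconcavity of φ times the L² stability constant; the second is the
  -- Lipschitz constant of φ times the L¹ bound on M(T) - Z(T).
  refine ⟨C₁ * (4 * Real.exp (8 * A)) +
    |C₂| * (4 * (4 * Real.exp (8 * A)) * I * Real.exp (4 * A)), by positivity, ?_⟩
  rintro τ hτ μ₁ μ₂ hμ₁ hμ₂ s hs γ c ⟨u, μ, hu, hμ, rfl⟩
  obtain ⟨P, hP, X₀, Y₀, hX₀, hY₀, rfl, rfl, hγ⟩ := exists_jointPlan_eq hμ₁ hμ₂ γ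
  rw [max_eq_left hr.le] at hX₀ hY₀
  have hs1 : 0 ≤ 1 - s := sub_nonneg.2 hs.2
  have hs0 := hs.1
  have hT' : T ∈ Icc τ T := ⟨hτ.2, le_rfl⟩
  have hle : Icc τ T ⊆ Icc 0 T := Icc_subset_Icc hτ.1 le_rfl
  have hZ₀ : ‖(1 - s) • X₀ + s • Y₀‖ ≤ r := by
    calc ‖(1 - s) • X₀ + s • Y₀‖ ≤ (1 - s) * ‖X₀‖ + s * ‖Y₀‖ := by
          refine (norm_add_le _ _).trans (le_of_eq ?_)
          rw [norm_smul, norm_smul, Real.norm_of_nonneg hs1, Real.norm_of_nonneg hs0]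
      _ ≤ (1 - s) * r + s * r := by gcongr
      _ = r := by ring
  have hinterp : interp γ s = law P ((1 - s) • X₀ + s • Y₀) := by
    rw [← interp_jointPlan]
    exact Subtype.ext (by simp only [interp, hγ])
  rw [hinterp] at hμ
  have hF := h.lipField hu hτ
  obtain ⟨X, hX, hXi, hXe, hXc⟩ := h.exists_mem_attainableCosts P φ hu hτ X₀
  obtain ⟨Y, hY, hYi, hYe, hYc⟩ := h.exists_mem_attainableCosts P φ hu hτ Y₀
  obtain ⟨Z, hZ, hZi, hZe, hZμ⟩ := hμ.exists_lagrangian P hF hτ.2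
  have hXR := h.norm_lagrangian_le P hu hτ hX₀ hX hXe
  have hYR := h.norm_lagrangian_le P hu hτ hY₀ hY hYe
  have hZR := h.norm_lagrangian_le P hu hτ hZ₀ hZ hZe
  rw [← hRdef] at hXR hYR hZR
  refine ⟨_, hXc, _, hYc, ?_⟩
  rw [hZμ T hT']
  have hsum : IsL1Nonneg T fun t => l R t + L R t :=
    ⟨(h.space_integrable R hR).1.add (h.measure_integrable R hR).1, fun t ht =>
      add_nonneg ((h.space_integrable R hR).2 t ht) ((h.measure_integrable R hR).2 t ht)⟩
  have hpc : planCost 2 γ.1 ^ 2 = ∫ o, ‖X₀ o - Y₀ o‖ ^ 2 ∂P := by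
    rw [← hγ, planCost_two_jointPlan_sq]
  set q := planCost 2 γ.1 ^ 2 with hq
  have hq0 : 0 ≤ q := sq_nonneg _
  set E := 4 * Real.exp (8 * A) * q with hEdef
  have hE : ∀ t ∈ Icc τ T, ∫ o, ‖X t o - Y t o‖ ^ 2 ∂P ≤ E := by
    intro t ht
    have h1 := integral_norm_sq_sub_le P hX hY hXi hYi hXe hYe (hsum.1.mono_set hle)
      (fun t ht => hsum.2 t (hle ht)) (by
        filter_upwards [hF.norm_fieldOn_sub_le (Ω := BallSpace d r × BallSpace d r) hR,
          ae_restrict_mem measurableSet_Icc] with t hsub htm o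
        have hl := (h.space_integrable R hR).2 t (hle htm)
        have hL := (h.measure_integrable R hR).2 t (hle htm)
        have hW := wasserstein_law_le P (X t) (Y t)
        refine (hsub _ _ (X t) (Y t) (law_livesOn P (hXR t htm)) (law_livesOn P (hYR t htm))
          (hXR t htm) (hYR t htm) o).trans ?_
        set W := ∫ o, ‖X t o - Y t o‖ ∂P
        have hW0 : 0 ≤ W := integral_nonneg fun o => norm_nonneg _
        have e1 := mul_nonneg hl hW0
        have e2 := mul_nonneg hL (norm_nonneg (X t o - Y t o))
        have e3 := mul_le_mul_of_nonneg_left hW hL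
        nlinarith) t ht
    refine h1.trans ?_
    have h2 := integral_le_of_Icc hsum.1 hsum.2 hτ ht
    rw [← hpc]
    calc 4 * q * Real.exp (8 * ∫ t in τ..t, (l R t + L R t)) ≤ 4 * q * Real.exp (8 * A) := by gcongr
      _ = E := by rw [hEdef]; ring
  have hWle := h.integral_norm_interpolation_sub_le P hR hCi hC hu hτ hs hX hY hZ hXR hYR hZR rfl
    hXi hYi hZi hXe hYe hZe hE
  have hMR : ‖(1 - s) • X T + s • Y T‖ ≤ R := by
    calc ‖(1 - s) • X T + s • Y T‖ ≤ (1 - s) * ‖X T‖ + s * ‖Y T‖ := by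
          refine (norm_add_le _ _).trans (le_of_eq ?_)
          rw [norm_smul, norm_smul, Real.norm_of_nonneg hs1, Real.norm_of_nonneg hs0]
      _ ≤ (1 - s) * R + s * R := by gcongr; exacts [hXR T hT', hYR T hT']
      _ = R := by ring
  -- The plan used at time T is the joint law of X(T) and Y(T), in general not optimal; this is why
  -- semiconcavity along arbitrary plans is needed.
  have h1 := hcost _ _ (law_livesOn P (hXR T hT')) (law_livesOn P (hYR T hT'))
    (jointPlan P (X T) (Y T)) s hs
  rw [interp_jointPlan, planCost_two_jointPlan_sq] at h1
  have h2 := hlip _ _ (law_livesOn P hMR) (law_livesOn P (hZR T hT'))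
  have h3 := wasserstein_law_le P ((1 - s) • X T + s • Y T) (Z T)
  have h4 := wasserstein_nonneg 1 (law P ((1 - s) • X T + s • Y T)) (law P (Z T))
  have hss : 0 ≤ s * (1 - s) := mul_nonneg hs0 hs1
  have hE0 : 0 ≤ E := by positivity
  have h5 : C₂ * wasserstein 1 (law P ((1 - s) • X T + s • Y T)) (law P (Z T)) ≤
      |C₂| * (4 * (s * (1 - s) * E) * I * Real.exp (4 * A)) := by
    calc _ ≤ |C₂| * wasserstein 1 (law P ((1 - s) • X T + s • Y T)) (law P (Z T)) := by
          gcongr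
          exact le_abs_self _
      _ ≤ _ := by
          gcongr
          refine h3.trans (hWle.trans ?_)
          gcongr
          exact le_abs_self _
  have h6 : C₁ * (s * (1 - s)) * ∫ o, ‖X T o - Y T o‖ ^ 2 ∂P ≤ C₁ * (s * (1 - s)) * E := by
    gcongr
    exact hE T hT'
  have h7 := (le_abs_self _).trans h2
  calc _ ≤ C₁ * (s * (1 - s)) * E + |C₂| * (4 * (s * (1 - s) * E) * I * Real.exp (4 * A)) := by
        linarith
    _ = _ := by rw [hEdef]; ring

theorem attainableCosts_nonempty [Nonempty U] (h : UniformField T m l L v) (φ : Pc d → ℝ)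
    {τ : ℝ} (hτ : τ ∈ Icc 0 T) (μ : Pc d) : (attainableCosts T v φ τ μ).Nonempty := by
  obtain ⟨R, _, hμ⟩ := μ.exists_livesOn
  obtain ⟨P, hP, rfl⟩ := exists_law_ballIncl hμ
  obtain ⟨X, -, -, -, hc⟩ := h.exists_mem_attainableCosts P φ
    (u := fun _ => Classical.arbitrary U) aemeasurable_const hτ (ballIncl d R)
  exact ⟨_, hc⟩

/-- By the Lagrangian representation all terminal measures live on one ball, where φ is
W₁-Lipschitz; they are compared with the Dirac mass at 0, the law of the zero variable. -/
theorem attainableCosts_bddBelow (h : UniformField T m l L v) (hO : OCP T v φ)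
    {τ : ℝ} (hτ : τ ∈ Icc 0 T) (μ : Pc d) : BddBelow (attainableCosts T v φ τ μ) := by
  obtain ⟨r, hr, hμ⟩ := μ.exists_livesOn
  obtain ⟨P, hP, rfl⟩ := exists_law_ballIncl hμ
  have hι : ‖ballIncl d r‖ ≤ r :=
    (ContinuousMap.norm_le _ hr.le).2 fun x => mem_closedBall_zero_iff.1 x.2
  set R := 2 * (1 + r) * Real.exp (4 * ∫ s in 0..T, m s) with hRdef
  have hR : 0 < R := by positivity
  obtain ⟨C, hlip⟩ := hO.cost_lipschitz R hR
  have h0 : ∀ {X : C(BallSpace d r, Rd d)}, X = 0 → ‖X‖ ≤ R := by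
    rintro X rfl
    simpa using hR.le
  refine ⟨φ (law P (0 : C(BallSpace d r, Rd d))) - |C| * R, ?_⟩
  rintro c ⟨u, ν, hu, hν, rfl⟩
  have hF := h.lipField hu hτ
  obtain ⟨X, hX, -, hXe, hXν⟩ := hν.exists_lagrangian P hF hτ.2
  have hXR := h.norm_lagrangian_le P hu hτ hι hX hXe T ⟨hτ.2, le_rfl⟩
  rw [hXν T ⟨hτ.2, le_rfl⟩]
  have h1 := (le_abs_self _).trans
    (hlip _ _ (law_livesOn P (h0 rfl)) (law_livesOn P hXR))
  have h2 : wasserstein 1 (law P (0 : C(BallSpace d r, Rd d))) (law P (X T)) ≤ R :=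
    (wasserstein_law_le_norm P _ _).trans (by simpa using hXR)
  have h3 : C * wasserstein 1 (law P (0 : C(BallSpace d r, Rd d))) (law P (X T)) ≤ |C| * R := by
    refine (mul_le_mul_of_nonneg_right (le_abs_self C) (wasserstein_nonneg _ _ _)).trans ?_
    gcongr
  linarith

end Semiconcavity

end MeanField

theorem mainTheorem2 {d : ℕ} {U : Type*} [MetricSpace U] [CompactSpace U] [Nonempty U]
    [MeasurableSpace U] [BorelSpace U] (T : ℝ) (hT : 0 < T)
    (v : ℝ → MeanField.Pc d → U → MeanField.Rd d → MeanField.Rd d) (φ : MeanField.Pc d → ℝ)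
    (hOCP : MeanField.OCP T v φ) (hSC2 : MeanField.SC2 T v φ) :
    (∀ τ ∈ Icc 0 T, ∀ μ : MeanField.Pc d,
      IsGLB (MeanField.attainableCosts T v φ τ μ) (MeanField.valueFunction T v φ τ μ)) ∧
    ∀ r > 0, ∃ C > 0, ∀ τ ∈ Icc 0 T, ∀ μ₁ μ₂ : MeanField.Pc d,
      μ₁.LivesOn (MeanField.ball0 d r) → μ₂.LivesOn (MeanField.ball0 d r) →
      ∀ s ∈ Icc (0 : ℝ) 1, ∀ γ : MeanField.transportPlans μ₁ μ₂,
        (1 - s) * MeanField.valueFunction T v φ τ μ₁ + s * MeanField.valueFunction T v φ τ μ₂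
            - MeanField.valueFunction T v φ τ (MeanField.interp γ s)
          ≤ C * (s * (1 - s)) * MeanField.planCost 2 γ.1 ^ 2 := by
  obtain ⟨m, l, L, h⟩ := hOCP.exists_uniformField
  have hglb : ∀ τ ∈ Icc 0 T, ∀ μ : MeanField.Pc d,
      IsGLB (MeanField.attainableCosts T v φ τ μ) (MeanField.valueFunction T v φ τ μ) :=
    fun τ hτ μ => isGLB_csInf (MeanField.attainableCosts_nonempty h φ hτ μ)
      (MeanField.attainableCosts_bddBelow h hOCP hτ μ)
  refine ⟨hglb, fun r hr => ?_⟩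
  obtain ⟨C, hC, key⟩ := MeanField.exists_semiconcavity_bound h hOCP hSC2 hr
  refine ⟨C, hC, fun τ hτ μ₁ μ₂ hμ₁ hμ₂ s hs γ => ?_⟩
  -- Isolating the value at the interpolation reduces the claim to a lower bound for each of its
  -- attainable costs.
  rw [sub_le_iff_le_add', ← sub_le_iff_le_add]
  refine (hglb τ hτ _).2 fun c hc => ?_
  obtain ⟨c₁, hc₁, c₂, hc₂, hle⟩ := key τ hτ μ₁ μ₂ hμ₁ hμ₂ s hs γ c hc
  have h1 := mul_le_mul_of_nonneg_left ((hglb τ hτ μ₁).1 hc₁) (sub_nonneg.2 hs.2)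
  have h2 := mul_le_mul_of_nonneg_left ((hglb τ hτ μ₂).1 hc₂) hs.1
  linarith
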